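/- Let $R$ be a commutative ring with $1$, let $q, Q_1,\dots,Q_r \in R$ with $q$ invertible, and let $n \ge 0$. For a finite family $\mathbf{P}=(P_1,\dots,P_s)$ of elements of $R$ and $m\ge 0$, let $\mathcal{H}_{q,\mathbf{P}}(m)$ be the Ariki–Koike algebra: the associative unital $R$-algebra with generators $T_0,T_1,\dots,T_{m-1}$ and relations $$\begin{aligned} (T_0-P_1)\cdots(T_0-P_s)&=0 &&\text{if } m\ge 1,\\ T_0T_1T_0T_1&=T_1T_0T_1T_0 &&\text{if } m\ge 2,\\ (T_i+1)(T_i-q)&=0 &&\text{for } 1\le i\le m-1,\\ T_{i+1}T_iT_{i+1}&=T_iT_{i+1}T_i &&\text{for } 1\le i\le m-2,\\ T_iT_j&=T_jT_i &&\text{for } 0\le i<j-1\le m-2, \end{aligned}$$ so that $\mathcal{H}_{q,\mathbf{P}}(0)=R$. Suppose that the family $\mathbf{Q}=(Q_1,\dots,Q_r)$ is partitioned as a disjoint union $\mathbf{Q}=\mathbf{Q}_1\amalg\dots\amalg\mathbf{Q}_\kappa$ of subfamilies (each index $i$ is assigned to exactly one of the $\kappa$ pieces), and that $$f_\Pi(q,\mathbf{Q})=\prod_{1\le\alpha<\beta\le\kappa}\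 \prod_{Q_i\in\mathbf{Q}_\alpha,\ Q_j\in\mathbf{Q}_\beta}\ \prod_{-n<a<n}(q^aQ_i-Q_j)$$ is an invertible element of $R$. Then $\mathcal{H}_{q,\mathbf{Q}}(n)$ is Morita equivalent, as an $R$-algebra (that is, the module categories are equivalent as $R$-linear categories), to $$\bigoplus_{\substack{n_1,\dots,n_\kappa\ge 0\\ n_1+\dots+n_\kappa=n}}\mathcal{H}_{q,\mathbf{Q}_1}(n_1)\otimes_R\mathcal{H}_{q,\mathbf{Q}_2}(n_2)\otimes_R\dots\otimes_R\mathcal{H}_{q,\mathbf{Q}_\kappa}(n_\kappa).$$ -/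

import Mathlib

open scoped TensorProduct

universe u v

noncomputable section

/-- The defining relations of the Ariki-Koike algebra on the free `R`-algebra with generators
`T_0, ..., T_{n-1}` (indexed by `Fin n`). The parameters are a finite family `Q : ι → R`.
For `n = 0` there are no generators and no relations. -/
inductive ArikiKoikeRel {R : Type u} [CommRing R] (q : R) {ι : Type v} [Fintype ι] (Q : ι → R)
    (n : ℕ) : FreeAlgebra R (Fin n) → FreeAlgebra R (Fin n) → Prop
  /-- `∏ₖ (T_0 - Q_k) = 0`; all the factors commute, being polynomials in `T_0`. -/
  | cyclotomic (i : Fin n) (hi : (i : ℕ) = 0) :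
      ArikiKoikeRel q Q n
        (Polynomial.aeval (FreeAlgebra.ι R i)
          (∏ k, (Polynomial.X - Polynomial.C (Q k)) : Polynomial R)) 0
  /-- `T_0 T_1 T_0 T_1 = T_1 T_0 T_1 T_0`. -/
  | braidFour (i j : Fin n) (hi : (i : ℕ) = 0) (hj : (j : ℕ) = 1) :
      ArikiKoikeRel q Q n
        (FreeAlgebra.ι R i * FreeAlgebra.ι R j * FreeAlgebra.ι R i * FreeAlgebra.ι R j)
        (FreeAlgebra.ι R j * FreeAlgebra.ι R i * FreeAlgebra.ι R j * FreeAlgebra.ι R i)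
  /-- `(T_i + 1)(T_i - q) = 0` for `i ≥ 1`. -/
  | quadratic (i : Fin n) (hi : 1 ≤ (i : ℕ)) :
      ArikiKoikeRel q Q n
        ((FreeAlgebra.ι R i + 1) *
          (FreeAlgebra.ι R i - algebraMap R (FreeAlgebra R (Fin n)) q)) 0
  /-- `T_{i+1} T_i T_{i+1} = T_i T_{i+1} T_i` for `i ≥ 1`. -/
  | braid (i j : Fin n) (hi : 1 ≤ (i : ℕ)) (hj : (j : ℕ) = i + 1) :
      ArikiKoikeRel q Q n
        (FreeAlgebra.ι R j * FreeAlgebra.ι R i * FreeAlgebra.ι R j)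
        (FreeAlgebra.ι R i * FreeAlgebra.ι R j * FreeAlgebra.ι R i)
  /-- `T_i T_j = T_j T_i` for `0 ≤ i < j - 1`. -/
  | comm (i j : Fin n) (hij : (i : ℕ) + 1 < j) :
      ArikiKoikeRel q Q n
        (FreeAlgebra.ι R i * FreeAlgebra.ι R j)
        (FreeAlgebra.ι R j * FreeAlgebra.ι R i)

/-- The Ariki-Koike algebra `H_{q,Q}(n)`: the associative unital `R`-algebra presented by the
generators `T_0, ..., T_{n-1}` and the relations `ArikiKoikeRel q Q n`. -/
def ArikiKoike {R : Type u} [CommRing R] (q : R) {ι : Type v} [Fintype ι] (Q : ι → R)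
    (n : ℕ) : Type u :=
  RingQuot (ArikiKoikeRel q Q n)

instance ArikiKoike.instRing {R : Type u} [CommRing R] (q : R) {ι : Type v} [Fintype ι]
    (Q : ι → R) (n : ℕ) : Ring (ArikiKoike q Q n) :=
  inferInstanceAs (Ring (RingQuot (ArikiKoikeRel q Q n)))

instance ArikiKoike.instAlgebra {R : Type u} [CommRing R] (q : R) {ι : Type v} [Fintype ι]
    (Q : ι → R) (n : ℕ) : Algebra R (ArikiKoike q Q n) :=
  inferInstanceAs (Algebra R (RingQuot (ArikiKoikeRel q Q n)))

/-- The piece `Q_α` of the parameter family `Q_1, ..., Q_r` under the partitioning in which the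
parameter with index `i` lies in the piece with label `c i`: the subfamily of those `Q_i` with
`c i = α`. -/
def paramPiece {R : Type u} {r κ : ℕ} (Q : Fin r → R) (c : Fin r → Fin κ) (α : Fin κ) :
    {i : Fin r // c i = α} → R :=
  fun i => Q i

/-- `∏_{α < β} ∏_{Q_i ∈ Q_α, Q_j ∈ Q_β} ∏_{-n < a < n} (q^a Q_i - Q_j)`. -/
def partitionPoly {R : Type u} [CommRing R] (q : Rˣ) {r κ : ℕ} (Q : Fin r → R)
    (c : Fin r → Fin κ) (n : ℕ) : R :=
  ∏ p : Fin κ × Fin κ with p.1 < p.2,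
    ∏ i : {i : Fin r // c i = p.1}, ∏ j : {j : Fin r // c j = p.2},
      ∏ a ∈ Finset.Ioo (-(n : ℤ)) (n : ℤ),
        (((q ^ a : Rˣ) : R) * paramPiece Q c p.1 i - paramPiece Q c p.2 j)

/-- The algebra `⨁_{n_1 + ... + n_κ = n} H_{q,Q_1}(n_1) ⊗ ... ⊗ H_{q,Q_κ}(n_κ)`. The index set is
finite, so the direct sum of algebras is the product, with componentwise operations; the tensor
products are over `R`. -/
abbrev PartitionedArikiKoike {R : Type u} [CommRing R] (q : R) {r κ : ℕ} (Q : Fin r → R)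
    (c : Fin r → Fin κ) (n : ℕ) : Type u :=
  ∀ m : {m : Fin κ → ℕ // ∑ α, m α = n},
    ⨂[R] α : Fin κ, ArikiKoike q (paramPiece Q c α) (m.1 α)

end

/-! The Jucys-Murphy elements `X_0 = T_0`, `X_{i+1} = q⁻¹ T_{i+1} X_i T_{i+1}` of `H = H_{q,Q}(n)`
generate a commutative subalgebra `D`, and together with the `T_i`, `i ≥ 1`, they satisfy the
relations of the affine Hecke algebra of type `A`. With the intertwiners `T x_k - x_k T` one sees that
the generalized eigenvalues of `X_i` are residues `q^a Q_k` with `|a| ≤ i`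
(`IsAffineHecke.specIn_jucysMurphy`). Call the pieces of the partition of `Q` colors. Since `f_Π` is
invertible, residues of different colors have invertible differences, and the Chinese remainder
theorem yields a complete family of orthogonal idempotents `E w` of `D`, indexed by the words `w` of
length `n` in the colors: on the part cut out by `E w`, the eigenvalues of `X_p` have the color `w p`
(`exists_isWordIdempotents_of_le`).

Where two adjacent letters of `w` differ, the square of the intertwiner is invertible, so that the
intertwiner identifies the part of `w` with the part of the word in which these letters are exchanged.
Hence every `E w` is equivalent to the idempotent of the sorted word (`exists_sorter_mul`), and the sum
`e` of the idempotents of the increasing words, of which there is one for each content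
`(n_1, ..., n_κ)`, is a full idempotent. So `H` is Morita equivalent to `e H e`
(`isMoritaEquivalent_of_full_corner`).

In the corner of an increasing word, the generators between equal letters and the first Jucys-Murphy
element of each letter satisfy the relations of `H_{q,Q_1}(n_1) ⊗ ... ⊗ H_{q,Q_κ}(n_κ)`
(`exists_cornerHom`). The resulting homomorphism is onto the corner, and the corners of different
contents are orthogonal, because the elements sorting a word carry generators between equal letters to
such generators, by the braid relations of the intertwiners (`IsCornerAlgebra.corner_mem`). For
injectivity no basis of `H` is needed: `H` acts on the functions on the words of the given content with
values in the tensor product, by formulas modelled on the action of `T_i` on the parts `E w`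
(`ArikiKoike.exists_wordRep`), and on the functions supported at the increasing word the image of an
element `a` of the tensor product acts as left multiplication by `a` (`cornerHom_injective`).
-/

noncomputable section

/-! ### Morita equivalence from a full corner -/

section Morita

open CategoryTheory

variable {R : Type u} [CommRing R] {S B : Type u} [Ring S] [Algebra R S] [Ring B] [Algebra R B]

/-- For a non-unital algebra map `ψ : B → S`, the elements of an `S`-module that are fixed by the
idempotent `ψ 1`. -/
def cornerFixed (ψ : B →ₙₐ[R] S) (M : Type*) [AddCommGroup M] [Module S M] : AddSubgroup M where
  carrier := {m | ψ 1 • m = m}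
  add_mem' {a b} ha hb := by
    simp only [Set.mem_ofPred_eq] at ha hb ⊢
    rw [smul_add, ha, hb]
  zero_mem' := smul_zero _
  neg_mem' {a} ha := by
    simp only [Set.mem_ofPred_eq] at ha ⊢
    rw [smul_neg, ha]

lemma corner_smul_mem (ψ : B →ₙₐ[R] S) {M : Type*} [AddCommGroup M] [Module S M] (b : B) (m : M) :
    ψ b • m ∈ cornerFixed ψ M := by
  change ψ 1 • ψ b • m = ψ b • m
  rw [← mul_smul, ← map_mul, one_mul]

instance cornerFixedModule (ψ : B →ₙₐ[R] S) (M : Type*) [AddCommGroup M] [Module S M] :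
    Module B (cornerFixed ψ M) where
  smul b m := ⟨ψ b • m.1, corner_smul_mem ψ b m.1⟩
  one_smul m := Subtype.ext m.2
  mul_smul a b m := Subtype.ext (by
    change ψ (a * b) • m.1 = ψ a • ψ b • m.1
    rw [map_mul, mul_smul])
  smul_zero a := Subtype.ext (smul_zero (ψ a))
  smul_add a m m' := Subtype.ext (smul_add (ψ a) m.1 m'.1)
  add_smul a b m := Subtype.ext (by
    change ψ (a + b) • m.1 = ψ a • m.1 + ψ b • m.1
    rw [map_add, add_smul])
  zero_smul m := Subtype.ext (by
    change ψ 0 • m.1 = 0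
    rw [map_zero, zero_smul])

lemma cornerFixed_coe_smul (ψ : B →ₙₐ[R] S) {M : Type*} [AddCommGroup M] [Module S M] (b : B)
    (m : cornerFixed ψ M) : ((b • m : cornerFixed ψ M) : M) = ψ b • (m : M) := rfl

/-- The functor `M ↦ ψ(1) M` from `S`-modules to `B`-modules. -/
def cornerFunctor (ψ : B →ₙₐ[R] S) : ModuleCat.{u} S ⥤ ModuleCat.{u} B where
  obj M := ModuleCat.of B (cornerFixed ψ M)
  map {M N} f := ModuleCat.ofHom
    { toFun m := ⟨f.hom m.1, by
        change ψ 1 • f.hom m.1 = f.hom m.1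
        rw [← map_smul, show ψ 1 • m.1 = m.1 from m.2]⟩
      map_add' _ _ := Subtype.ext (map_add f.hom _ _)
      map_smul' b m := Subtype.ext (map_smul f.hom (ψ b) m.1) }
  map_id _ := rfl
  map_comp _ _ := rfl

/-- The module of coinduced functions `f : S → N`, with `f (ψ b * s) = b • f s`. -/
def cornerCoind (ψ : B →ₙₐ[R] S) (N : Type u) [AddCommGroup N] [Module B N] :
    AddSubgroup (S →+ N) where
  carrier := {f | ∀ b s, f (ψ b * s) = b • f s}
  add_mem' {f g} hf hg b s := by simp [hf b s, hg b s]
  zero_mem' _ _ := by simp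
  neg_mem' {f} hf b s := by simp [hf b s]

instance cornerCoindModule (ψ : B →ₙₐ[R] S) (N : Type u) [AddCommGroup N] [Module B N] :
    Module S (cornerCoind ψ N) where
  smul t f := ⟨f.1.comp (AddMonoidHom.mulRight t), fun b s => by
    simpa [mul_assoc] using f.2 b (s * t)⟩
  one_smul f := Subtype.ext (AddMonoidHom.ext fun s => congrArg f.1 (mul_one s))
  mul_smul a b f := Subtype.ext (AddMonoidHom.ext fun s => congrArg f.1 (mul_assoc s a b).symm)
  smul_zero _ := rfl
  smul_add _ _ _ := rfl
  add_smul a b f := Subtype.ext (AddMonoidHom.ext fun s =>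
    (congrArg f.1 (mul_add s a b)).trans (map_add f.1 _ _))
  zero_smul f := Subtype.ext (AddMonoidHom.ext fun s =>
    (congrArg f.1 (mul_zero s)).trans (map_zero f.1))

open scoped ModuleCat.Algebra in
/-- If `B` is carried isomorphically onto a corner `e S e` by `ψ`, and the idempotent `e = ψ 1`
generates the unit ideal, then `S` and `B` are Morita equivalent. -/
theorem isMoritaEquivalent_of_full_corner (ψ : B →ₙₐ[R] S) (hinj : Function.Injective ψ)
    (hsurj : ∀ s, ∃ b, ψ b = ψ 1 * s * ψ 1) {ι : Type*} [Fintype ι] (x y : ι → S)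
    (hfull : ∑ i, x i * ψ 1 * y i = 1) : IsMoritaEquivalent R S B := by
  have hdec : ∀ {M : Type u} [AddCommGroup M] [Module S M] (m : M),
      ∑ i, x i • ψ 1 • y i • m = m := fun m => by
    simp_rw [← mul_smul, ← Finset.sum_smul, ← mul_assoc, hfull, one_smul]
  have hfaith : (cornerFunctor ψ).Faithful := by
    refine ⟨fun {M N} f g hfg => ?_⟩
    ext m
    have key : ∀ m ∈ cornerFixed ψ M, f.hom m = g.hom m := fun m hm =>
      congrArg Subtype.val (congrArg (fun h => h.hom ⟨m, hm⟩) hfg)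
    rw [← hdec m]
    simp only [map_sum, map_smul f.hom (x _), map_smul g.hom (x _)]
    exact Finset.sum_congr rfl fun i _ => by rw [key _ (corner_smul_mem ψ 1 _)]
  have hfullf : (cornerFunctor ψ).Full := by
    refine ⟨fun {M N} g => ?_⟩
    let g' : cornerFixed ψ M →ₗ[B] cornerFixed ψ N := g.hom
    let P : S → M → cornerFixed ψ M := fun s m => ⟨ψ 1 • s • m, corner_smul_mem ψ 1 _⟩
    have hP : ∀ s t m, P (s * t) m = P s (t • m) := fun s t m => Subtype.ext (by
      simp only [P, mul_smul])
    have hPadd : ∀ s m m', P s (m + m') = P s m + P s m' := fun s m m' => Subtype.ext (by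
      simp [P])
    have hPsum : ∀ s (f : ι → M), P s (∑ i, f i) = ∑ i, P s (f i) := fun s f => Subtype.ext (by
      simp [P, Finset.smul_sum])
    -- a matrix coefficient `ψ 1 * s * ψ 1` acts through `B`
    have hPs : ∀ s (m : M), (g' (P s (ψ 1 • m)) : N) = ψ 1 • s • (g' (P 1 m) : N) := by
      intro s m
      obtain ⟨b, hb⟩ := hsurj s
      have h1 : P s (ψ 1 • m) = b • P 1 m := Subtype.ext (by
        rw [cornerFixed_coe_smul, hb]
        simp only [P, ← mul_smul]
        congr 1
        simp only [mul_assoc, mul_one]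
        rw [← map_mul, one_mul])
      rw [h1, map_smul, cornerFixed_coe_smul, hb, mul_smul, mul_smul]
      congr 2
      exact (g' (P 1 m)).2
    have hlin : ∀ (s : S) (m : M), ∑ i, x i • (g' (P (y i) (s • m)) : N)
        = s • ∑ i, x i • (g' (P (y i) m) : N) := by
      intro s m
      have h2 : ∀ i, (g' (P (y i) (s • m)) : N)
          = ∑ j, ψ 1 • y i • s • x j • (g' (P (y j) m) : N) := by
        intro i
        conv_lhs => rw [← hdec m]
        rw [Finset.smul_sum, hPsum, map_sum, AddSubgroup.val_finsetSum]
        refine Finset.sum_congr rfl fun j _ => ?_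
        rw [← mul_smul s, ← hP, hPs, ← hP, one_mul]
        simp only [mul_smul]
      simp_rw [h2, Finset.smul_sum]
      rw [Finset.sum_comm]
      exact Finset.sum_congr rfl fun j _ => hdec _
    refine ⟨ModuleCat.ofHom
      { toFun m := ∑ i, x i • (g' (P (y i) m) : N)
        map_add' m m' := by simp [hPadd, Finset.sum_add_distrib]
        map_smul' := hlin }, ?_⟩
    refine ModuleCat.hom_ext (LinearMap.ext fun (m : cornerFixed ψ M) => Subtype.ext ?_)
    change ∑ i, x i • (g' (P (y i) m.1) : N) = (g' m : N)
    have hm : ∀ i, (g' (P (y i) m.1) : N) = ψ 1 • y i • (g' m : N) := by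
      intro i
      have h3 := hPs (y i) m.1
      have h4 : P 1 m.1 = m := Subtype.ext (by
        change ψ 1 • (1 : S) • m.1 = m.1
        rw [one_smul]
        exact m.2)
      rwa [show ψ 1 • m.1 = m.1 from m.2, h4] at h3
    simp_rw [hm]
    exact hdec _
  have hess : (cornerFunctor ψ).EssSurj := by
    refine ⟨fun N => ⟨ModuleCat.of S (cornerCoind ψ N), ⟨?_⟩⟩⟩
    choose κ hκ using hsurj
    have hκadd : ∀ s t, κ (s + t) = κ s + κ t := fun s t => hinj (by
      rw [map_add, hκ, hκ, hκ, mul_add, add_mul])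
    have hκmul : ∀ b s, κ (ψ b * s) = b * κ s := fun b s => hinj (by
      rw [map_mul, hκ, hκ, ← mul_assoc, ← mul_assoc, ← mul_assoc, ← map_mul, ← map_mul, one_mul,
        mul_one])
    have hκψ : ∀ b, κ (ψ b) = b := fun b => hinj (by
      rw [hκ, ← map_mul, ← map_mul, one_mul, mul_one])
    have hκ1 : ∀ s, κ (s * ψ 1) = κ s := fun s => hinj (by
      rw [hκ, hκ, mul_assoc, mul_assoc, ← map_mul, one_mul, ← mul_assoc])
    have hfix : ∀ (f : cornerFixed ψ (cornerCoind ψ N)) s, f.1.1 (s * ψ 1) = f.1.1 s :=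
      fun f s => congrArg (fun h : cornerCoind ψ N => h.1 s) f.2
    have hval : ∀ (f : cornerFixed ψ (cornerCoind ψ N)) s,
        f.1.1 s = κ s • f.1.1 (ψ 1) := fun f s => by
      rw [← f.1.2, ← map_mul ψ, mul_one, hκ, hfix f, f.1.2, one_smul]
    let F : cornerFixed ψ (cornerCoind ψ N) →ₗ[B] N :=
      { toFun f := f.1.1 (ψ 1)
        map_add' _ _ := rfl
        map_smul' b f := by
          change f.1.1 (ψ 1 * ψ b) = b • f.1.1 (ψ 1)
          rw [hval, ← map_mul, one_mul, hκψ] }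
    refine LinearEquiv.toModuleIso (LinearEquiv.ofBijective F ⟨?_, ?_⟩)
    · refine (injective_iff_map_eq_zero F).2 fun f hf => ?_
      refine Subtype.ext (Subtype.ext (AddMonoidHom.ext fun s => ?_))
      rw [hval]
      change κ s • F f = 0
      rw [hf, smul_zero]
    · intro n
      refine ⟨⟨⟨⟨⟨fun s => κ s • n, ?_⟩, fun s t => ?_⟩, fun b s => ?_⟩, ?_⟩, ?_⟩
      · change κ 0 • n = 0
        have : κ 0 = 0 := hinj (by rw [hκ]; simp)
        rw [this, zero_smul]
      · change κ (s + t) • n = κ s • n + κ t • n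
        rw [hκadd, add_smul]
      · change κ (ψ b * s) • n = b • κ s • n
        rw [hκmul, mul_smul]
      · refine Subtype.ext (AddMonoidHom.ext fun s => ?_)
        change κ (s * ψ 1) • n = κ s • n
        rw [hκ1]
      · change κ (ψ 1) • n = n
        rw [hκψ, one_smul]
  have : (cornerFunctor ψ).IsEquivalence := { }
  refine ⟨⟨(cornerFunctor ψ).asEquivalence, ?_⟩⟩
  refine ⟨fun {M N} f r => ?_⟩
  ext m
  refine Subtype.ext ?_
  change algebraMap R S r • f.hom m.1 = ψ (algebraMap R B r) • f.hom m.1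
  have hm : f.hom m.1 = ψ 1 • f.hom m.1 := by
    rw [← map_smul, show ψ 1 • m.1 = m.1 from m.2]
  rw [Algebra.algebraMap_eq_smul_one, Algebra.algebraMap_eq_smul_one, map_smul, hm, ← mul_smul,
    ← mul_smul, smul_mul_assoc, smul_mul_assoc, one_mul, ← map_mul, one_mul]

end Morita

/-! ### Generators of the Ariki-Koike algebra -/

section Generators

variable {R : Type u} [CommRing R] (q : R) {J : Type v} [Fintype J] (P : J → R) (n : ℕ)

/-- The generator `T_i` of the Ariki-Koike algebra, with value `0` for `i ≥ n`. -/
def ArikiKoike.gen (i : ℕ) : ArikiKoike q P n :=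
  if h : i < n then RingQuot.mkAlgHom R (ArikiKoikeRel q P n) (FreeAlgebra.ι R ⟨i, h⟩) else 0

variable {q P n}

lemma ArikiKoike.gen_of_lt {i : ℕ} (h : i < n) : ArikiKoike.gen q P n i =
    RingQuot.mkAlgHom R (ArikiKoikeRel q P n) (FreeAlgebra.ι R ⟨i, h⟩) := dif_pos h

lemma ArikiKoike.gen_cyclotomic (h : 0 < n) :
    Polynomial.aeval (ArikiKoike.gen q P n 0)
      (∏ k, (Polynomial.X - Polynomial.C (P k)) : Polynomial R) = 0 := by
  have := RingQuot.mkAlgHom_rel R (ArikiKoikeRel.cyclotomic (q := q) (Q := P) (⟨0, h⟩ : Fin n) rfl)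
  rw [gen_of_lt h]
  rw [← Polynomial.aeval_algHom_apply, map_zero] at this
  exact this

lemma ArikiKoike.gen_braidFour (h : 1 < n) :
    gen q P n 0 * gen q P n 1 * gen q P n 0 * gen q P n 1 =
      gen q P n 1 * gen q P n 0 * gen q P n 1 * gen q P n 0 := by
  have := RingQuot.mkAlgHom_rel R (ArikiKoikeRel.braidFour (q := q) (Q := P)
    (⟨0, by lia⟩ : Fin n) ⟨1, h⟩ rfl rfl)
  rw [gen_of_lt h, gen_of_lt (by lia : 0 < n)]
  simp only [map_mul] at this
  exact this

lemma ArikiKoike.gen_quadratic {i : ℕ} (h1 : 1 ≤ i) (h : i < n) :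
    gen q P n i * gen q P n i = (q - 1) • gen q P n i + q • 1 := by
  have := RingQuot.mkAlgHom_rel R (ArikiKoikeRel.quadratic (q := q) (Q := P)
    (⟨i, h⟩ : Fin n) h1)
  rw [gen_of_lt h]
  rw [map_zero, map_mul, map_add, map_sub, map_one, AlgHom.commutes,
    Algebra.algebraMap_eq_smul_one] at this
  have h2 : ∀ t : RingQuot (ArikiKoikeRel q P n), t * t - ((q - 1) • t + q • 1)
      = (t + 1) * (t - q • 1) := fun t => by
    simp only [add_mul, mul_sub, mul_smul_comm, mul_one, one_mul]
    module
  exact sub_eq_zero.1 ((h2 _).trans this)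

lemma ArikiKoike.gen_braid {i : ℕ} (h1 : 1 ≤ i) (h : i + 1 < n) :
    gen q P n (i + 1) * gen q P n i * gen q P n (i + 1) =
      gen q P n i * gen q P n (i + 1) * gen q P n i := by
  have := RingQuot.mkAlgHom_rel R (ArikiKoikeRel.braid (q := q) (Q := P)
    (⟨i, by lia⟩ : Fin n) ⟨i + 1, h⟩ h1 rfl)
  rw [gen_of_lt h, gen_of_lt (by lia : i < n)]
  simp only [map_mul] at this
  exact this

lemma ArikiKoike.gen_commute {i j : ℕ} (hij : i + 1 < j) (h : j < n) :
    Commute (gen q P n i) (gen q P n j) := by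
  have := RingQuot.mkAlgHom_rel R (ArikiKoikeRel.comm (q := q) (Q := P)
    (⟨i, by lia⟩ : Fin n) ⟨j, h⟩ hij)
  rw [gen_of_lt h, gen_of_lt (by lia : i < n)]
  simp only [map_mul] at this
  exact this

/-- The universal property: elements `x` and `t 0, t 1, ...` satisfying the defining relations, with
`x` in the role of `T_0` and `t i` in the role of `T_{i+1}`, define an algebra map. -/
lemma ArikiKoike.exists_algHom {S : Type*} [Ring S] [Algebra R S] (x : S) (t : ℕ → S)
    (hcyc : 0 < n → Polynomial.aeval x (∏ k, (Polynomial.X - Polynomial.C (P k)) :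
      Polynomial R) = 0)
    (hfour : 1 < n → x * t 0 * x * t 0 = t 0 * x * t 0 * x)
    (hquad : ∀ i, i + 1 < n → t i * t i = (q - 1) • t i + q • 1)
    (hbraid : ∀ i, i + 2 < n → t (i + 1) * t i * t (i + 1) = t i * t (i + 1) * t i)
    (hfar : ∀ i j, i + 1 < j → j + 1 < n → Commute (t i) (t j))
    (hx : ∀ j, 1 ≤ j → j + 1 < n → Commute x (t j)) :
    ∃ f : ArikiKoike q P n →ₐ[R] S, (0 < n → f (gen q P n 0) = x) ∧
      ∀ i, i + 1 < n → f (gen q P n (i + 1)) = t i := by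
  let t' : ℕ → S := fun i => if i = 0 then x else t (i - 1)
  have ht0 : t' 0 = x := rfl
  have hts : ∀ i, t' (i + 1) = t i := fun i => rfl
  have key : ∀ ⦃a b : FreeAlgebra R (Fin n)⦄, ArikiKoikeRel q P n a b →
      FreeAlgebra.lift R (fun i : Fin n => t' i) a
        = FreeAlgebra.lift R (fun i : Fin n => t' i) b := by
    intro a b hab
    induction hab with
    | cyclotomic i hi =>
      rw [← Polynomial.aeval_algHom_apply, FreeAlgebra.lift_ι_apply, hi, ht0, map_zero]
      exact hcyc (by have := i.2; lia)
    | braidFour i j hi hj =>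
      simp only [map_mul, FreeAlgebra.lift_ι_apply, hi, hj]
      exact hfour (by have := j.2; lia)
    | quadratic i hi =>
      simp only [map_mul, map_add, map_sub, FreeAlgebra.lift_ι_apply, map_one, AlgHom.commutes,
        map_zero]
      obtain ⟨k, hk⟩ : ∃ k, (i : ℕ) = k + 1 := ⟨i - 1, by lia⟩
      have h2 := hquad k (by have := i.2; lia)
      rw [hk, hts, Algebra.algebraMap_eq_smul_one]
      simp only [add_mul, mul_sub, mul_smul_comm, mul_one, one_mul, h2]
      module
    | braid i j hi hj =>
      simp only [map_mul, FreeAlgebra.lift_ι_apply, hj]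
      obtain ⟨k, hk⟩ : ∃ k, (i : ℕ) = k + 1 := ⟨i - 1, by lia⟩
      rw [hk, hts, hts]
      exact hbraid k (by have := j.2; lia)
    | comm i j hij =>
      simp only [map_mul, FreeAlgebra.lift_ι_apply]
      obtain ⟨l, hl⟩ : ∃ l, (j : ℕ) = l + 1 := ⟨j - 1, by lia⟩
      have := j.2
      rcases Nat.eq_zero_or_pos (i : ℕ) with h0 | h0
      · rw [h0, hl, ht0, hts]
        exact hx l (by lia) (by lia)
      · obtain ⟨k, hk⟩ : ∃ k, (i : ℕ) = k + 1 := ⟨i - 1, by lia⟩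
        rw [hk, hl, hts, hts]
        exact hfar k l (by lia) (by lia)
  refine ⟨RingQuot.liftAlgHom R ⟨FreeAlgebra.lift R (fun i : Fin n => t' i), key⟩,
    fun h => ?_, fun i h => ?_⟩
  · rw [gen_of_lt h]
    exact (RingQuot.liftAlgHom_mkAlgHom_apply R _ key _).trans (FreeAlgebra.lift_ι_apply _ _)
  · rw [gen_of_lt h]
    exact (RingQuot.liftAlgHom_mkAlgHom_apply R _ key _).trans (FreeAlgebra.lift_ι_apply _ _)

/-- The generators generate. -/
lemma ArikiKoike.eq_top_of_gen_mem (A : Subalgebra R (ArikiKoike q P n))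
    (hA : ∀ i < n, gen q P n i ∈ A) : A = ⊤ := by
  refine Algebra.eq_top_iff.2 fun a => ?_
  obtain ⟨b, rfl⟩ := RingQuot.mkAlgHom_surjective R (ArikiKoikeRel q P n) a
  induction b using FreeAlgebra.induction with
  | grade0 r => rw [AlgHom.commutes]; exact A.algebraMap_mem r
  | grade1 i => rw [← gen_of_lt i.2]; exact hA i i.2
  | mul a b ha hb => rw [map_mul]; exact A.mul_mem ha hb
  | add a b ha hb => rw [map_add]; exact A.add_mem ha hb

end Generators

/-! ### Affine Hecke relations -/

section AffineHecke

variable {R : Type u} [CommRing R] {S : Type*} [Ring S] [Algebra R S] {D : Type*} [CommRing D]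
  [Algebra R D]

/-- The relations of the affine Hecke algebra of type `A` on `n` strands: `T k`, for `k + 1 < n`,
are the braid-like generators, acting on the positions `k` and `k + 1`, and `x 0, ..., x (n - 1)`
are the Jucys-Murphy elements. The latter live in a commutative algebra `D` which is mapped to `S`
by `j`. -/
structure IsAffineHecke (q : Rˣ) (n : ℕ) (j : D →ₐ[R] S) (T : ℕ → S) (x : ℕ → D) : Prop where
  quad : ∀ k, k + 1 < n → T k * T k = ((q : R) - 1) • T k + (q : R) • 1
  braid : ∀ k, k + 2 < n → T (k + 1) * T k * T (k + 1) = T k * T (k + 1) * T k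
  far : ∀ k l, k + 1 < l → l + 1 < n → Commute (T k) (T l)
  comm : ∀ k l, k + 1 < n → l < n → l ≠ k → l ≠ k + 1 → Commute (T k) (j (x l))
  shift : ∀ k, k + 1 < n → T k * j (x k) * T k = (q : R) • j (x (k + 1))

/-- The intertwiner `T x_k - x_k T`. -/
def intertwiner (j : D →ₐ[R] S) (T : ℕ → S) (x : ℕ → D) (k : ℕ) : S :=
  T k * j (x k) - j (x k) * T k

namespace IsAffineHecke

variable {q : Rˣ} {n : ℕ} {j : D →ₐ[R] S} {T : ℕ → S} {x : ℕ → D}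

lemma jcomm (j : D →ₐ[R] S) (a b : D) : j a * j b = j b * j a := by
  rw [← map_mul, mul_comm, map_mul]

/-- A unit scalar may be cancelled. -/
lemma smul_cancel (q : Rˣ) {a b : S} (h : (q : R) • a = (q : R) • b) : a = b := by
  have := congrArg (((q⁻¹ : Rˣ) : R) • ·) h
  simpa [smul_smul] using this

lemma succ_mul (h : IsAffineHecke q n j T x) {k : ℕ} (hk : k + 1 < n) :
    j (x (k + 1)) * T k = T k * j (x k) + ((q : R) - 1) • j (x (k + 1)) := by
  apply smul_cancel q
  rw [← smul_mul_assoc, ← h.shift k hk, mul_assoc, h.quad k hk, smul_add,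
    smul_comm (q : R) ((q : R) - 1), ← h.shift k hk]
  simp only [mul_add, mul_smul_comm, mul_one]
  module

lemma mul_succ (h : IsAffineHecke q n j T x) {k : ℕ} (hk : k + 1 < n) :
    T k * j (x (k + 1)) = j (x k) * T k + ((q : R) - 1) • j (x (k + 1)) := by
  apply smul_cancel q
  rw [← mul_smul_comm, ← h.shift k hk, ← mul_assoc, ← mul_assoc, h.quad k hk, smul_add,
    smul_comm (q : R) ((q : R) - 1), ← h.shift k hk]
  simp only [add_mul, smul_mul_assoc, one_mul]
  module

lemma self_mul (h : IsAffineHecke q n j T x) {k : ℕ} (hk : k + 1 < n) :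
    j (x k) * T k = T k * j (x (k + 1)) - ((q : R) - 1) • j (x (k + 1)) := by
  rw [h.mul_succ hk, add_sub_cancel_right]

lemma intertwiner_eq (h : IsAffineHecke q n j T x) {k : ℕ} (hk : k + 1 < n) :
    intertwiner j T x k = T k * j (x k - x (k + 1)) + ((q : R) - 1) • j (x (k + 1)) := by
  rw [intertwiner, h.self_mul hk, map_sub, mul_sub]
  abel

lemma intertwiner_mul_self (h : IsAffineHecke q n j T x) {k : ℕ} (hk : k + 1 < n) :
    intertwiner j T x k * j (x k) = j (x (k + 1)) * intertwiner j T x k := by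
  rw [intertwiner, mul_sub, ← mul_assoc (j (x (k + 1))), h.succ_mul hk,
    ← mul_assoc (j (x (k + 1))), jcomm j (x (k + 1)), mul_assoc (j (x k)) (j (x (k + 1))),
    h.succ_mul hk]
  simp only [mul_add, sub_mul, add_mul, mul_smul_comm, smul_mul_assoc, mul_assoc]
  rw [jcomm j (x (k + 1))]
  abel

lemma intertwiner_mul_succ (h : IsAffineHecke q n j T x) {k : ℕ} (hk : k + 1 < n) :
    intertwiner j T x k * j (x (k + 1)) = j (x k) * intertwiner j T x k := by
  rw [intertwiner, sub_mul, mul_assoc, jcomm j (x k), ← mul_assoc, mul_assoc (j (x k)),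
    h.mul_succ hk]
  simp only [mul_add, mul_sub, add_mul, mul_smul_comm, smul_mul_assoc, mul_assoc]
  rw [jcomm j (x (k + 1))]
  abel

lemma intertwiner_mul_of_ne (h : IsAffineHecke q n j T x) {k l : ℕ} (hk : k + 1 < n) (hl : l < n)
    (h1 : l ≠ k) (h2 : l ≠ k + 1) : Commute (intertwiner j T x k) (j (x l)) :=
  ((h.comm k l hk hl h1 h2).mul_left (jcomm j _ _)).sub_left
    (Commute.mul_left (jcomm j _ _) (h.comm k l hk hl h1 h2))

lemma intertwiner_mul_intertwiner (h : IsAffineHecke q n j T x) {k : ℕ} (hk : k + 1 < n) :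
    intertwiner j T x k * intertwiner j T x k =
      j (((q : R) • x k - x (k + 1)) * ((q : R) • x (k + 1) - x k)) := by
  have e1 : intertwiner j T x k * intertwiner j T x k
      = intertwiner j T x k * T k * j (x k - x (k + 1))
        + ((q : R) - 1) • (j (x k) * intertwiner j T x k) := by
    conv_lhs => rw [h.intertwiner_eq hk, ← h.intertwiner_eq hk]
    nth_rewrite 2 [h.intertwiner_eq hk]
    rw [mul_add, ← mul_assoc, mul_smul_comm, h.intertwiner_mul_succ hk]
  have e2 : intertwiner j T x k * T k = (q : R) • j (x (k + 1))
      - ((q : R) - 1) • (j (x k) * T k) - (q : R) • j (x k) := by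
    rw [intertwiner, sub_mul, h.shift k hk, mul_assoc, h.quad k hk]
    simp only [mul_add, mul_smul_comm, mul_one]
    abel
  rw [e1, e2, h.intertwiner_eq hk]
  simp only [map_mul, map_sub, map_smul, mul_add, mul_sub, sub_mul, mul_smul_comm, smul_mul_assoc,
    mul_assoc, smul_sub, smul_add]
  simp only [← mul_assoc (j (x k)) (T k), h.self_mul hk]
  simp only [sub_mul, mul_assoc, smul_mul_assoc, jcomm j (x (k + 1)) (x k)]
  module

end IsAffineHecke

end AffineHecke

section AffineHecke

variable {R : Type u} [CommRing R] {S : Type*} [Ring S] [Algebra R S] {D : Type*} [CommRing D]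
  [Algebra R D]

namespace IsAffineHecke

variable {q : Rˣ} {n : ℕ} {j : D →ₐ[R] S} {T : ℕ → S} {x : ℕ → D}

/-- The form of a rewriting rule which applies to right-associated products. -/
lemma reassoc₂ {a b c : S} (h : a * b = c) (w : S) : a * (b * w) = c * w := by
  rw [← h, mul_assoc]

lemma reassoc₃ {a b c d : S} (h : a * (b * c) = d) (w : S) : a * (b * (c * w)) = d * w := by
  rw [← h, mul_assoc, mul_assoc]

/-- Two intertwiners carry a generator `T_k` to `T_{k+1}`. Both sides are computed by moving the
Jucys-Murphy elements to the right. -/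
lemma intertwiner_mul_intertwiner_mul (h : IsAffineHecke q n j T x) {k : ℕ} (hk : k + 2 < n) :
    intertwiner j T x k * intertwiner j T x (k + 1) * T k =
      T (k + 1) * (intertwiner j T x k * intertwiner j T x (k + 1)) := by
  have hab := h.self_mul (k := k) (by lia)
  have hbb := h.succ_mul (k := k) (by lia)
  have hbc := h.self_mul (k := k + 1) (by lia)
  have hca : j (x (k + 1 + 1)) * T k = T k * j (x (k + 1 + 1)) :=
    ((h.comm k (k + 1 + 1) (by lia) (by lia) (by lia) (by lia)).eq).symm
  have hac : j (x k) * T (k + 1) = T (k + 1) * j (x k) :=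
    ((h.comm (k + 1) k (by lia) (by lia) (by lia) (by lia)).eq).symm
  have hq1 := h.quad k (by lia)
  have hq2 := h.quad (k + 1) (by lia)
  have hbr := h.braid k hk
  have hxy := jcomm j (x (k + 1)) (x k)
  have hyz := jcomm j (x (k + 1 + 1)) (x (k + 1))
  rw [intertwiner, intertwiner]
  generalize j (x k) = a at *
  generalize j (x (k + 1)) = b at *
  generalize j (x (k + 1 + 1)) = c at *
  generalize T k = s at *
  generalize T (k + 1) = t at *
  generalize (q : R) = p at *
  rw [mul_assoc, mul_assoc] at hbr
  simp only [mul_assoc, mul_add, add_mul, mul_sub, sub_mul, mul_smul_comm, smul_mul_assoc, one_mul,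
    hab, hbb, hbc, hca, reassoc₂ hab, reassoc₂ hbb, reassoc₂ hbc, reassoc₂ hca,
    reassoc₂ hac, reassoc₂ hq1, reassoc₂ hq2, reassoc₃ hbr, hxy, hyz]
  module

lemma intertwiner_mul_intertwiner_mul' (h : IsAffineHecke q n j T x) {k : ℕ} (hk : k + 2 < n) :
    intertwiner j T x (k + 1) * intertwiner j T x k * T (k + 1) =
      T k * (intertwiner j T x (k + 1) * intertwiner j T x k) := by
  have hab := h.self_mul (k := k) (by lia)
  have hbb := h.succ_mul (k := k) (by lia)
  have hbc := h.self_mul (k := k + 1) (by lia)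
  have hcc := h.succ_mul (k := k + 1) (by lia)
  have hca : j (x (k + 1 + 1)) * T k = T k * j (x (k + 1 + 1)) :=
    ((h.comm k (k + 1 + 1) (by lia) (by lia) (by lia) (by lia)).eq).symm
  have hac : j (x k) * T (k + 1) = T (k + 1) * j (x k) :=
    ((h.comm (k + 1) k (by lia) (by lia) (by lia) (by lia)).eq).symm
  have hq1 := h.quad k (by lia)
  have hq2 := h.quad (k + 1) (by lia)
  have hbr := h.braid k hk
  have hxy := jcomm j (x (k + 1)) (x k)
  have hxz := jcomm j (x (k + 1 + 1)) (x k)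
  have hyz := jcomm j (x (k + 1 + 1)) (x (k + 1))
  rw [intertwiner, intertwiner]
  generalize j (x k) = a at *
  generalize j (x (k + 1)) = b at *
  generalize j (x (k + 1 + 1)) = c at *
  generalize T k = s at *
  generalize T (k + 1) = t at *
  generalize (q : R) = p at *
  rw [mul_assoc, mul_assoc] at hbr
  simp only [mul_assoc, mul_add, add_mul, mul_sub, sub_mul, mul_smul_comm, smul_mul_assoc, one_mul,
    hab, hbc, hcc, hac, reassoc₂ hbb, reassoc₂ hbc, reassoc₂ hca, reassoc₂ hac,
    reassoc₂ hq1, reassoc₂ hq2, reassoc₃ hbr, hxy, hxz, hyz]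
  module

lemma intertwiner_braid (h : IsAffineHecke q n j T x) {k : ℕ} (hk : k + 2 < n) :
    intertwiner j T x k * intertwiner j T x (k + 1) * intertwiner j T x k =
      intertwiner j T x (k + 1) * intertwiner j T x k * intertwiner j T x (k + 1) := by
  have e0 : intertwiner j T x k * intertwiner j T x (k + 1) * j (x k)
      = j (x (k + 1)) * (intertwiner j T x k * intertwiner j T x (k + 1)) := by
    rw [mul_assoc, (h.intertwiner_mul_of_ne (k := k + 1) (l := k) (by lia) (by lia) (by lia)
      (by lia)).eq, ← mul_assoc, h.intertwiner_mul_self (by lia), mul_assoc]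
  calc intertwiner j T x k * intertwiner j T x (k + 1) * intertwiner j T x k
      = intertwiner j T x k * intertwiner j T x (k + 1) * T k * j (x k)
        - intertwiner j T x k * intertwiner j T x (k + 1) * j (x k) * T k := by
        conv_lhs => rhs; rw [intertwiner]
        rw [mul_sub]
        simp only [mul_assoc]
    _ = T (k + 1) * (j (x (k + 1)) * (intertwiner j T x k * intertwiner j T x (k + 1)))
        - j (x (k + 1)) * (T (k + 1) * (intertwiner j T x k * intertwiner j T x (k + 1))) := by
        rw [h.intertwiner_mul_intertwiner_mul hk, e0, mul_assoc (T (k + 1)), e0,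
          mul_assoc (j (x (k + 1))), h.intertwiner_mul_intertwiner_mul hk]
    _ = intertwiner j T x (k + 1) * intertwiner j T x k * intertwiner j T x (k + 1) := by
        rw [mul_assoc (intertwiner j T x (k + 1)), intertwiner.eq_1 j T x (k + 1), sub_mul]
        simp only [mul_assoc]

lemma far_intertwiner (h : IsAffineHecke q n j T x) {k l : ℕ} (hk : k + 1 < n) (hl : l + 1 < n)
    (hkl : k + 1 < l ∨ l + 1 < k) : Commute (T k) (intertwiner j T x l) := by
  have h1 : Commute (T k) (T l) := by
    rcases hkl with h1 | h1
    · exact h.far k l h1 hl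
    · exact (h.far l k h1 hk).symm
  have h2 := h.comm k l hk (by lia) (by lia) (by lia)
  exact (h1.mul_right h2).sub_right (h2.mul_right h1)

lemma intertwiner_far (h : IsAffineHecke q n j T x) {k l : ℕ} (hk : k + 1 < n) (hl : l + 1 < n)
    (hkl : k + 1 < l ∨ l + 1 < k) :
    Commute (intertwiner j T x k) (intertwiner j T x l) := by
  have h1 := h.far_intertwiner hk hl hkl
  have h2 := (h.intertwiner_mul_of_ne (k := l) (l := k) hl (by lia) (by lia) (by lia)).symm
  exact (h1.mul_left h2).sub_left (h2.mul_left h1)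

open Polynomial

lemma intertwiner_mul_aeval (h : IsAffineHecke q n j T x) {k : ℕ} (hk : k + 1 < n) (p : R[X]) :
    intertwiner j T x k * j (aeval (x k) p) = j (aeval (x (k + 1)) p) * intertwiner j T x k := by
  induction p using Polynomial.induction_on' with
  | add p p' hp hp' => simp only [map_add, mul_add, add_mul, hp, hp']
  | monomial m a =>
    simp only [aeval_monomial, map_mul, AlgHom.commutes, map_pow]
    rw [← mul_assoc, ← Algebra.commutes, mul_assoc, mul_assoc]
    congr 1
    exact (SemiconjBy.pow_right (h.intertwiner_mul_self hk) m)

lemma intertwiner_mul_aeval_succ (h : IsAffineHecke q n j T x) {k : ℕ} (hk : k + 1 < n)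
    (p : R[X]) :
    intertwiner j T x k * j (aeval (x (k + 1)) p) = j (aeval (x k) p) * intertwiner j T x k := by
  induction p using Polynomial.induction_on' with
  | add p p' hp hp' => simp only [map_add, mul_add, add_mul, hp, hp']
  | monomial m a =>
    simp only [aeval_monomial, map_mul, AlgHom.commutes, map_pow]
    rw [← mul_assoc, ← Algebra.commutes, mul_assoc, mul_assoc]
    congr 1
    exact (SemiconjBy.pow_right (h.intertwiner_mul_succ hk) m)

lemma commute_aeval_of_commute {a : S} {y : D} (h : Commute a (j y)) (p : R[X]) :
    Commute a (j (aeval y p)) := by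
  rw [← aeval_algHom_apply]
  induction p using Polynomial.induction_on' with
  | add p p' hp hp' => simpa only [map_add] using hp.add_right hp'
  | monomial m b =>
    rw [aeval_monomial]
    exact (Algebra.commute_algebraMap_right b a).mul_right (h.pow_right m)

lemma commute_add (h : IsAffineHecke q n j T x) {k : ℕ} (hk : k + 1 < n) :
    Commute (T k) (j (x k + x (k + 1))) := by
  rw [Commute, SemiconjBy, map_add, mul_add, add_mul, h.self_mul hk, h.succ_mul hk]
  abel

lemma commute_mul (h : IsAffineHecke q n j T x) {k : ℕ} (hk : k + 1 < n) :
    Commute (T k) (j (x k * x (k + 1))) := by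
  have h1 : T k * j (x k) = j (x (k + 1)) * T k - ((q : R) - 1) • j (x (k + 1)) := by
    rw [h.succ_mul hk, add_sub_cancel_right]
  rw [Commute, SemiconjBy, map_mul, ← mul_assoc, h1, sub_mul, mul_assoc, h.mul_succ hk, mul_add,
    ← mul_assoc, jcomm j (x (k + 1)) (x k)]
  simp only [mul_smul_comm, smul_mul_assoc, add_sub_cancel_right]

/-- Symmetric power sums in `x_k` and `x_{k+1}` commute with `T_k`. -/
lemma commute_aeval_add (h : IsAffineHecke q n j T x) {k : ℕ} (hk : k + 1 < n) (p : R[X]) :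
    Commute (T k) (j (aeval (x k) p + aeval (x (k + 1)) p)) := by
  have hpow : ∀ m : ℕ, Commute (T k) (j (x k ^ m + x (k + 1) ^ m)) ∧
      Commute (T k) (j (x k ^ (m + 1) + x (k + 1) ^ (m + 1))) := by
    intro m
    induction m with
    | zero =>
      refine ⟨?_, by simpa using h.commute_add hk⟩
      rw [pow_zero, pow_zero, map_add, map_one]
      exact (Commute.one_right _).add_right (Commute.one_right _)
    | succ m ih =>
      refine ⟨ih.2, ?_⟩
      have e : x k ^ (m + 1 + 1) + x (k + 1) ^ (m + 1 + 1)
          = (x k + x (k + 1)) * (x k ^ (m + 1) + x (k + 1) ^ (m + 1))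
            - (x k * x (k + 1)) * (x k ^ m + x (k + 1) ^ m) := by ring
      rw [e, map_sub, map_mul, map_mul j (x k * x (k + 1))]
      exact ((h.commute_add hk).mul_right ih.2).sub_right ((h.commute_mul hk).mul_right ih.1)
  induction p using Polynomial.induction_on' with
  | add p p' hp hp' =>
    have e : aeval (x k) (p + p') + aeval (x (k + 1)) (p + p')
      = (aeval (x k) p + aeval (x (k + 1)) p) + (aeval (x k) p' + aeval (x (k + 1)) p') := by
      simp only [map_add]; ring
    rw [e, map_add]
    exact hp.add_right hp'
  | monomial m b =>
    rw [aeval_monomial, aeval_monomial, ← mul_add, map_mul, AlgHom.commutes]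
    exact (Algebra.commute_algebraMap_right b (T k)).mul_right (hpow m).1

/-- If `p` is a product of linear factors, then `p(x_k) p(x_{k+1})` commutes with `T_k`. -/
lemma commute_aeval_mul (h : IsAffineHecke q n j T x) {k : ℕ} (hk : k + 1 < n) {p : R[X]}
    (hp : p ∈ Submonoid.closure (Set.range fun r : R => X - C r)) :
    Commute (T k) (j (aeval (x k) p * aeval (x (k + 1)) p)) := by
  induction hp using Submonoid.closure_induction with
  | mem p hp =>
    obtain ⟨r, rfl⟩ := hp
    have e : aeval (x k) (X - C r) * aeval (x (k + 1)) (X - C r)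
        = x k * x (k + 1) - (algebraMap R D r * (x k + x (k + 1)) - algebraMap R D (r * r)) := by
      simp only [map_sub, aeval_X, aeval_C, map_mul]; ring
    rw [e, map_sub, map_sub, AlgHom.commutes, map_mul j (algebraMap R D r), AlgHom.commutes]
    exact (h.commute_mul hk).sub_right
      (((Algebra.commute_algebraMap_right _ (T k)).mul_right (h.commute_add hk)).sub_right
        (Algebra.commute_algebraMap_right _ (T k)))
  | one => simp
  | mul p p' _ _ hp hp' =>
    rw [map_mul (aeval (x k)), map_mul (aeval (x (k + 1))), mul_mul_mul_comm, map_mul]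
    exact hp.mul_right hp'

end IsAffineHecke
end AffineHecke

/-! ### Jucys-Murphy elements -/

section JucysMurphy

namespace ArikiKoike

variable {R : Type u} [CommRing R] (q : Rˣ) {J : Type v} [Fintype J] (P : J → R) (n : ℕ)

/-- The Jucys-Murphy elements `q^{-i} T_i ⋯ T_1 T_0 T_1 ⋯ T_i`. -/
def jucysMurphy : ℕ → ArikiKoike (q : R) P n
  | 0 => gen (q : R) P n 0
  | i + 1 => ((q⁻¹ : Rˣ) : R) • (gen (q : R) P n (i + 1) * jucysMurphy i * gen (q : R) P n (i + 1))

variable {q P n}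

lemma commute_jucysMurphy_of_lt {i l : ℕ} (hl : l + 1 < i) (hi : i < n) :
    Commute (gen (q : R) P n i) (jucysMurphy q P n l) := by
  induction l with
  | zero => exact (gen_commute (by lia) hi).symm
  | succ l ih =>
    have h1 : Commute (gen (q : R) P n i) (gen (q : R) P n (l + 1)) :=
      (gen_commute (by lia) hi).symm
    exact ((h1.mul_right (ih (by lia))).mul_right h1).smul_right _

lemma commute_jucysMurphy_of_gt {i l : ℕ} (h1 : 1 ≤ i) (hil : i < l) (hl : l < n) :
    Commute (gen (q : R) P n i) (jucysMurphy q P n l) := by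
  induction l with
  | zero => lia
  | succ l ih =>
    rcases Nat.lt_or_ge i l with h2 | h2
    · have h3 : Commute (gen (q : R) P n i) (gen (q : R) P n (l + 1)) :=
        gen_commute (by lia) hl
      exact ((h3.mul_right (ih h2 (by lia))).mul_right h3).smul_right _
    · obtain rfl : i = l := by lia
      obtain ⟨m, rfl⟩ : ∃ m, i = m + 1 := ⟨i - 1, by lia⟩
      refine Commute.smul_right ?_ _
      have hb := gen_braid (q := (q : R)) (P := P) h1 hl
      have hc : Commute (gen (q : R) P n (m + 1 + 1)) (jucysMurphy q P n m) :=
        commute_jucysMurphy_of_lt (by lia) hl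
      have hb' := hb
      rw [jucysMurphy, Commute, SemiconjBy]
      simp only [mul_smul_comm, smul_mul_assoc]
      congr 1
      generalize gen (q : R) P n (m + 1 + 1) = t at *
      generalize gen (q : R) P n (m + 1) = s at *
      generalize jucysMurphy q P n m = y at *
      calc s * (t * (s * y * s) * t) = (s * t * s) * y * s * t := by noncomm_ring
        _ = t * s * (t * y) * s * t := by rw [← hb]; noncomm_ring
        _ = t * s * y * (t * s * t) := by rw [hc.eq]; noncomm_ring
        _ = t * (s * y * s) * t * s := by rw [hb]; noncomm_ring

lemma jucysMurphy_commute_zero {l : ℕ} (hl : l < n) :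
    Commute (gen (q : R) P n 0) (jucysMurphy q P n l) := by
  induction l with
  | zero => exact Commute.refl _
  | succ l ih =>
    refine Commute.smul_right ?_ _
    rcases Nat.eq_zero_or_pos l with rfl | h0
    · have := gen_braidFour (q := (q : R)) (P := P) hl
      simpa only [Commute, SemiconjBy, mul_assoc, jucysMurphy, zero_add] using this
    · have h1 : Commute (gen (q : R) P n 0) (gen (q : R) P n (l + 1)) := gen_commute (by lia) hl
      exact (h1.mul_right (ih (by lia))).mul_right h1

lemma jucysMurphy_commute {i l : ℕ} (hi : i < n) (hl : l < n) :
    Commute (jucysMurphy q P n i) (jucysMurphy q P n l) := by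
  wlog h : i ≤ l
  · exact (this hl hi (by lia)).symm
  rcases h.eq_or_lt with rfl | h
  · exact Commute.refl _
  induction i with
  | zero => exact jucysMurphy_commute_zero hl
  | succ i ih =>
    have h1 : Commute (gen (q : R) P n (i + 1)) (jucysMurphy q P n l) :=
      commute_jucysMurphy_of_gt (by lia) h hl
    exact ((h1.mul_left (ih (by lia) (by lia) (by lia))).mul_left h1).smul_left _

/-- The Ariki-Koike algebra satisfies the affine Hecke relations, the commutative algebra being the
subalgebra generated by the Jucys-Murphy elements. -/
lemma exists_isAffineHecke (q : Rˣ) (P : J → R) (n : ℕ) :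
    ∃ (D : Type u) (_ : CommRing D) (_ : Algebra R D) (j : D →ₐ[R] ArikiKoike (q : R) P n)
      (x : ℕ → D), Function.Injective j ∧ Algebra.adjoin R {a | ∃ l < n, a = x l} = ⊤ ∧
      IsAffineHecke q n j (fun k => gen (q : R) P n (k + 1)) x ∧
      (0 < n → j (x 0) = gen (q : R) P n 0) := by
  let X : Set (ArikiKoike (q : R) P n) := {a | ∃ l < n, a = jucysMurphy q P n l}
  have hX : ∀ a ∈ X, ∀ b ∈ X, a * b = b * a := by
    rintro _ ⟨i, hi, rfl⟩ _ ⟨l, hl, rfl⟩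
    exact jucysMurphy_commute hi hl
  let D := Algebra.adjoin R X
  let : CommRing D :=
    { (inferInstance : Ring D) with
      mul_comm := (Algebra.isMulCommutative_adjoin R hX).is_comm.comm }
  let x : ℕ → D := fun l => if h : l < n then
    ⟨jucysMurphy q P n l, Algebra.subset_adjoin ⟨l, h, rfl⟩⟩ else 0
  have hx : ∀ l < n, ((x l : D) : ArikiKoike (q : R) P n) = jucysMurphy q P n l := fun l h => by
    simp only [x, dif_pos h]
  refine ⟨D, inferInstance, Subalgebra.algebra D, D.val, x, Subtype.val_injective, ?_,
    ⟨?_, ?_, ?_, ?_, ?_⟩, ?_⟩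
  · refine Algebra.eq_top_iff.2 fun a => ?_
    obtain ⟨a, ha⟩ := a
    induction ha using Algebra.adjoin_induction with
    | mem a ha =>
      obtain ⟨l, hl, rfl⟩ := ha
      exact Algebra.subset_adjoin ⟨l, hl, Subtype.ext (hx l hl).symm⟩
    | algebraMap r => exact Subalgebra.algebraMap_mem _ r
    | add a b ha hb iha ihb => exact Subalgebra.add_mem _ iha ihb
    | mul a b ha hb iha ihb => exact Subalgebra.mul_mem _ iha ihb
  · exact fun k hk => gen_quadratic (by lia) hk
  · exact fun k hk => gen_braid (by lia) hk
  · exact fun k l hkl hl => gen_commute (by lia) hl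
  · intro k l hk hl h1 h2
    change Commute _ ((x l : D) : ArikiKoike (q : R) P n)
    rw [hx l hl]
    rcases Nat.lt_or_ge l k with h3 | h3
    · exact commute_jucysMurphy_of_lt (by lia) hk
    · exact commute_jucysMurphy_of_gt (by lia) (by lia) hl
  · intro k hk
    change _ * ((x k : D) : ArikiKoike (q : R) P n) * _
      = (q : R) • ((x (k + 1) : D) : ArikiKoike (q : R) P n)
    rw [hx k (by lia), hx (k + 1) hk, jucysMurphy, smul_smul, Units.mul_inv, one_smul]
  · intro h
    change ((x 0 : D) : ArikiKoike (q : R) P n) = _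
    rw [hx 0 h, jucysMurphy]

end ArikiKoike

end JucysMurphy

/-! ### Spectra of Jucys-Murphy elements -/

section Spectrum

open Polynomial

variable {R : Type u} [CommRing R] {J : Type v} (q : Rˣ) (P : J → R)

/-- The scalar `q^a P_i` attached to the pair `(i, a)`. -/
def residue (p : Σ _ : J, ℤ) : R := ((q ^ p.2 : Rˣ) : R) * P p.1

/-- The monic polynomial with roots the residues of a finite set of pairs. -/
def residuePoly (s : Finset (Σ _ : J, ℤ)) : R[X] := ∏ p ∈ s, (X - C (residue q P p))

/-- The pairs `(i, a)` with `i ∈ A` and `|a| ≤ f i`. -/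
def strip (A : Finset J) (f : J → ℕ) : Finset (Σ _ : J, ℤ) :=
  A.sigma fun i => Finset.Icc (-(f i : ℤ)) (f i)

lemma mem_strip {A : Finset J} {f : J → ℕ} {p : Σ _ : J, ℤ} :
    p ∈ strip A f ↔ p.1 ∈ A ∧ |p.2| ≤ f p.1 := by
  rw [strip, Finset.mem_sigma, Finset.mem_Icc, abs_le]

lemma residuePoly_mem_closure (s : Finset (Σ _ : J, ℤ)) :
    residuePoly q P s ∈ Submonoid.closure (Set.range fun r : R => X - C r) :=
  Submonoid.prod_mem _ fun p _ => Submonoid.subset_closure ⟨residue q P p, rfl⟩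

variable {D : Type*} [CommRing D] [Algebra R D]

/-- The generalized eigenvalues of `y` on the part of `D` cut out by `e` are residues of pairs in
`s`, in the sense that the corresponding product of linear factors is nilpotent there. -/
def SpecIn (y e : D) (s : Finset (Σ _ : J, ℤ)) : Prop :=
  IsNilpotent (aeval y (residuePoly q P s) * e)

variable {q P}

lemma aeval_residuePoly_mem_iff {y : D} {s : Finset (Σ _ : J, ℤ)} {𝔭 : Ideal D} (h𝔭 : 𝔭.IsPrime) :
    aeval y (residuePoly q P s) ∈ 𝔭 ↔ ∃ p ∈ s, y - algebraMap R D (residue q P p) ∈ 𝔭 := by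
  rw [residuePoly, map_prod, h𝔭.prod_mem_iff]
  simp only [map_sub, aeval_X, aeval_C]

lemma specIn_iff {y e : D} {s : Finset (Σ _ : J, ℤ)} :
    SpecIn q P y e s ↔ ∀ 𝔭 : Ideal D, 𝔭.IsPrime → e ∉ 𝔭 →
      ∃ p ∈ s, y - algebraMap R D (residue q P p) ∈ 𝔭 := by
  rw [SpecIn, nilpotent_iff_mem_prime]
  refine forall₂_congr fun 𝔭 h𝔭 => ?_
  rw [h𝔭.mul_mem_iff_mem_or_mem, aeval_residuePoly_mem_iff h𝔭, or_iff_not_imp_right]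

/-- An element lying only in those primes that contain the idempotent `e` is invertible on the part
cut out by `e`. -/
lemma exists_mul_mul_eq_of_prime {g e : D} (he : IsIdempotentElem e)
    (h : ∀ 𝔭 : Ideal D, 𝔭.IsPrime → g ∈ 𝔭 → e ∈ 𝔭) : ∃ d, g * d * e = e := by
  have h1 : e ∈ (Ideal.span {g}).radical := by
    rw [Ideal.radical_eq_sInf, Ideal.mem_sInf]
    rintro 𝔭 ⟨h1, h2⟩
    exact h 𝔭 h2 (h1 (Ideal.mem_span_singleton_self g))
  obtain ⟨N, hN⟩ := h1
  obtain ⟨d, hd⟩ := Ideal.mem_span_singleton.1 hN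
  refine ⟨d, ?_⟩
  rw [← hd, ← pow_succ, he.pow_succ_eq]

lemma specIn_pow {y e : D} (he : IsIdempotentElem e) {s : Finset (Σ _ : J, ℤ)}
    (h : SpecIn q P y e s) : ∃ N, aeval y (residuePoly q P s ^ N) * e = 0 := by
  obtain ⟨N, hN⟩ := h
  refine ⟨N + 1, ?_⟩
  have : (aeval y (residuePoly q P s) * e) ^ (N + 1) = 0 := by rw [pow_succ, hN, zero_mul]
  rwa [mul_pow, he.pow_succ_eq, ← map_pow] at this

/-- If the spectra of `y` and `z` are separated, then `a y - b z` is invertible, provided all the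
differences of residues are. -/
lemma exists_inverse_of_specIn {y z e : D} (he : IsIdempotentElem e) {s t : Finset (Σ _ : J, ℤ)}
    (hy : SpecIn q P y e s) (hz : SpecIn q P z e t) (a b : R)
    (h : ∀ p ∈ s, ∀ p' ∈ t, IsUnit (a * residue q P p - b * residue q P p')) :
    ∃ d, (a • y - b • z) * d * e = e := by
  refine exists_mul_mul_eq_of_prime he fun 𝔭 h𝔭 hg => ?_
  by_contra hne
  obtain ⟨p, hp, h1⟩ := specIn_iff.1 hy 𝔭 h𝔭 hne
  obtain ⟨p', hp', h2⟩ := specIn_iff.1 hz 𝔭 h𝔭 hne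
  refine h𝔭.ne_top (𝔭.eq_top_of_isUnit_mem ?_ ((h p hp p' hp').map (algebraMap R D)))
  have e1 : algebraMap R D (a * residue q P p - b * residue q P p')
      = (a • y - b • z) - algebraMap R D a * (y - algebraMap R D (residue q P p))
        + algebraMap R D b * (z - algebraMap R D (residue q P p')) := by
    simp only [Algebra.smul_def, map_sub, map_mul]
    ring
  rw [e1]
  exact 𝔭.add_mem (𝔭.sub_mem hg (𝔭.mul_mem_left _ h1)) (𝔭.mul_mem_left _ h2)

/-- If the spectrum of `y` is separated from the residues of `t`, then the product of the linear
factors belonging to `t` is invertible at `y`. -/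
lemma exists_inverse_residuePoly {y e : D} (he : IsIdempotentElem e) {s t : Finset (Σ _ : J, ℤ)}
    (hy : SpecIn q P y e s)
    (h : ∀ p ∈ s, ∀ p' ∈ t, IsUnit (residue q P p - residue q P p')) :
    ∃ d, aeval y (residuePoly q P t) * d * e = e := by
  refine exists_mul_mul_eq_of_prime he fun 𝔭 h𝔭 hg => ?_
  by_contra hne
  obtain ⟨p, hp, h1⟩ := specIn_iff.1 hy 𝔭 h𝔭 hne
  obtain ⟨p', hp', h2⟩ := (aeval_residuePoly_mem_iff h𝔭).1 hg
  refine h𝔭.ne_top (𝔭.eq_top_of_isUnit_mem ?_ ((h p hp p' hp').map (algebraMap R D)))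
  have e1 : algebraMap R D (residue q P p - residue q P p')
      = (y - algebraMap R D (residue q P p')) - (y - algebraMap R D (residue q P p)) := by
    rw [map_sub]; ring
  rw [e1]
  exact 𝔭.sub_mem h2 h1

lemma isCoprime_residuePoly {s t : Finset (Σ _ : J, ℤ)}
    (h : ∀ p ∈ s, ∀ p' ∈ t, IsUnit (residue q P p - residue q P p')) :
    IsCoprime (residuePoly q P s) (residuePoly q P t) := by
  refine IsCoprime.prod_left fun p hp => IsCoprime.prod_right fun p' hp' => ?_
  exact isCoprime_X_sub_C_of_isUnit_sub (h p hp p' hp')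

/-- Splitting an idempotent along a coprime factorization of a polynomial annihilating `y`. -/
lemma exists_split_idempotent {K : Type*} [Fintype K] [DecidableEq K] {y e : D}
    (he : IsIdempotentElem e) (g : K → R[X])
    (hg : Pairwise fun a b => IsCoprime (g a) (g b))
    (hnil : IsNilpotent (aeval y (∏ a, g a) * e)) :
    ∃ h : K → R[X], (∑ a, aeval y (h a) * e = e) ∧
      (∀ a b, a ≠ b → aeval y (h a) * e * (aeval y (h b) * e) = 0) ∧
      ∀ a, IsNilpotent (aeval y (g a) * (aeval y (h a) * e)) := by
  obtain ⟨N, hN⟩ := hnil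
  have hN' : aeval y (∏ a, g a ^ (N + 1)) * e = 0 := by
    have : (aeval y (∏ a, g a) * e) ^ (N + 1) = 0 := by rw [pow_succ, hN, zero_mul]
    rwa [mul_pow, he.pow_succ_eq, ← map_pow, ← Finset.prod_pow] at this
  rcases isEmpty_or_nonempty K with hK | hK
  · have : e = 0 := by simpa using hN'
    exact ⟨fun _ => 0, by simp [this], fun a => (hK.false a).elim, fun a => (hK.false a).elim⟩
  have hcop : Pairwise (Function.onFun IsCoprime
      fun i : (Finset.univ : Finset K) => g i ^ (N + 1)) := by
    intro a b hab
    exact (hg fun h => hab (Subtype.ext h)).pow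
  obtain ⟨μ, hμ⟩ := (exists_sum_eq_one_iff_pairwise_coprime Finset.univ_nonempty
    (s := fun i => g i ^ (N + 1))).2 hcop
  have hkill : ∀ p : R[X], (∏ a, g a ^ (N + 1)) ∣ p → aeval y p * e = 0 := by
    rintro _ ⟨c, rfl⟩
    rw [map_mul, mul_right_comm, hN', zero_mul]
  have hprod : ∀ a, g a ^ (N + 1) * ∏ b ∈ Finset.univ \ {a}, g b ^ (N + 1)
      = ∏ b, g b ^ (N + 1) := fun a => by
    rw [Finset.sdiff_singleton_eq_erase]
    exact Finset.mul_prod_erase _ _ (Finset.mem_univ a)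
  refine ⟨fun a => μ a * ∏ b ∈ Finset.univ \ {a}, g b ^ (N + 1), ?_, ?_, ?_⟩
  · rw [← Finset.sum_mul, ← map_sum, hμ, map_one, one_mul]
  · intro a b hab
    rw [mul_mul_mul_comm, he.eq, ← map_mul]
    refine hkill _ ?_
    obtain ⟨c, hc⟩ : g a ^ (N + 1) ∣ ∏ c ∈ Finset.univ \ {b}, g c ^ (N + 1) :=
      Finset.dvd_prod_of_mem _ (by simpa using hab)
    refine ⟨μ a * μ b * c, ?_⟩
    beta_reduce
    rw [← hprod a, hc]
    ring
  · intro a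
    refine ⟨N + 1, ?_⟩
    have h1 := hkill (g a ^ (N + 1) * (μ a * ∏ b ∈ Finset.univ \ {a}, g b ^ (N + 1)))
      ⟨μ a, by rw [mul_left_comm, hprod, mul_comm]⟩
    beta_reduce
    rw [map_mul, map_pow] at h1
    generalize aeval y (μ a * ∏ b ∈ Finset.univ \ {a}, g b ^ (N + 1)) = m at *
    linear_combination (m * e) ^ N * h1

variable [Fintype J] [DecidableEq J]

/-- Passing from `x_k` to `x_{k+1}`: if `e` commutes with `T_k`, the spectrum of `x_{k+1}` on a part
of `e` is contained in the spectrum of `x_k` on `e` enlarged by the neighbours of the eigenvalues of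
`x_k` on that part. This follows from `φ p(x_k) φ = p(x_{k+1}) φ²` for the intertwiner `φ`. -/
lemma IsAffineHecke.specIn_succ {S : Type*} [Ring S] [Algebra R S] {n : ℕ} {j : D →ₐ[R] S}
    {T : ℕ → S} {x : ℕ → D} (h : IsAffineHecke q n j T x) (hj : Function.Injective j) {k : ℕ}
    (hk : k + 1 < n) {e e₁ : D} (hee : e ∣ e₁) (he : IsIdempotentElem e)
    (hcomm : Commute (T k) (j e))
    {A : Finset J} {f : J → ℕ} (h0 : SpecIn q P (x k) e (strip Finset.univ f))
    (h1 : SpecIn q P (x k) e₁ (strip A f)) :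
    SpecIn q P (x (k + 1)) e₁ (strip Finset.univ fun i => if i ∈ A then f i + 1 else f i) := by
  obtain ⟨N, hN⟩ := specIn_pow he h0
  generalize hp : residuePoly q P (strip Finset.univ f) ^ N = p at hN
  have hφe : Commute (intertwiner j T x k) (j e) :=
    (hcomm.mul_left (IsAffineHecke.jcomm j _ _)).sub_left
      (Commute.mul_left (IsAffineHecke.jcomm j _ _) hcomm)
  have key : aeval (x (k + 1)) p *
      (((q : R) • x k - x (k + 1)) * ((q : R) • x (k + 1) - x k)) * e = 0 := by
    apply hj
    rw [map_mul, map_mul, ← h.intertwiner_mul_intertwiner hk, ← mul_assoc,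
      ← h.intertwiner_mul_aeval hk, mul_assoc, hφe.eq, ← mul_assoc, mul_assoc _ (j _) (j e),
      ← map_mul, hN, map_zero, mul_zero, zero_mul]
  rw [specIn_iff]
  intro 𝔭 h𝔭 hne
  have hne' : e ∉ 𝔭 := fun hh => hne (𝔭.mem_of_dvd hee hh)
  obtain ⟨p₁, hp₁, hx⟩ := specIn_iff.1 h1 𝔭 h𝔭 hne
  have hmem := h𝔭.mem_or_mem (key ▸ 𝔭.zero_mem)
  replace hmem := h𝔭.mem_or_mem (hmem.resolve_right hne')
  rw [mem_strip] at hp₁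
  rcases hmem with hmem | hmem
  · rw [← hp, map_pow] at hmem
    obtain ⟨p₂, hp₂, h2⟩ := (aeval_residuePoly_mem_iff h𝔭).1 (h𝔭.mem_of_pow_mem _ hmem)
    refine ⟨p₂, ?_, h2⟩
    rw [mem_strip] at hp₂ ⊢
    refine ⟨hp₂.1, hp₂.2.trans ?_⟩
    split_ifs <;> simp
  rcases h𝔭.mem_or_mem hmem with hmem | hmem
  · refine ⟨⟨p₁.1, p₁.2 + 1⟩, ?_, ?_⟩
    · rw [mem_strip]
      refine ⟨Finset.mem_univ _, ?_⟩
      simp only [hp₁.1, if_true]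
      push_cast
      exact (abs_add_le _ _).trans (by simpa using hp₁.2)
    · have e1 : x (k + 1) - algebraMap R D (residue q P ⟨p₁.1, p₁.2 + 1⟩)
          = algebraMap R D q * (x k - algebraMap R D (residue q P p₁))
            - ((q : R) • x k - x (k + 1)) := by
        simp only [residue, Algebra.smul_def, zpow_add, zpow_one, Units.val_mul, map_mul]
        ring
      rw [e1]
      exact 𝔭.sub_mem (𝔭.mul_mem_left _ hx) hmem
  · refine ⟨⟨p₁.1, p₁.2 - 1⟩, ?_, ?_⟩
    · rw [mem_strip]
      refine ⟨Finset.mem_univ _, ?_⟩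
      simp only [hp₁.1, if_true]
      push_cast
      exact (abs_sub _ _).trans (by simpa using hp₁.2)
    · have hq : algebraMap R D ((q⁻¹ : Rˣ) : R) * algebraMap R D q = 1 := by
        rw [← map_mul, Units.inv_mul, map_one]
      have e1 : x (k + 1) - algebraMap R D (residue q P ⟨p₁.1, p₁.2 - 1⟩)
          = algebraMap R D ((q⁻¹ : Rˣ) : R) * ((x k - algebraMap R D (residue q P p₁))
            + ((q : R) • x (k + 1) - x k)) := by
        simp only [residue, Algebra.smul_def, zpow_sub, zpow_one, Units.val_mul, map_mul]
        linear_combination (-x (k + 1)) * hq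
      rw [e1]
      exact 𝔭.mul_mem_left _ (𝔭.add_mem hx hmem)

/-- The spectrum of the `k`-th Jucys-Murphy element of an Ariki-Koike algebra. -/
lemma IsAffineHecke.specIn_jucysMurphy {S : Type*} [Ring S] [Algebra R S] {n : ℕ} {j : D →ₐ[R] S}
    {T : ℕ → S} {x : ℕ → D} (h : IsAffineHecke q n j T x) (hj : Function.Injective j)
    (h0 : 0 < n → SpecIn q P (x 0) 1 (strip Finset.univ fun _ => 0)) {k : ℕ} (hk : k < n) :
    SpecIn q P (x k) 1 (strip Finset.univ fun _ => k) := by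
  induction k with
  | zero => exact h0 hk
  | succ k ih =>
    have := h.specIn_succ hj hk dvd_rfl IsIdempotentElem.one (by rw [map_one]; exact .one_right _)
      (ih (by lia)) (ih (by lia))
    simpa using this

end Spectrum

/-! ### Words -/

section Words

variable {n : ℕ} {K : Type*}

/-- The transposition of the positions `k` and `k + 1`. -/
def swapAdj (n k : ℕ) : Equiv.Perm (Fin n) :=
  if h : k + 1 < n then Equiv.swap ⟨k, by lia⟩ ⟨k + 1, h⟩ else 1

lemma swapAdj_val {k : ℕ} (h : k + 1 < n) (p : Fin n) : (swapAdj n k p : ℕ) =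
    if (p : ℕ) = k then k + 1 else if (p : ℕ) = k + 1 then k else p := by
  rw [swapAdj, dif_pos h, Equiv.swap_apply_def]
  simp only [Fin.ext_iff]
  split_ifs <;> rfl

/-- The word `w` with the letters at the positions `k` and `k + 1` exchanged. -/
def swapWord (k : ℕ) (w : Fin n → K) : Fin n → K := w ∘ swapAdj n k

lemma swapWord_apply (k : ℕ) (w : Fin n → K) (p : Fin n) :
    swapWord k w p = w (swapAdj n k p) := rfl

lemma swapWord_left {k : ℕ} (h : k + 1 < n) (w : Fin n → K) :
    swapWord k w ⟨k, by lia⟩ = w ⟨k + 1, h⟩ := by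
  rw [swapWord_apply]; congr 1; ext; simp [swapAdj_val h]

lemma swapWord_right {k : ℕ} (h : k + 1 < n) (w : Fin n → K) :
    swapWord k w ⟨k + 1, h⟩ = w ⟨k, by lia⟩ := by
  rw [swapWord_apply]; congr 1; ext; simp [swapAdj_val h]

lemma swapWord_of_ne {k : ℕ} (h : k + 1 < n) (w : Fin n → K) {p : Fin n} (h1 : (p : ℕ) ≠ k)
    (h2 : (p : ℕ) ≠ k + 1) : swapWord k w p = w p := by
  rw [swapWord_apply]; congr 1; ext; simp [swapAdj_val h, h1, h2]

lemma swapAdj_mul_self (k : ℕ) : swapAdj n k * swapAdj n k = 1 := by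
  rw [swapAdj]
  split_ifs
  · exact Equiv.swap_mul_self _ _
  · rfl

lemma swapAdj_swapAdj (k : ℕ) (p : Fin n) : swapAdj n k (swapAdj n k p) = p := by
  rw [← Equiv.Perm.mul_apply, swapAdj_mul_self]; rfl

@[simp] lemma swapWord_swapWord (k : ℕ) (w : Fin n → K) : swapWord k (swapWord k w) = w := by
  funext p
  rw [swapWord_apply, swapWord_apply, swapAdj_swapAdj]

lemma swapWord_far {k l : ℕ} (hk : k + 1 < n) (hl : l + 1 < n) (hkl : k + 1 < l ∨ l + 1 < k)
    (w : Fin n → K) : swapWord k (swapWord l w) = swapWord l (swapWord k w) := by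
  funext p
  simp only [swapWord_apply]
  congr 1
  ext
  simp only [swapAdj_val hk, swapAdj_val hl]
  split_ifs <;> lia

lemma swapWord_braid {k : ℕ} (hk : k + 2 < n) (w : Fin n → K) :
    swapWord k (swapWord (k + 1) (swapWord k w))
      = swapWord (k + 1) (swapWord k (swapWord (k + 1) w)) := by
  funext p
  simp only [swapWord_apply]
  congr 1
  ext
  simp only [swapAdj_val (n := n) (k := k) (by lia), swapAdj_val (n := n) (k := k + 1) (by lia)]
  split_ifs <;> lia

variable [DecidableEq K]

/-- The number of occurrences of the letter `α` among the first `k` letters of `w`. -/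
def cnt (w : Fin n → K) (k : ℕ) (α : K) : ℕ :=
  (Finset.univ.filter fun p : Fin n => (p : ℕ) < k ∧ w p = α).card

lemma cnt_zero (w : Fin n → K) (α : K) : cnt w 0 α = 0 := by simp [cnt]

lemma cnt_succ (w : Fin n → K) (p : Fin n) (α : K) :
    cnt w (p + 1) α = cnt w p α + if w p = α then 1 else 0 := by
  have : (Finset.univ.filter fun p' : Fin n => (p' : ℕ) < p + 1 ∧ w p' = α)
      = (Finset.univ.filter fun p' : Fin n => (p' : ℕ) < p ∧ w p' = α)
        ∪ if w p = α then {p} else ∅ := by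
    ext p'
    simp only [Finset.mem_filter, Finset.mem_univ, true_and, Finset.mem_union]
    by_cases h : p' = p
    · subst h; by_cases h1 : w p' = α <;> simp [h1]
    · have h2 : (p' : ℕ) ≠ p := fun h' => h (Fin.ext h')
      have h3 : p' ∉ (if w p = α then {p} else ∅ : Finset (Fin n)) := by
        split_ifs <;> simp [h]
      have h4 : (p' : ℕ) < p + 1 ↔ (p' : ℕ) < p := by lia
      simp [h3, h4]
  rw [cnt, cnt, this, Finset.card_union_of_disjoint]
  · split_ifs <;> simp
  · rw [Finset.disjoint_left]
    intro p' h1 h2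
    split_ifs at h2 with h3
    · rw [Finset.mem_singleton] at h2
      subst h2
      simp at h1
    · simp at h2

lemma cnt_congr {m : ℕ} {w : Fin n → K} {w' : Fin m → K} {k : ℕ} (hn : k ≤ n) (hm : k ≤ m)
    (h : ∀ p (hp : p < k), w ⟨p, by lia⟩ = w' ⟨p, by lia⟩) (α : K) : cnt w k α = cnt w' k α := by
  induction k with
  | zero => rw [cnt_zero, cnt_zero]
  | succ k ih =>
    have h1 := cnt_succ w ⟨k, by lia⟩ α
    have h2 := cnt_succ w' ⟨k, by lia⟩ α
    simp only at h1 h2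
    rw [h1, h2, ih (by lia) (by lia) fun p hp => h p (by lia), h k (by lia)]

lemma sum_cnt [Fintype K] (w : Fin n → K) {k : ℕ} (hk : k ≤ n) : ∑ α, cnt w k α = k := by
  induction k with
  | zero => simp [cnt_zero]
  | succ k ih =>
    have h1 := cnt_succ w ⟨k, by lia⟩
    simp only at h1
    simp_rw [h1, Finset.sum_add_distrib]
    rw [ih (by lia)]
    simp

lemma cnt_add_le [Fintype K] (w : Fin n → K) {k : ℕ} (hk : k ≤ n) {α β : K} (h : α ≠ β) :
    cnt w k α + cnt w k β ≤ k := by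
  conv_rhs => rw [← sum_cnt w hk]
  rw [← Finset.sum_pair h]
  exact Finset.sum_le_sum_of_subset (Finset.subset_univ _)

lemma cnt_le (w : Fin n → K) {k l : ℕ} (hkl : k ≤ l) (α : K) : cnt w k α ≤ cnt w l α :=
  Finset.card_le_card fun p hp => by
    simp only [Finset.mem_filter, Finset.mem_univ, true_and] at hp ⊢
    exact ⟨by lia, hp.2⟩

/-- The occurrence of a letter precedes the total count. -/
lemma cnt_lt (w : Fin n → K) (p : Fin n) {k : ℕ} (hk : (p : ℕ) < k) :
    cnt w p (w p) < cnt w k (w p) := by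
  have h1 := cnt_succ w p (w p)
  rw [if_pos rfl] at h1
  have h2 := cnt_le w (k := p + 1) (l := k) (by lia) (w p)
  lia

lemma cnt_swapWord {k : ℕ} (hk : k + 1 < n) (w : Fin n → K) {l : ℕ} (hl : l ≠ k + 1) (α : K) :
    cnt (swapWord k w) l α = cnt w l α := by
  refine Finset.card_bij (fun p _ => swapAdj n k p) (fun p hp => ?_)
    (fun p _ p' _ h => (swapAdj n k).injective h) fun p hp => ⟨swapAdj n k p, ?_, ?_⟩
  · simp only [Finset.mem_filter, Finset.mem_univ, true_and] at hp ⊢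
    refine ⟨?_, hp.2⟩
    have h1 := hp.1
    rw [swapAdj_val hk]
    split_ifs <;> lia
  · simp only [Finset.mem_filter, Finset.mem_univ, true_and] at hp ⊢
    rw [swapWord_apply, swapAdj_swapAdj]
    refine ⟨?_, hp.2⟩
    have h1 := hp.1
    rw [swapAdj_val hk]
    split_ifs <;> lia
  · rw [swapAdj_swapAdj]

lemma cnt_swapWord_succ {k : ℕ} (hk : k + 1 < n) (w : Fin n → K) (α : K) :
    cnt (swapWord k w) (k + 1) α = cnt w k α + if w ⟨k + 1, hk⟩ = α then 1 else 0 := by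
  have h1 := cnt_succ (swapWord k w) ⟨k, by lia⟩ α
  simp only at h1
  rw [h1, cnt_swapWord hk w (by lia), swapWord_left hk]

/-- The number of earlier occurrences of the letter at position `p`. -/
def occ (w : Fin n → K) (p : Fin n) : ℕ := cnt w p (w p)

/-- Exchanging distinct adjacent letters carries along their occurrence numbers. -/
lemma occ_swapWord {k : ℕ} (hk : k + 1 < n) {w : Fin n → K}
    (hne : w ⟨k, by lia⟩ ≠ w ⟨k + 1, hk⟩) (p : Fin n) :
    occ (swapWord k w) p = occ w (swapAdj n k p) := by
  by_cases h1 : (p : ℕ) = k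
  · obtain rfl : p = ⟨k, by lia⟩ := Fin.ext h1
    have h2 : swapAdj n k ⟨k, by lia⟩ = ⟨k + 1, hk⟩ := by ext; simp [swapAdj_val hk]
    rw [occ, occ, cnt_swapWord hk w (by simp), swapWord_apply, h2]
    have h3 := cnt_succ w ⟨k, by lia⟩ (w ⟨k + 1, hk⟩)
    rw [if_neg hne] at h3
    simpa using h3.symm
  by_cases h2 : (p : ℕ) = k + 1
  · obtain rfl : p = ⟨k + 1, hk⟩ := Fin.ext h2
    have h2 : swapAdj n k ⟨k + 1, hk⟩ = ⟨k, by lia⟩ := by ext; simp [swapAdj_val hk]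
    rw [occ, occ, cnt_swapWord_succ hk, swapWord_apply, h2, if_neg hne.symm, add_zero]
  · have h3 : swapAdj n k p = p := by ext; simp [swapAdj_val hk, h1, h2]
    rw [occ, occ, cnt_swapWord hk w h2, swapWord_apply, h3]

lemma occ_succ {k : ℕ} (hk : k + 1 < n) {w : Fin n → K}
    (heq : w ⟨k, by lia⟩ = w ⟨k + 1, hk⟩) : occ w ⟨k + 1, hk⟩ = occ w ⟨k, by lia⟩ + 1 := by
  have h3 := cnt_succ w ⟨k, by lia⟩ (w ⟨k + 1, hk⟩)
  rw [if_pos heq] at h3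
  rw [occ, occ, heq]
  exact h3

lemma cnt_snoc (w : Fin n → K) (b : K) {k : ℕ} (hk : k ≤ n) (α : K) :
    cnt (Fin.snoc w b : Fin (n + 1) → K) k α = cnt w k α :=
  cnt_congr (by lia) hk (fun p hp => by
    exact Fin.snoc_castSucc (α := fun _ => K) b w ⟨p, by lia⟩) α

lemma cnt_snoc_last (w : Fin n → K) (b : K) (α : K) :
    cnt (Fin.snoc w b : Fin (n + 1) → K) (n + 1) α = cnt w n α + if b = α then 1 else 0 := by
  have h1 := cnt_succ (Fin.snoc w b : Fin (n + 1) → K) (Fin.last n) α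
  rw [Fin.snoc_last] at h1
  simp only [Fin.val_last] at h1
  rw [h1, cnt_snoc w b le_rfl]

end Words

/-! ### Block idempotents -/

section WordIdempotents

open Polynomial

variable {R : Type u} [CommRing R] {S : Type*} [Ring S] [Algebra R S] {D : Type*} [CommRing D]
  [Algebra R D] {q : Rˣ} {n : ℕ} {j : D →ₐ[R] S} {T : ℕ → S} {x : ℕ → D} {J : Type v} [Fintype J]
  {P : J → R} {K : Type*} [DecidableEq K] {c : J → K}

/-- The parameters with different colors are separated, up to distance `n`: the differences of the
corresponding residues are invertible. -/
def Separated (q : Rˣ) (P : J → R) (c : J → K) (n : ℕ) : Prop :=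
  ∀ (i i' : J) (a b : ℤ), c i ≠ c i' → |a| + |b| < n →
    IsUnit (residue q P ⟨i, a⟩ - residue q P ⟨i', b⟩)

/-- The pairs `(i, a)` where `i` has color `α` and `|a| ≤ m`. -/
def colorStrip (c : J → K) (α : K) (m : ℕ) : Finset (Σ _ : J, ℤ) :=
  strip (Finset.univ.filter fun i => c i = α) fun _ => m

lemma mem_colorStrip {α : K} {m : ℕ} {p : Σ _ : J, ℤ} :
    p ∈ colorStrip c α m ↔ c p.1 = α ∧ |p.2| ≤ m := by
  rw [colorStrip, mem_strip]
  simp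

lemma Separated.isUnit (hsep : Separated q P c n) {α β : K} (h : α ≠ β) {m m' : ℕ}
    (hm : m + m' < n) : ∀ p ∈ colorStrip c α m, ∀ p' ∈ colorStrip c β m',
      IsUnit (residue q P p - residue q P p') := by
  intro p hp p' hp'
  rw [mem_colorStrip] at hp hp'
  exact hsep p.1 p'.1 p.2 p'.2 (by rw [hp.1, hp'.1]; exact h) (by lia)

variable [Fintype K]

/-- A complete family of orthogonal idempotents of `D` indexed by the words of length `k`, such that
on the part belonging to `w` the spectrum of `x p` consists of residues of color `w p`. -/
structure IsWordIdempotents (q : Rˣ) (P : J → R) (c : J → K) (x : ℕ → D) (k : ℕ)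
    (E : (Fin k → K) → D) : Prop where
  sum : ∑ w, E w = 1
  ortho : ∀ w w', w ≠ w' → E w * E w' = 0
  spec : ∀ w p, SpecIn q P (x (p : Fin k)) (E w) (colorStrip c (w p) (occ w p))

lemma IsWordIdempotents.idem {k : ℕ} {E : (Fin k → K) → D} (h : IsWordIdempotents q P c x k E)
    (w : Fin k → K) : IsIdempotentElem (E w) := by
  have h1 : E w * ∑ w', E w' = E w := by rw [h.sum, mul_one]
  rwa [Finset.mul_sum, Finset.sum_eq_single w (fun w' _ hne => h.ortho _ _ hne.symm)
    (fun h => (h (Finset.mem_univ _)).elim)] at h1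

variable [DecidableEq J]

/-- Existence of the block idempotents, by induction on the length `k` of the words. In each step
the idempotent of a word is split according to the spectrum of the next Jucys-Murphy element. -/
lemma exists_isWordIdempotents_of_le (h : IsAffineHecke q n j T x) (hj : Function.Injective j)
    (h0 : 0 < n → SpecIn q P (x 0) 1 (strip Finset.univ fun _ => 0)) (hsep : Separated q P c n)
    (k : ℕ) (hk : k ≤ n) : ∃ E : (Fin k → K) → D, IsWordIdempotents q P c x k E ∧
      (∀ l, k ≤ l → l + 1 < n → ∀ w, Commute (T l) (j (E w))) ∧
      (k < n → ∀ w, SpecIn q P (x k) (E w) (strip Finset.univ fun i => cnt w k (c i))) := by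
  induction k with
  | zero =>
    refine ⟨fun _ => 1, ⟨by simp, fun w w' hw => (hw (Subsingleton.elim _ _)).elim,
      fun w p => p.elim0⟩, fun l _ _ w => by rw [map_one]; exact .one_right _, fun hn w => ?_⟩
    simpa only [cnt_zero] using h0 hn
  | succ k ih =>
    obtain ⟨E, hE, hcomm, hspec⟩ := ih (by lia)
    replace hspec := hspec (by lia)
    have hsplit : ∀ w : Fin k → K, ∃ h : K → R[X], (∑ a, aeval (x k) (h a) * E w = E w) ∧
        (∀ a b, a ≠ b → aeval (x k) (h a) * E w * (aeval (x k) (h b) * E w) = 0) ∧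
        ∀ a, IsNilpotent (aeval (x k) (residuePoly q P (colorStrip c a (cnt w k a)))
          * (aeval (x k) (h a) * E w)) := by
      intro w
      refine exists_split_idempotent (hE.idem w) _ ?_ ?_
      · intro a b hab
        refine isCoprime_residuePoly (hsep.isUnit hab ?_)
        have := cnt_add_le w le_rfl hab
        lia
      · rw [nilpotent_iff_mem_prime]
        intro 𝔭 h𝔭
        by_cases he : E w ∈ 𝔭
        · exact 𝔭.mul_mem_left _ he
        obtain ⟨p, hp, hx⟩ := specIn_iff.1 (hspec w) 𝔭 h𝔭 he
        refine 𝔭.mul_mem_right _ ?_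
        rw [map_prod, h𝔭.prod_mem_iff]
        refine ⟨c p.1, Finset.mem_univ _, (aeval_residuePoly_mem_iff h𝔭).2 ⟨p, ?_, hx⟩⟩
        rw [mem_strip] at hp
        rw [mem_colorStrip]
        exact ⟨rfl, hp.2⟩
    choose g hg1 hg2 hg3 using hsplit
    let F : (Fin (k + 1) → K) → D := fun W =>
      aeval (x k) (g (Fin.init W) (W (Fin.last k))) * E (Fin.init W)
    have hFsnoc : ∀ (w : Fin k → K) b, F (Fin.snoc w b) = aeval (x k) (g w b) * E w := by
      intro w b
      simp only [F, Fin.init_snoc, Fin.snoc_last]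
    have hF : IsWordIdempotents q P c x (k + 1) F := by
      refine ⟨?_, ?_, ?_⟩
      · rw [← (Fin.snocEquiv fun _ : Fin (k + 1) => K).sum_comp, Fintype.sum_prod_type_right]
        have h1 : ∀ w b, F ((Fin.snocEquiv fun _ : Fin (k + 1) => K) (b, w))
            = aeval (x k) (g w b) * E w := fun w b => hFsnoc w b
        simp only [h1, hg1, hE.sum]
      · intro W W' hne
        by_cases hi : Fin.init W = Fin.init W'
        · have hl : W (Fin.last k) ≠ W' (Fin.last k) := fun hl => hne <| by
            rw [← Fin.snoc_init_self W, ← Fin.snoc_init_self W', hi, hl]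
          simp only [F, hi]
          exact hg2 _ _ _ hl
        · simp only [F]
          rw [mul_mul_mul_comm, hE.ortho _ _ hi, mul_zero]
      · intro W
        obtain ⟨w, b, rfl⟩ : ∃ w b, W = Fin.snoc w b := ⟨_, _, (Fin.snoc_init_self W).symm⟩
        intro p
        rw [hFsnoc]
        refine Fin.lastCases ?_ (fun p => ?_) p
        · rw [occ, Fin.snoc_last, Fin.val_last, cnt_snoc _ _ le_rfl]
          exact hg3 w b
        · rw [occ, Fin.snoc_castSucc, Fin.val_castSucc, cnt_snoc _ _ p.2.le]
          rw [SpecIn, mul_left_comm]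
          exact Commute.isNilpotent_mul_left (Commute.all _ _) (hE.spec w p)
    refine ⟨F, hF, fun l hl hln W => ?_, fun hk' W => ?_⟩
    · refine (map_mul j _ _).symm ▸ Commute.mul_right ?_ (hcomm l (by lia) hln _)
      exact IsAffineHecke.commute_aeval_of_commute
        (h.comm l k hln (by lia) (by lia) (by lia)) _
    · obtain ⟨w, b, rfl⟩ : ∃ w b, W = Fin.snoc w b := ⟨_, _, (Fin.snoc_init_self W).symm⟩
      have h1 : SpecIn q P (x k) (F (Fin.snoc w b))
          (strip (Finset.univ.filter fun i => c i = b) fun i => cnt w k (c i)) := by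
        have h2 : strip (Finset.univ.filter fun i => c i = b) (fun i => cnt w k (c i))
            = colorStrip c b (cnt w k b) := by
          ext p
          rw [mem_colorStrip, mem_strip]
          simp only [Finset.mem_filter, Finset.mem_univ, true_and]
          exact and_congr_right fun hp => by rw [hp]
        rw [h2, hFsnoc]
        exact hg3 w b
      have h2 := h.specIn_succ hj hk' (e := E w) (by rw [hFsnoc]; exact dvd_mul_left _ _)
        (hE.idem w) (hcomm k le_rfl hk' w) (hspec w) h1
      convert! h2 using 3 with i
      rw [cnt_snoc_last]
      by_cases hb : b = c i
      · simp [hb]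
      · simp [hb, Ne.symm hb]

end WordIdempotents

/-! ### Transport between the parts of different words -/

section BlockSystem

open Polynomial

variable {R : Type u} [CommRing R] {S : Type*} [Ring S] [Algebra R S] {D : Type*} [CommRing D]
  [Algebra R D] {q : Rˣ} {n : ℕ} {j : D →ₐ[R] S} {T : ℕ → S} {x : ℕ → D} {J : Type v} [Fintype J]
  {P : J → R} {K : Type*} [DecidableEq K] {c : J → K} [Fintype K] {E : (Fin n → K) → D}

/-- An element which is annihilated by the linear factors prescribed by `w` lies in the part
belonging to `w`; the eigenvalues of `x p` are allowed to wander a little further than in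
`IsWordIdempotents.spec`. -/
lemma IsWordIdempotents.fix_of_kill (hE : IsWordIdempotents q P c x n E)
    (hsep : Separated q P c n) {S' : Type*} [Ring S'] [Algebra R S'] (ρ : D →ₐ[R] S') (z : S')
    (w : Fin n → K) (M : Fin n → ℕ) (hM : ∀ p α, α ≠ w p → M p + cnt w p α < n)
    (hz : ∀ p : Fin n, ∃ N, ρ (aeval (x p) (residuePoly q P (colorStrip c (w p) (M p)) ^ N)) * z
      = 0) : ρ (E w) * z = z := by
  have h1 : ∀ w', w' ≠ w → ρ (E w') * z = 0 := by
    intro w' hw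
    obtain ⟨p, hp, hmin⟩ : ∃ p, w' p ≠ w p ∧ ∀ p' < p, w' p' = w p' := by
      have hex : ∃ m, ∃ hm : m < n, w' ⟨m, hm⟩ ≠ w ⟨m, hm⟩ := by
        obtain ⟨p, hp⟩ := Function.ne_iff.1 hw
        exact ⟨p, p.2, hp⟩
      classical
      obtain ⟨hm, h⟩ := Nat.find_spec hex
      refine ⟨⟨_, hm⟩, h, fun p' hp' => ?_⟩
      by_contra hne
      exact Nat.find_min hex hp' ⟨p'.2, hne⟩
    have hcnt : cnt w' p (w' p) = cnt w p (w' p) :=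
      cnt_congr p.2.le p.2.le (fun p' hp' => hmin ⟨p', by lia⟩ hp') _
    obtain ⟨N, hN⟩ := hz p
    obtain ⟨d, hd⟩ := exists_inverse_residuePoly (hE.idem w') (hE.spec w' p)
      (t := colorStrip c (w p) (M p)) (hsep.isUnit hp (by
        rw [occ, hcnt]
        have := hM p _ hp
        lia))
    have hd' : E w' = d ^ N * E w' * aeval (x p) (residuePoly q P (colorStrip c (w p) (M p)) ^ N)
        := by
      rw [map_pow]
      clear hN
      induction N with
      | zero => simp
      | succ N ih =>
        rw [pow_succ, pow_succ]
        linear_combination ih - hd * (d ^ N *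
          aeval (x p) (residuePoly q P (colorStrip c (w p) (M p))) ^ N)
    rw [hd', map_mul, mul_assoc, hN, mul_zero]
  calc ρ (E w) * z = ∑ w', ρ (E w') * z := by
        rw [Finset.sum_eq_single w (fun w' _ hne => h1 w' hne)
          (fun h => (h (Finset.mem_univ _)).elim)]
    _ = z := by rw [← Finset.sum_mul, ← map_sum, hE.sum, map_one, one_mul]

/-- The affine Hecke relations in an algebra together with block idempotents for separated
parameters. -/
structure IsBlockSystem (q : Rˣ) (P : J → R) (c : J → K) (n : ℕ) (j : D →ₐ[R] S) (T : ℕ → S)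
    (x : ℕ → D) (E : (Fin n → K) → D) : Prop extends
    IsAffineHecke q n j T x, IsWordIdempotents q P c x n E where
  inj : Function.Injective j
  sep : Separated q P c n

namespace IsBlockSystem

lemma jE_sum (h : IsBlockSystem q P c n j T x E) (a : S) : ∑ w, a * j (E w) = a := by
  rw [← Finset.mul_sum, ← map_sum, h.sum, map_one, mul_one]

lemma jE_mul (h : IsBlockSystem q P c n j T x E) (w : Fin n → K) :
    j (E w) * j (E w) = j (E w) := by rw [← map_mul, (h.idem w).eq]

lemma jE_ortho (h : IsBlockSystem q P c n j T x E) {w w' : Fin n → K} (hne : w ≠ w') :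
    j (E w) * j (E w') = 0 := by rw [← map_mul, h.ortho _ _ hne, map_zero]

lemma occ_add_cnt_lt (w : Fin n → K) (p : Fin n) {α : K} (hα : α ≠ w p) :
    occ w p + cnt w p α < n :=
  (cnt_add_le w p.2.le hα.symm).trans_lt p.2

/-- The generator `T_k` preserves the parts belonging to words with equal letters at the positions
`k` and `k + 1`. Symmetric functions of `x_k` and `x_{k+1}` commute with `T_k`, whence the
eigenvalues of these two elements are controlled on the image. -/
lemma T_mul_eq (h : IsBlockSystem q P c n j T x E) {k : ℕ} (hk : k + 1 < n) {w : Fin n → K}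
    (hw : w ⟨k, by lia⟩ = w ⟨k + 1, hk⟩) : j (E w) * (T k * j (E w)) = T k * j (E w) := by
  obtain ⟨N₁, hN₁⟩ := specIn_pow (h.idem w) (h.spec w ⟨k, by lia⟩)
  obtain ⟨N₂, hN₂⟩ := specIn_pow (h.idem w) (h.spec w ⟨k + 1, hk⟩)
  have hocc := occ_succ hk hw
  set g := residuePoly q P (colorStrip c (w ⟨k, by lia⟩) (occ w ⟨k, by lia⟩ + 1)) with hg
  rw [← hw, hocc, ← hg] at hN₂
  have hdvd : residuePoly q P (colorStrip c (w ⟨k, by lia⟩) (occ w ⟨k, by lia⟩)) ∣ g := by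
    refine Finset.prod_dvd_prod_of_subset _ _ _ fun p hp => ?_
    rw [mem_colorStrip] at hp ⊢
    exact ⟨hp.1, hp.2.trans (by simp)⟩
  have hN₁' : aeval (x k) (g ^ (N₁ + N₂)) * E w = 0 := by
    obtain ⟨r, hr⟩ := pow_dvd_pow_of_dvd hdvd N₁
    rw [pow_add, hr, map_mul, map_mul, mul_right_comm, mul_right_comm _ _ (E w), hN₁, zero_mul,
      zero_mul]
  have hN₂' : aeval (x (k + 1)) (g ^ (N₁ + N₂)) * E w = 0 := by
    rw [pow_add, map_mul, mul_assoc, hN₂, mul_zero]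
  set G := g ^ (N₁ + N₂) with hG
  have hcl : G ∈ Submonoid.closure (Set.range fun r : R => X - C r) :=
    Submonoid.pow_mem _ (residuePoly_mem_closure q P _) _
  have hadd : j (aeval (x k) G + aeval (x (k + 1)) G) * (T k * j (E w)) = 0 := by
    rw [← mul_assoc, ← (h.commute_aeval_add hk G).eq, mul_assoc, ← map_mul, add_mul, hN₁', hN₂',
      add_zero, map_zero, mul_zero]
  have hmul : j (aeval (x k) G * aeval (x (k + 1)) G) * (T k * j (E w)) = 0 := by
    rw [← mul_assoc, ← (h.commute_aeval_mul hk hcl).eq, mul_assoc, ← map_mul, mul_assoc, hN₂',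
      mul_zero, map_zero, mul_zero]
  have hsq : j (aeval (x k) (G ^ 2)) * (T k * j (E w)) = 0 ∧
      j (aeval (x (k + 1)) (G ^ 2)) * (T k * j (E w)) = 0 := by
    constructor
    · have e : aeval (x k) (G ^ 2) = aeval (x k) G * (aeval (x k) G + aeval (x (k + 1)) G)
          - aeval (x k) G * aeval (x (k + 1)) G := by rw [map_pow]; ring
      rw [e, map_sub, sub_mul, hmul, map_mul, mul_assoc, hadd, mul_zero, sub_zero]
    · have e : aeval (x (k + 1)) (G ^ 2)
          = aeval (x (k + 1)) G * (aeval (x k) G + aeval (x (k + 1)) G)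
          - aeval (x k) G * aeval (x (k + 1)) G := by rw [map_pow]; ring
      rw [e, map_sub, sub_mul, hmul, map_mul, mul_assoc, hadd, mul_zero, sub_zero]
  rw [hG, ← pow_mul] at hsq
  refine h.fix_of_kill h.sep j _ w
    (fun p => if (p : ℕ) = k then occ w p + 1 else occ w p) ?_ ?_
  · intro p α hα
    have h1 := occ_add_cnt_lt w p hα
    split_ifs with h2
    · have h3 : occ w p + cnt w p α ≤ p := cnt_add_le w p.2.le hα.symm
      lia
    · exact h1
  · intro p
    by_cases h1 : (p : ℕ) = k
    · obtain rfl : p = ⟨k, by lia⟩ := Fin.ext h1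
      exact ⟨_, by rw [if_pos rfl]; exact hsq.1⟩
    by_cases h2 : (p : ℕ) = k + 1
    · obtain rfl : p = ⟨k + 1, hk⟩ := Fin.ext h2
      exact ⟨_, by rw [if_neg h1, hocc, ← hw]; exact hsq.2⟩
    · obtain ⟨N, hN⟩ := specIn_pow (h.idem w) (h.spec w p)
      refine ⟨N, ?_⟩
      rw [if_neg h1, ← mul_assoc, ← (IsAffineHecke.commute_aeval_of_commute
        (h.comm k p hk p.2 h1 h2) _).eq, mul_assoc, ← map_mul, hN, map_zero, mul_zero]

lemma intertwiner_mul_aeval_swapAdj {q : Rˣ} {j : D →ₐ[R] S} {T : ℕ → S} {x : ℕ → D}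
    (h : IsAffineHecke q n j T x) {k : ℕ} (hk : k + 1 < n) (p : Fin n) (g : R[X]) :
    intertwiner j T x k * j (aeval (x (swapAdj n k p)) g)
      = j (aeval (x p) g) * intertwiner j T x k := by
  rw [swapAdj_val hk]
  split_ifs with h1 h2
  · rw [h1]; exact h.intertwiner_mul_aeval_succ hk g
  · rw [h2]; exact h.intertwiner_mul_aeval hk g
  · exact (IsAffineHecke.commute_aeval_of_commute
      (h.intertwiner_mul_of_ne hk p.2 h1 h2) g).eq

lemma intertwiner_mul_ne (h : IsBlockSystem q P c n j T x E) {k : ℕ} (hk : k + 1 < n)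
    {w : Fin n → K} (hw : w ⟨k, by lia⟩ ≠ w ⟨k + 1, hk⟩) :
    j (E (swapWord k w)) * (intertwiner j T x k * j (E w)) = intertwiner j T x k * j (E w) := by
  refine h.fix_of_kill h.sep j _ (swapWord k w) (occ (swapWord k w))
    (fun p α hα => occ_add_cnt_lt _ p hα) fun p => ?_
  obtain ⟨N, hN⟩ := specIn_pow (h.idem w) (h.spec w (swapAdj n k p))
  refine ⟨N, ?_⟩
  rw [occ_swapWord hk hw, swapWord_apply, ← mul_assoc,
    ← intertwiner_mul_aeval_swapAdj h.toIsAffineHecke hk, mul_assoc, ← map_mul, hN, map_zero,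
    mul_zero]

/-- The separation of the eigenvalues of `x_k` and `x_{k+1}` where `w` has distinct letters. -/
lemma isUnit_residue_sub (h : IsBlockSystem q P c n j T x E) {k : ℕ} (hk : k + 1 < n)
    {w : Fin n → K} (hw : w ⟨k, by lia⟩ ≠ w ⟨k + 1, hk⟩) {p p' : Σ _ : J, ℤ}
    (hp : p ∈ colorStrip c (w ⟨k, by lia⟩) (occ w ⟨k, by lia⟩))
    (hp' : p' ∈ colorStrip c (w ⟨k + 1, hk⟩) (occ w ⟨k + 1, hk⟩)) :
    IsUnit (residue q P p - residue q P p') ∧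
      IsUnit ((q : R) * residue q P p - residue q P p') ∧
      IsUnit ((q : R) * residue q P p' - residue q P p) := by
  rw [mem_colorStrip] at hp hp'
  have h1 := cnt_succ w ⟨k, by lia⟩ (w ⟨k + 1, hk⟩)
  rw [if_neg hw, add_zero] at h1
  have h2 : occ w ⟨k, by lia⟩ + occ w ⟨k + 1, hk⟩ ≤ k := by
    rw [occ, occ]
    simp only at h1 ⊢
    rw [h1]
    exact cnt_add_le w (by lia) hw
  have hc : c p.1 ≠ c p'.1 := by rw [hp.1, hp'.1]; exact hw
  have hmul : ∀ p : Σ _ : J, ℤ, (q : R) * residue q P p = residue q P ⟨p.1, p.2 + 1⟩ := by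
    intro p
    simp only [residue, zpow_add, zpow_one, Units.val_mul]
    ring
  refine ⟨h.sep _ _ _ _ hc (by lia), ?_, ?_⟩
  · rw [hmul]
    have := abs_add_le p.2 1
    rw [abs_one] at this
    exact h.sep _ _ _ _ hc (by lia)
  · rw [hmul]
    have := abs_add_le p'.2 1
    rw [abs_one] at this
    exact h.sep _ _ _ _ hc.symm (by lia)

lemma exists_sub_inverse (h : IsBlockSystem q P c n j T x E) {k : ℕ} (hk : k + 1 < n)
    {w : Fin n → K} (hw : w ⟨k, by lia⟩ ≠ w ⟨k + 1, hk⟩) :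
    ∃ d, (x k - x (k + 1)) * d * E w = E w := by
  have := exists_inverse_of_specIn (h.idem w) (h.spec w ⟨k, by lia⟩) (h.spec w ⟨k + 1, hk⟩) 1 1
    fun p hp p' hp' => by simpa using (h.isUnit_residue_sub hk hw hp hp').1
  simpa using this

lemma exists_intertwiner_sq_inverse (h : IsBlockSystem q P c n j T x E) {k : ℕ} (hk : k + 1 < n)
    {w : Fin n → K} (hw : w ⟨k, by lia⟩ ≠ w ⟨k + 1, hk⟩) :
    ∃ d, (((q : R) • x k - x (k + 1)) * ((q : R) • x (k + 1) - x k)) * d * E w = E w := by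
  obtain ⟨d, hd⟩ := exists_inverse_of_specIn (h.idem w) (h.spec w ⟨k, by lia⟩)
    (h.spec w ⟨k + 1, hk⟩) (q : R) 1
    fun p hp p' hp' => by simpa using (h.isUnit_residue_sub hk hw hp hp').2.1
  obtain ⟨d', hd'⟩ := exists_inverse_of_specIn (h.idem w) (h.spec w ⟨k + 1, hk⟩)
    (h.spec w ⟨k, by lia⟩) (q : R) 1
    fun p hp p' hp' => by simpa using (h.isUnit_residue_sub hk hw hp' hp).2.2
  simp only [one_smul] at hd hd'
  refine ⟨d * d', ?_⟩
  linear_combination hd + ((q : R) • x k - x (k + 1)) * d * hd'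

/-- On a part with distinct letters, `T_k` is a combination of the intertwiner and of elements of
`D`. -/
lemma T_mul_ne (h : IsBlockSystem q P c n j T x E) {k : ℕ} (hk : k + 1 < n)
    {w : Fin n → K} (hw : w ⟨k, by lia⟩ ≠ w ⟨k + 1, hk⟩) :
    ∃ d, T k * j (E w) = intertwiner j T x k * j (E w) * j d
      - ((q : R) - 1) • (j (E w) * j (x (k + 1) * d)) := by
  obtain ⟨d, hd⟩ := h.exists_sub_inverse hk hw
  refine ⟨d, ?_⟩
  conv_lhs => rw [← hd]
  rw [map_mul, map_mul, ← mul_assoc, ← mul_assoc,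
    show T k * j (x k - x (k + 1)) = intertwiner j T x k - ((q : R) - 1) • j (x (k + 1)) by
      rw [h.intertwiner_eq hk, add_sub_cancel_right],
    sub_mul, sub_mul, smul_mul_assoc, smul_mul_assoc, mul_assoc, ← map_mul, ← map_mul, ← map_mul,
    mul_assoc _ (j (E w)), ← map_mul, ← map_mul, mul_comm d, mul_comm (E w) (_ * d)]

lemma T_mul_ne_ortho (h : IsBlockSystem q P c n j T x E) {k : ℕ} (hk : k + 1 < n)
    {w w' : Fin n → K} (hw : w ⟨k, by lia⟩ ≠ w ⟨k + 1, hk⟩) (h1 : w' ≠ w)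
    (h2 : w' ≠ swapWord k w) : j (E w') * (T k * j (E w)) = 0 := by
  obtain ⟨d, hd⟩ := h.T_mul_ne hk hw
  rw [hd, ← h.intertwiner_mul_ne hk hw, mul_sub, mul_smul_comm]
  simp only [← mul_assoc]
  rw [h.jE_ortho h1, h.jE_ortho h2]
  simp

lemma T_commute (h : IsBlockSystem q P c n j T x E) {k : ℕ} (hk : k + 1 < n) {w : Fin n → K}
    (hw : w ⟨k, by lia⟩ = w ⟨k + 1, hk⟩) : Commute (T k) (j (E w)) := by
  have h1 : ∀ w', w' ≠ w → j (E w) * (T k * j (E w')) = 0 := by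
    intro w' hne
    by_cases hw' : w' ⟨k, by lia⟩ = w' ⟨k + 1, hk⟩
    · rw [← h.T_mul_eq hk hw', ← mul_assoc, h.jE_ortho hne.symm, zero_mul]
    · refine h.T_mul_ne_ortho hk hw' hne.symm fun h2 => hw' ?_
      rw [h2, swapWord_left hk, swapWord_right hk] at hw
      exact hw.symm
  have h2 := h.jE_sum (j (E w) * T k)
  simp_rw [mul_assoc] at h2
  rw [Finset.sum_eq_single w (fun w' _ hne => h1 w' hne)
    (fun h => (h (Finset.mem_univ _)).elim), h.T_mul_eq hk hw] at h2
  exact h2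

lemma intertwiner_commute (h : IsBlockSystem q P c n j T x E) {k : ℕ} (hk : k + 1 < n)
    {w : Fin n → K} (hw : w ⟨k, by lia⟩ = w ⟨k + 1, hk⟩) :
    Commute (intertwiner j T x k) (j (E w)) :=
  have h1 := h.T_commute hk hw
  (h1.mul_left (IsAffineHecke.jcomm j _ _)).sub_left
    (Commute.mul_left (IsAffineHecke.jcomm j _ _) h1)

lemma intertwiner_mul_jE (h : IsBlockSystem q P c n j T x E) {k : ℕ} (hk : k + 1 < n)
    {w : Fin n → K} (hw : w ⟨k, by lia⟩ ≠ w ⟨k + 1, hk⟩) :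
    intertwiner j T x k * j (E w) = j (E (swapWord k w)) * intertwiner j T x k := by
  have h1 : ∀ w', w' ≠ w → j (E (swapWord k w)) * (intertwiner j T x k * j (E w')) = 0 := by
    intro w' hne
    by_cases hw' : w' ⟨k, by lia⟩ = w' ⟨k + 1, hk⟩
    · rw [(h.intertwiner_commute hk hw').eq, ← mul_assoc, h.jE_ortho, zero_mul]
      rintro rfl
      rw [swapWord_left hk, swapWord_right hk] at hw'
      exact hw hw'.symm
    · rw [← h.intertwiner_mul_ne hk hw', ← mul_assoc, h.jE_ortho, zero_mul]
      intro h2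
      refine hne ?_
      rw [← swapWord_swapWord k w', ← h2, swapWord_swapWord]
  have h2 := h.jE_sum (j (E (swapWord k w)) * intertwiner j T x k)
  simp_rw [mul_assoc] at h2
  rw [Finset.sum_eq_single w (fun w' _ hne => h1 w' hne)
    (fun h => (h (Finset.mem_univ _)).elim), h.intertwiner_mul_ne hk hw] at h2
  exact h2

/-- On the part belonging to `w`, the first Jucys-Murphy element attached to a letter satisfies the
cyclotomic relation of that letter. It is moved to the front by intertwiners. -/
lemma first_occurrence (h : IsBlockSystem q P c n j T x E)
    (h0 : 0 < n → aeval (x 0) (residuePoly q P (strip Finset.univ fun _ => 0)) = 0) (k : ℕ)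
    (hk : k < n) (w : Fin n → K) (hw : occ w ⟨k, hk⟩ = 0) :
    aeval (x k) (residuePoly q P (colorStrip c (w ⟨k, hk⟩) 0)) * E w = 0 := by
  induction k generalizing w with
  | zero =>
    obtain ⟨d, hd⟩ := exists_inverse_residuePoly (h.idem w) (h.spec w ⟨0, hk⟩)
      (t := (strip Finset.univ fun _ => 0).filter fun p => c p.1 ≠ w ⟨0, hk⟩) (by
        intro p hp p' hp'
        rw [hw, mem_colorStrip] at hp
        rw [Finset.mem_filter, mem_strip] at hp'
        exact h.sep _ _ _ _ (by rw [hp.1]; exact hp'.2.symm) (by lia))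
    have h1 : residuePoly q P (colorStrip c (w ⟨0, hk⟩) 0)
        * residuePoly q P ((strip Finset.univ fun _ => 0).filter fun p => c p.1 ≠ w ⟨0, hk⟩)
        = residuePoly q P (strip Finset.univ fun _ => 0) := by
      rw [residuePoly, residuePoly, residuePoly, ← Finset.prod_filter_mul_prod_filter_not
        (strip Finset.univ fun _ => 0) fun p => c p.1 = w ⟨0, hk⟩]
      congr 2
      ext p
      rw [mem_colorStrip, Finset.mem_filter, mem_strip]
      simp [and_comm]
    simp only at hd
    have h2 := h0 hk
    rw [← h1, map_mul] at h2
    linear_combination (d * E w) * h2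
      - aeval (x 0) (residuePoly q P (colorStrip c (w ⟨0, hk⟩) 0)) * hd
  | succ k ih =>
    have hne : w ⟨k, by lia⟩ ≠ w ⟨k + 1, hk⟩ := fun heq => by
      rw [occ_succ hk heq] at hw
      lia
    have h1 := ih (by lia) (swapWord k w) (by
      rw [occ_swapWord hk hne, ← hw]
      congr 1
      ext
      simp [swapAdj_val hk])
    rw [swapWord_left hk] at h1
    obtain ⟨d, hd⟩ := h.exists_intertwiner_sq_inverse hk hne
    have h2 : aeval (x (k + 1)) (residuePoly q P (colorStrip c (w ⟨k + 1, hk⟩) 0))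
        * (((q : R) • x k - x (k + 1)) * ((q : R) • x (k + 1) - x k)) * E w = 0 := by
      apply h.inj
      rw [map_mul, map_mul, ← h.intertwiner_mul_intertwiner hk, mul_assoc, mul_assoc,
        h.intertwiner_mul_jE hk hne, ← mul_assoc, ← h.intertwiner_mul_aeval hk, mul_assoc,
        ← mul_assoc (j (aeval _ _)), ← map_mul, h1, map_zero, zero_mul, mul_zero]
    linear_combination d * h2
      - aeval (x (k + 1)) (residuePoly q P (colorStrip c (w ⟨k + 1, hk⟩) 0)) * hd

end IsBlockSystem
end BlockSystem

/-! ### Sorting words by intertwiners -/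

section Sorting

open Polynomial

/-- The letters of `w` at the positions `k` and `k + 1` are in the wrong order. -/
def IsDescent {n κ : ℕ} (k : ℕ) (w : Fin n → Fin κ) : Prop :=
  ∃ hk : k + 1 < n, w ⟨k + 1, hk⟩ < w ⟨k, by lia⟩

/-- A measure of disorder, which decreases whenever a descent is removed. -/
def disorder {n κ : ℕ} (w : Fin n → Fin κ) : ℕ := ∑ p : Fin n, (n - p) * (w p : ℕ)

lemma disorder_swapWord_lt {n κ : ℕ} {k : ℕ} {w : Fin n → Fin κ} (h : IsDescent k w) :
    disorder (swapWord k w) < disorder w := by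
  obtain ⟨hk, hw⟩ := h
  have hne : (⟨k + 1, hk⟩ : Fin n) ∈ Finset.univ.erase (⟨k, by lia⟩ : Fin n) := by simp
  rw [disorder, disorder, ← Finset.add_sum_erase _ _ (Finset.mem_univ (⟨k, by lia⟩ : Fin n)),
    ← Finset.add_sum_erase _ _ hne,
    ← Finset.add_sum_erase _ _ (Finset.mem_univ (⟨k, by lia⟩ : Fin n)),
    ← Finset.add_sum_erase _ _ hne, swapWord_left hk, swapWord_right hk, ← add_assoc, ← add_assoc]
  have hrest : ∑ p ∈ (Finset.univ.erase (⟨k, by lia⟩ : Fin n)).erase ⟨k + 1, hk⟩,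
      (n - (p : ℕ)) * ((swapWord k w p : Fin κ) : ℕ)
      = ∑ p ∈ (Finset.univ.erase (⟨k, by lia⟩ : Fin n)).erase ⟨k + 1, hk⟩,
      (n - (p : ℕ)) * ((w p : Fin κ) : ℕ) := by
    refine Finset.sum_congr rfl fun p hp => ?_
    simp only [Finset.mem_erase, ne_eq, Fin.ext_iff, Finset.mem_univ, and_true] at hp
    rw [swapWord_of_ne hk w hp.2 hp.1]
  rw [hrest]
  refine Nat.add_lt_add_right ?_ _
  have h1 : n - k = (n - (k + 1)) + 1 := by lia
  have h2 : (w ⟨k + 1, hk⟩ : ℕ) < (w ⟨k, by lia⟩ : ℕ) := hw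
  simp only
  rw [h1]
  nlinarith

lemma monotone_of_not_isDescent {n κ : ℕ} {w : Fin n → Fin κ} (h : ∀ k, ¬ IsDescent k w) :
    Monotone w := by
  have h1 : ∀ m, ∀ i (hi : i + m < n), w ⟨i, by lia⟩ ≤ w ⟨i + m, hi⟩ := by
    intro m
    induction m with
    | zero => exact fun i hi => le_rfl
    | succ m ih =>
      intro i hi
      refine (ih i (by lia)).trans (not_lt.1 fun hlt => h (i + m) ⟨by lia, hlt⟩)
  intro a b hab
  have := h1 (b - a) a (by lia)
  convert! this using 2
  ext
  simp only [Fin.le_def] at hab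
  simp only
  lia

/-- The increasing rearrangement of a word. -/
def sortWord {n κ : ℕ} (w : Fin n → Fin κ) : Fin n → Fin κ := w ∘ Tuple.sort w

lemma sortWord_swapWord {n κ : ℕ} (k : ℕ) (w : Fin n → Fin κ) :
    sortWord (swapWord k w) = sortWord w := Tuple.comp_perm_comp_sort_eq_comp_sort

lemma sortWord_of_monotone {n κ : ℕ} {w : Fin n → Fin κ} (h : Monotone w) : sortWord w = w := by
  rw [sortWord, Tuple.sort_eq_refl_iff_monotone.2 h]
  rfl

lemma monotone_sortWord {n κ : ℕ} (w : Fin n → Fin κ) : Monotone (sortWord w) :=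
  Tuple.monotone_sort w

variable {R : Type u} [CommRing R] {S : Type*} [Ring S] [Algebra R S] {D : Type*} [CommRing D]
  [Algebra R D] {q : Rˣ} {n : ℕ} {j : D →ₐ[R] S} {T : ℕ → S} {x : ℕ → D} {J : Type v} [Fintype J]
  {P : J → R} {κ : ℕ} {c : J → Fin κ} {E : (Fin n → Fin κ) → D}

open Classical in
/-- The product of intertwiners which sorts the word `w`, removing one descent after the other. -/
def sorter (j : D →ₐ[R] S) (T : ℕ → S) (x : ℕ → D) (E : (Fin n → Fin κ) → D)
    (w : Fin n → Fin κ) : S :=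
  if h : ∃ k, IsDescent k w then
    intertwiner j T x h.choose * sorter j T x E (swapWord h.choose w)
  else j (E w)
termination_by disorder w
decreasing_by exact disorder_swapWord_lt h.choose_spec

lemma sorter_of_monotone {w : Fin n → Fin κ} (h : ∀ k, ¬ IsDescent k w) :
    sorter j T x E w = j (E w) := by
  rw [sorter, dif_neg (not_exists.2 h)]

/-- Induction on the disorder of a word. -/
lemma sorting_induction {motive : (Fin n → Fin κ) → Prop}
    (base : ∀ w, (∀ k, ¬ IsDescent k w) → motive w)
    (step : ∀ w k, IsDescent k w → (∀ w', disorder w' < disorder w → motive w') → motive w)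
    (w : Fin n → Fin κ) : motive w := by
  generalize hm : disorder w = m
  induction m using Nat.strong_induction_on generalizing w with
  | _ m ih =>
    subst hm
    by_cases h : ∃ k, IsDescent k w
    · obtain ⟨k, hk⟩ := h
      exact step w k hk fun w' hw' => ih _ hw' w' rfl
    · exact base w (not_exists.1 h)

lemma IsDescent.far {k l : ℕ} {w : Fin n → Fin κ} (hk : IsDescent k w) (hl : l + 1 < n)
    (h : k + 1 < l ∨ l + 1 < k) : IsDescent k (swapWord l w) := by
  obtain ⟨hk, hw⟩ := hk
  refine ⟨hk, ?_⟩
  rwa [swapWord_of_ne hl _ (by simp only; lia) (by simp only; lia),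
    swapWord_of_ne hl _ (by simp only; lia) (by simp only; lia)]

namespace IsBlockSystem

/-- The sorting element does not depend on the order in which descents are removed: removing two
descents commutes up to the braid relations of the intertwiners. -/
lemma sorter_of_isDescent (h : IsBlockSystem q P c n j T x E) {k : ℕ} {w : Fin n → Fin κ}
    (hk : IsDescent k w) :
    sorter j T x E w = intertwiner j T x k * sorter j T x E (swapWord k w) := by
  induction w using sorting_induction generalizing k with
  | base w hw => exact (hw k hk).elim
  | step w _ _ ih =>
    have hadj : ∀ a, IsDescent a w → IsDescent (a + 1) w →
        intertwiner j T x a * sorter j T x E (swapWord a w)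
          = intertwiner j T x (a + 1) * sorter j T x E (swapWord (a + 1) w) := by
      intro a h0 h1
      have l0 := disorder_swapWord_lt h0
      have l1 := disorder_swapWord_lt h1
      obtain ⟨hn0, hw0⟩ := id h0
      obtain ⟨hn1, hw1⟩ := id h1
      have d0 : IsDescent (a + 1) (swapWord a w) := by
        refine ⟨hn1, ?_⟩
        rw [swapWord_right hn0, swapWord_of_ne hn0 w (by simp only; lia) (by simp only; lia)]
        exact hw1.trans hw0
      have d1 : IsDescent a (swapWord (a + 1) w) := by
        refine ⟨hn0, ?_⟩
        rw [swapWord_left hn1, swapWord_of_ne hn1 w (by simp only; lia) (by simp only; lia)]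
        exact hw1.trans hw0
      have d00 : IsDescent a (swapWord (a + 1) (swapWord a w)) := by
        refine ⟨hn0, ?_⟩
        rw [swapWord_left hn1, swapWord_of_ne hn1 _ (by simp only; lia) (by simp only; lia),
          swapWord_left hn0, swapWord_of_ne hn0 w (by simp only; lia) (by simp only; lia)]
        exact hw1
      have d11 : IsDescent (a + 1) (swapWord a (swapWord (a + 1) w)) := by
        refine ⟨hn1, ?_⟩
        rw [swapWord_right hn0, swapWord_of_ne hn0 _ (by simp only; lia) (by simp only; lia),
          swapWord_right hn1, swapWord_of_ne hn1 w (by simp only; lia) (by simp only; lia)]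
        exact hw0
      rw [ih _ l0 d0, ih _ ((disorder_swapWord_lt d0).trans l0) d00, ih _ l1 d1,
        ih _ ((disorder_swapWord_lt d1).trans l1) d11, swapWord_braid hn1, ← mul_assoc,
        ← mul_assoc, ← mul_assoc, ← mul_assoc, h.intertwiner_braid hn1]
    have hex : ∃ k, IsDescent k w := ⟨k, hk⟩
    rw [sorter, dif_pos hex]
    generalize hp : hex.choose = p
    have hpd : IsDescent p w := hp ▸ hex.choose_spec
    have lp := disorder_swapWord_lt hpd
    have lk := disorder_swapWord_lt hk
    rcases lt_trichotomy k p with hlt | rfl | hlt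
    · rcases Nat.lt_or_ge (k + 1) p with h1 | h1
      · rw [ih _ lp (hk.far hpd.1 (Or.inl h1)), ih _ lk (hpd.far hk.1 (Or.inr h1)),
          ← mul_assoc, ← mul_assoc, (h.intertwiner_far hk.1 hpd.1 (Or.inl h1)).eq,
          swapWord_far hk.1 hpd.1 (Or.inl h1)]
      · obtain rfl : p = k + 1 := by lia
        exact (hadj k hk hpd).symm
    · rfl
    · rcases Nat.lt_or_ge (p + 1) k with h1 | h1
      · rw [ih _ lp (hk.far hpd.1 (Or.inr h1)), ih _ lk (hpd.far hk.1 (Or.inl h1)),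
          ← mul_assoc, ← mul_assoc, (h.intertwiner_far hk.1 hpd.1 (Or.inr h1)).eq,
          swapWord_far hk.1 hpd.1 (Or.inr h1)]
      · obtain rfl : k = p + 1 := by lia
        exact hadj p hpd hk

lemma jE_mul_sorter (h : IsBlockSystem q P c n j T x E) (w : Fin n → Fin κ) :
    j (E w) * sorter j T x E w = sorter j T x E w := by
  induction w using sorting_induction with
  | base w hw => rw [sorter_of_monotone hw, h.jE_mul]
  | step w k hk ih =>
    obtain ⟨hk', hw⟩ := id hk
    have hw' : swapWord k w ⟨k, by lia⟩ ≠ swapWord k w ⟨k + 1, hk'⟩ := by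
      rw [swapWord_left hk', swapWord_right hk']
      exact hw.ne
    have h1 := h.intertwiner_mul_jE hk' hw'
    rw [swapWord_swapWord] at h1
    rw [h.sorter_of_isDescent hk, ← mul_assoc]
    rw [← h1, mul_assoc, ih _ (disorder_swapWord_lt hk)]

lemma sorter_mul_jE (h : IsBlockSystem q P c n j T x E) (w : Fin n → Fin κ) :
    sorter j T x E w * j (E (sortWord w)) = sorter j T x E w := by
  induction w using sorting_induction with
  | base w hw =>
    rw [sorter_of_monotone hw, sortWord_of_monotone (monotone_of_not_isDescent hw), h.jE_mul]
  | step w k hk ih =>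
    rw [h.sorter_of_isDescent hk, mul_assoc, ← sortWord_swapWord k w,
      ih _ (disorder_swapWord_lt hk)]

/-- Sorting elements are invertible between the two parts which they connect. -/
lemma exists_sorter_mul (h : IsBlockSystem q P c n j T x E) (w : Fin n → Fin κ) :
    ∃ v, sorter j T x E w * v = j (E w) := by
  induction w using sorting_induction with
  | base w hw => exact ⟨j (E w), by rw [sorter_of_monotone hw, h.jE_mul]⟩
  | step w k hk ih =>
    obtain ⟨v, hv⟩ := ih _ (disorder_swapWord_lt hk)
    obtain ⟨hk', hw⟩ := id hk
    obtain ⟨d, hd⟩ := h.exists_intertwiner_sq_inverse hk' hw.ne'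
    refine ⟨v * intertwiner j T x k * j (E w * d), ?_⟩
    rw [h.sorter_of_isDescent hk, ← mul_assoc, ← mul_assoc, mul_assoc (intertwiner j T x k), hv,
      mul_assoc (intertwiner j T x k), ← h.intertwiner_mul_jE hk' hw.ne', ← mul_assoc,
      h.intertwiner_mul_intertwiner hk', ← map_mul, ← map_mul]
    congr 1
    linear_combination hd + d * (((q : R) • x k - x (k + 1)) * ((q : R) • x (k + 1) - x k))
      * (h.idem w).eq

/-- Sorting elements permute the Jucys-Murphy elements. -/
lemma exists_x_mul_sorter (h : IsBlockSystem q P c n j T x E) (w : Fin n → Fin κ) (p : Fin n) :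
    ∃ p' : Fin n, j (x p) * sorter j T x E w = sorter j T x E w * j (x p') := by
  induction w using sorting_induction generalizing p with
  | base w hw => exact ⟨p, by rw [sorter_of_monotone hw, IsAffineHecke.jcomm]⟩
  | step w k hk ih =>
    obtain ⟨p', hp'⟩ := ih _ (disorder_swapWord_lt hk) (swapAdj n k p)
    refine ⟨p', ?_⟩
    have h1 := intertwiner_mul_aeval_swapAdj h.toIsAffineHecke hk.1 p X
    rw [aeval_X, aeval_X] at h1
    rw [h.sorter_of_isDescent hk, ← mul_assoc, ← h1, mul_assoc, hp', mul_assoc]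

/-- Sorting elements carry the generators between equal letters to generators between equal
letters. -/
lemma exists_T_mul_sorter (h : IsBlockSystem q P c n j T x E) (w : Fin n → Fin κ) {k : ℕ}
    (hk : k + 1 < n) (hw : w ⟨k, by lia⟩ = w ⟨k + 1, hk⟩) :
    ∃ (k' : ℕ) (hk' : k' + 1 < n), sortWord w ⟨k', by lia⟩ = sortWord w ⟨k' + 1, hk'⟩ ∧
      T k * sorter j T x E w = sorter j T x E w * T k' := by
  induction w using sorting_induction generalizing k with
  | base w hw' =>
    refine ⟨k, hk, ?_, ?_⟩
    · rwa [sortWord_of_monotone (monotone_of_not_isDescent hw')]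
    · rw [sorter_of_monotone hw', (h.T_commute hk hw).eq]
  | step w p hp ih =>
    obtain ⟨hpn, hpw⟩ := id hp
    have lp := disorder_swapWord_lt hp
    rcases lt_trichotomy k p with hlt | rfl | hlt
    · rcases Nat.lt_or_ge (k + 1) p with h1 | h1
      · obtain ⟨k', hk', hs, hT⟩ := ih _ lp hk (by
          rwa [swapWord_of_ne hpn _ (by simp only; lia) (by simp only; lia),
            swapWord_of_ne hpn _ (by simp only; lia) (by simp only; lia)])
        refine ⟨k', hk', ?_, ?_⟩
        · rwa [sortWord_swapWord] at hs
        · rw [h.sorter_of_isDescent hp, ← mul_assoc, (h.far_intertwiner hk hpn (Or.inl h1)).eq,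
            mul_assoc, hT, mul_assoc]
      · obtain rfl : p = k + 1 := by lia
        have hd : IsDescent k (swapWord (k + 1) w) := by
          refine ⟨hk, ?_⟩
          rw [swapWord_left hpn, swapWord_of_ne hpn _ (by simp only; lia) (by simp only; lia), hw]
          exact hpw
        obtain ⟨k', hk', hs, hT⟩ := ih _ ((disorder_swapWord_lt hd).trans lp) hpn (by
          rw [swapWord_right hk, swapWord_of_ne hk _ (by simp only; lia) (by simp only; lia),
            swapWord_right hpn, swapWord_of_ne hpn _ (by simp only; lia) (by simp only; lia), hw])
        refine ⟨k', hk', ?_, ?_⟩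
        · rwa [sortWord_swapWord, sortWord_swapWord] at hs
        · rw [h.sorter_of_isDescent hp, h.sorter_of_isDescent hd, ← mul_assoc, ← mul_assoc,
            mul_assoc (T k), ← h.intertwiner_mul_intertwiner_mul' hpn, mul_assoc, hT,
            mul_assoc, mul_assoc, mul_assoc]
    · exact (hpw.ne hw.symm).elim
    · rcases Nat.lt_or_ge (p + 1) k with h1 | h1
      · obtain ⟨k', hk', hs, hT⟩ := ih _ lp hk (by
          rwa [swapWord_of_ne hpn _ (by simp only; lia) (by simp only; lia),
            swapWord_of_ne hpn _ (by simp only; lia) (by simp only; lia)])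
        refine ⟨k', hk', ?_, ?_⟩
        · rwa [sortWord_swapWord] at hs
        · rw [h.sorter_of_isDescent hp, ← mul_assoc, (h.far_intertwiner hk hpn (Or.inr h1)).eq,
            mul_assoc, hT, mul_assoc]
      · obtain rfl : k = p + 1 := by lia
        have hd : IsDescent (p + 1) (swapWord p w) := by
          refine ⟨hk, ?_⟩
          rw [swapWord_right hpn, swapWord_of_ne hpn _ (by simp only; lia) (by simp only; lia),
            ← hw]
          exact hpw
        obtain ⟨k', hk', hs, hT⟩ := ih _ ((disorder_swapWord_lt hd).trans lp) hpn (by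
          rw [swapWord_left hk, swapWord_of_ne hk _ (by simp only; lia) (by simp only; lia),
            swapWord_left hpn, swapWord_of_ne hpn _ (by simp only; lia) (by simp only; lia), hw])
        refine ⟨k', hk', ?_, ?_⟩
        · rwa [sortWord_swapWord, sortWord_swapWord] at hs
        · rw [h.sorter_of_isDescent hp, h.sorter_of_isDescent hd, ← mul_assoc, ← mul_assoc,
            mul_assoc (T (p + 1)), ← h.intertwiner_mul_intertwiner_mul hk, mul_assoc, hT,
            mul_assoc, mul_assoc, mul_assoc]

end IsBlockSystem
end Sorting

/-! ### The corners cut out by monotone words -/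

section Corner

variable {R : Type u} [CommRing R] {S : Type*} [Ring S] [Algebra R S] {D : Type*} [CommRing D]
  [Algebra R D] {q : Rˣ} {n : ℕ} {j : D →ₐ[R] S} {T : ℕ → S} {x : ℕ → D} {J : Type v} [Fintype J]
  {P : J → R} {κ : ℕ} {c : J → Fin κ} {E : (Fin n → Fin κ) → D} {w₀ : Fin n → Fin κ}
  {B : NonUnitalSubalgebra R S}

/-- `B` is a nonunital subalgebra with unit element `e = j (E w₀)`, which contains `j (x p) e` for
all `p`, and `T k e` whenever `w₀` has equal letters at the positions `k` and `k + 1`. -/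
structure IsCornerAlgebra (n : ℕ) (j : D →ₐ[R] S) (T : ℕ → S) (x : ℕ → D)
    (E : (Fin n → Fin κ) → D) (w₀ : Fin n → Fin κ) (B : NonUnitalSubalgebra R S) : Prop where
  one_mem : j (E w₀) ∈ B
  one_mul : ∀ b ∈ B, j (E w₀) * b = b
  x_mem : ∀ p : Fin n, j (x p) * j (E w₀) ∈ B
  T_mem : ∀ (k : ℕ) (hk : k + 1 < n), w₀ ⟨k, by lia⟩ = w₀ ⟨k + 1, hk⟩ → T k * j (E w₀) ∈ B

namespace IsCornerAlgebra

lemma mul_mem (hB : IsCornerAlgebra n j T x E w₀ B) {s b : S} (hs : s * j (E w₀) ∈ B)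
    (hb : b ∈ B) : s * b ∈ B := by
  rw [← hB.one_mul b hb, ← mul_assoc]
  exact B.mul_mem hs hb

/-- The span of the products of sorting elements of the rearrangements of `w₀` with elements
of `B`. -/
def sorterSpan (j : D →ₐ[R] S) (T : ℕ → S) (x : ℕ → D)
    (E : (Fin n → Fin κ) → D) (w₀ : Fin n → Fin κ) (B : NonUnitalSubalgebra R S) :
    Submodule R S :=
  Submodule.span R {s | ∃ w, sortWord w = w₀ ∧ ∃ b ∈ B, s = sorter j T x E w * b}

lemma mem_sorterSpan {w : Fin n → Fin κ} {b : S} (hw : sortWord w = w₀) (hb : b ∈ B) :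
    sorter j T x E w * b ∈ sorterSpan j T x E w₀ B :=
  Submodule.subset_span ⟨w, hw, b, hb, rfl⟩

lemma exists_j_mul_sorter (hB : IsCornerAlgebra n j T x E w₀ B)
    (h : IsBlockSystem q P c n j T x E) (hD : Algebra.adjoin R {a | ∃ l < n, a = x l} = ⊤)
    {w : Fin n → Fin κ} (d : D) {b : S} (hb : b ∈ B) :
    ∃ b' ∈ B, j d * (sorter j T x E w * b) = sorter j T x E w * b' := by
  have hd : d ∈ Algebra.adjoin R {a | ∃ l < n, a = x l} := by rw [hD]; trivial
  induction hd using Algebra.adjoin_induction generalizing b with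
  | mem a ha =>
    obtain ⟨l, hl, rfl⟩ := ha
    obtain ⟨p', hp'⟩ := h.exists_x_mul_sorter w ⟨l, hl⟩
    exact ⟨j (x p') * b, hB.mul_mem (hB.x_mem p') hb, by rw [← mul_assoc, hp', mul_assoc]⟩
  | algebraMap r =>
    exact ⟨r • b, SMulMemClass.smul_mem r hb, by
      rw [AlgHom.commutes, ← Algebra.smul_def, mul_smul_comm]⟩
  | add a a' _ _ ha ha' =>
    obtain ⟨b₁, hb₁, e₁⟩ := ha hb
    obtain ⟨b₂, hb₂, e₂⟩ := ha' hb
    exact ⟨b₁ + b₂, B.add_mem hb₁ hb₂, by rw [map_add, add_mul, e₁, e₂, mul_add]⟩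
  | mul a a' _ _ ha ha' =>
    obtain ⟨b₂, hb₂, e₂⟩ := ha' hb
    obtain ⟨b₁, hb₁, e₁⟩ := ha hb₂
    exact ⟨b₁, hb₁, by rw [map_mul, mul_assoc, e₂, e₁]⟩

lemma intertwiner_mul_mem (hB : IsCornerAlgebra n j T x E w₀ B)
    (h : IsBlockSystem q P c n j T x E) (hD : Algebra.adjoin R {a | ∃ l < n, a = x l} = ⊤)
    {k : ℕ} (hk : k + 1 < n) {w : Fin n → Fin κ} (hw : w ⟨k, by lia⟩ ≠ w ⟨k + 1, hk⟩)
    (hw₀ : sortWord w = w₀) {b : S} (hb : b ∈ B) :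
    intertwiner j T x k * (sorter j T x E w * b) ∈ sorterSpan j T x E w₀ B := by
  rcases lt_or_gt_of_ne hw with hlt | hlt
  · have hd : IsDescent k (swapWord k w) :=
      ⟨hk, by rwa [swapWord_left hk, swapWord_right hk]⟩
    have h1 := h.sorter_of_isDescent hd
    rw [swapWord_swapWord] at h1
    rw [← mul_assoc, ← h1]
    exact mem_sorterSpan (by rw [sortWord_swapWord, hw₀]) hb
  · rw [h.sorter_of_isDescent (k := k) ⟨hk, hlt⟩, mul_assoc, ← mul_assoc,
      h.intertwiner_mul_intertwiner hk]
    obtain ⟨b', hb', e⟩ := hB.exists_j_mul_sorter h hD (w := swapWord k w) _ hb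
    rw [e]
    exact mem_sorterSpan (by rw [sortWord_swapWord, hw₀]) hb'

lemma mul_mem_sorterSpan (hB : IsCornerAlgebra n j T x E w₀ B)
    (h : IsBlockSystem q P c n j T x E) (hD : Algebra.adjoin R {a | ∃ l < n, a = x l} = ⊤)
    (hS : ∀ A : Subalgebra R S, (∀ d, j d ∈ A) → (∀ k, k + 1 < n → T k ∈ A) → A = ⊤)
    (s : S) {z : S} (hz : z ∈ sorterSpan j T x E w₀ B) : s * z ∈ sorterSpan j T x E w₀ B := by
  let A : Subalgebra R S :=
    { carrier := {s | ∀ z ∈ sorterSpan j T x E w₀ B, s * z ∈ sorterSpan j T x E w₀ B}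
      mul_mem' := fun {a b} ha hb z hz => by rw [mul_assoc]; exact ha _ (hb _ hz)
      add_mem' := fun {a b} ha hb z hz => by
        rw [add_mul]; exact Submodule.add_mem _ (ha _ hz) (hb _ hz)
      algebraMap_mem' := fun r z hz => by
        rw [← Algebra.smul_def]; exact Submodule.smul_mem _ _ hz }
  have key : ∀ s : S, (∀ w, sortWord w = w₀ → ∀ b ∈ B,
      s * (sorter j T x E w * b) ∈ sorterSpan j T x E w₀ B) → s ∈ A := by
    intro s hs z hz
    induction hz using Submodule.span_induction with
    | mem y hy => obtain ⟨w, hw, b, hb, rfl⟩ := hy; exact hs w hw b hb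
    | zero => rw [mul_zero]; exact Submodule.zero_mem _
    | add y y' _ _ hy hy' => rw [mul_add]; exact Submodule.add_mem _ hy hy'
    | smul r y _ hy => rw [mul_smul_comm]; exact Submodule.smul_mem _ _ hy
  have hA : A = ⊤ := by
    refine hS A (fun d => key _ fun w hw b hb => ?_) fun k hk => key _ fun w hw b hb => ?_
    · obtain ⟨b', hb', e⟩ := hB.exists_j_mul_sorter h hD (w := w) d hb
      rw [e]
      exact mem_sorterSpan hw hb'
    · by_cases hkw : w ⟨k, by lia⟩ = w ⟨k + 1, hk⟩
      · obtain ⟨k', hk', hs, hT⟩ := h.exists_T_mul_sorter w hk hkw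
        rw [hw] at hs
        rw [← mul_assoc, hT, mul_assoc]
        exact mem_sorterSpan hw (hB.mul_mem (hB.T_mem k' hk' hs) hb)
      · obtain ⟨d, hd⟩ := h.T_mul_ne hk hkw
        rw [← h.jE_mul_sorter w, mul_assoc, ← mul_assoc, hd, sub_mul, smul_mul_assoc]
        refine Submodule.sub_mem _ ?_ (Submodule.smul_mem _ _ ?_)
        · rw [mul_assoc, mul_assoc, ← mul_assoc (j (E w)), ← map_mul]
          obtain ⟨b', hb', e⟩ := hB.exists_j_mul_sorter h hD (w := w) (E w * d) hb
          rw [e]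
          exact hB.intertwiner_mul_mem h hD hk hkw hw hb'
        · rw [← map_mul]
          obtain ⟨b', hb', e⟩ := hB.exists_j_mul_sorter h hD (w := w) (E w * (x (k + 1) * d)) hb
          rw [e]
          exact mem_sorterSpan hw hb'
  exact (hA ▸ Algebra.mem_top : s ∈ A) z hz

/-- For a monotone word, the corner of `E w₀` is contained in `B`, and for two different monotone
words the corresponding parts are orthogonal. -/
lemma corner_mem (hB : IsCornerAlgebra n j T x E w₀ B)
    (h : IsBlockSystem q P c n j T x E) (hD : Algebra.adjoin R {a | ∃ l < n, a = x l} = ⊤)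
    (hS : ∀ A : Subalgebra R S, (∀ d, j d ∈ A) → (∀ k, k + 1 < n → T k ∈ A) → A = ⊤)
    (hw₀ : Monotone w₀) {w : Fin n → Fin κ} (hw : Monotone w) (s : S) :
    (w = w₀ → j (E w) * (s * j (E w₀)) ∈ B) ∧ (w ≠ w₀ → j (E w) * (s * j (E w₀)) = 0) := by
  have hz : s * j (E w₀) ∈ sorterSpan j T x E w₀ B := by
    refine hB.mul_mem_sorterSpan h hD hS s ?_
    rw [← sorter_of_monotone (j := j) (T := T) (x := x) (E := E) (w := w₀),
      ← h.sorter_mul_jE, sortWord_of_monotone hw₀]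
    · exact mem_sorterSpan (sortWord_of_monotone hw₀) hB.one_mem
    · rintro k ⟨hk, hlt⟩
      exact absurd hlt (not_lt.2 (hw₀ (by simp [Fin.le_def])))
  generalize s * j (E w₀) = z at hz
  induction hz using Submodule.span_induction with
  | mem y hy =>
    obtain ⟨w', hw', b, hb, rfl⟩ := hy
    by_cases hww : w = w'
    · subst hww
      have h1 : w = w₀ := by rw [← hw', sortWord_of_monotone hw]
      refine ⟨fun _ => ?_, fun h2 => (h2 h1).elim⟩
      subst h1
      rw [← mul_assoc, h.jE_mul_sorter, sorter_of_monotone, hB.one_mul b hb]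
      · exact hb
      · rintro k ⟨hk, hlt⟩
        exact absurd hlt (not_lt.2 (hw₀ (by simp [Fin.le_def])))
    · rw [← h.jE_mul_sorter w', ← mul_assoc, ← mul_assoc, h.jE_ortho hww, zero_mul, zero_mul]
      exact ⟨fun _ => B.zero_mem, fun _ => rfl⟩
  | zero => rw [mul_zero]; exact ⟨fun _ => B.zero_mem, fun _ => rfl⟩
  | add y y' _ _ hy hy' =>
    rw [mul_add]
    exact ⟨fun e => B.add_mem (hy.1 e) (hy'.1 e), fun e => by rw [hy.2 e, hy'.2 e, add_zero]⟩
  | smul r y _ hy =>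
    rw [mul_smul_comm]
    exact ⟨fun e => SMulMemClass.smul_mem r (hy.1 e), fun e => by rw [hy.2 e, smul_zero]⟩

end IsCornerAlgebra
end Corner

/-! ### Monotone words -/

section MonotoneWords

variable {n κ : ℕ}

/-- The number of letters smaller than `α` in a word with `m β` letters `β` for all `β`. -/
def offset (m : Fin κ → ℕ) (α : Fin κ) : ℕ := ∑ β ∈ Finset.Iio α, m β

lemma offset_add (m : Fin κ → ℕ) (α : Fin κ) : offset m α + m α = ∑ β ∈ Finset.Iic α, m β := by
  rw [offset, ← Finset.sum_erase_add _ _ (Finset.mem_Iic.2 le_rfl)]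
  congr 2
  ext β
  simp [lt_iff_le_and_ne, and_comm]

lemma lt_card_iff_of_lower (s : Finset (Fin n)) (hs : ∀ p ∈ s, ∀ p' ≤ p, p' ∈ s) (p : Fin n) :
    (p : ℕ) < s.card ↔ p ∈ s := by
  refine ⟨fun h => ?_, fun h => ?_⟩
  · by_contra hp
    have : s ⊆ Finset.Iio p := fun p' hp' => by
      rw [Finset.mem_Iio]
      by_contra hle
      exact hp (hs p' hp' p (not_lt.1 hle))
    have := Finset.card_le_card this
    rw [Fin.card_Iio] at this
    lia
  · have : Finset.Iic p ⊆ s := fun p' hp' => hs p h p' (Finset.mem_Iic.1 hp')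
    have := Finset.card_le_card this
    rw [Fin.card_Iic] at this
    lia

lemma cnt_eq_card (w : Fin n → Fin κ) (α : Fin κ) :
    cnt w n α = (Finset.univ.filter fun p => w p = α).card := by
  rw [cnt]
  congr 1
  ext p
  simp

lemma sum_cnt_eq_card (w : Fin n → Fin κ) (A : Finset (Fin κ)) :
    ∑ β ∈ A, cnt w n β = (Finset.univ.filter fun p => w p ∈ A).card := by
  rw [Finset.card_eq_sum_card_fiberwise (f := w) (t := A) (fun p hp => by simpa using hp)]
  refine Finset.sum_congr rfl fun β hβ => ?_
  rw [cnt_eq_card, Finset.filter_filter]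
  congr 1
  ext p
  simp only [Finset.mem_filter, Finset.mem_univ, true_and]
  exact ⟨fun h => ⟨h ▸ hβ, h⟩, fun h => h.2⟩

/-- `w` is the increasing word in which each letter `α` occurs `m α` times. -/
structure IsMonotoneWord (m : Fin κ → ℕ) (w : Fin n → Fin κ) : Prop where
  mono : Monotone w
  cnt_eq : ∀ α, cnt w n α = m α

namespace IsMonotoneWord

variable {m : Fin κ → ℕ} {w : Fin n → Fin κ}

lemma lt_offset_iff (h : IsMonotoneWord m w) (α : Fin κ) (p : Fin n) :
    (p : ℕ) < offset m α ↔ w p < α := by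
  have h1 : offset m α = (Finset.univ.filter fun p => w p ∈ Finset.Iio α).card := by
    rw [offset, ← sum_cnt_eq_card]
    exact Finset.sum_congr rfl fun β _ => (h.cnt_eq β).symm
  rw [h1, lt_card_iff_of_lower]
  · simp
  · simp only [Finset.mem_Iio, Finset.mem_filter, Finset.mem_univ, true_and]
    exact fun p hp p' hp' => (h.mono hp').trans_lt hp

lemma lt_offset_add_iff (h : IsMonotoneWord m w) (α : Fin κ) (p : Fin n) :
    (p : ℕ) < offset m α + m α ↔ w p ≤ α := by
  have h1 : offset m α + m α = (Finset.univ.filter fun p => w p ∈ Finset.Iic α).card := by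
    rw [offset_add, ← sum_cnt_eq_card]
    exact Finset.sum_congr rfl fun β _ => (h.cnt_eq β).symm
  rw [h1, lt_card_iff_of_lower]
  · simp
  · simp only [Finset.mem_Iic, Finset.mem_filter, Finset.mem_univ, true_and]
    exact fun p hp p' hp' => (h.mono hp').trans hp

lemma offset_add_le (h : IsMonotoneWord m w) (α : Fin κ) : offset m α + m α ≤ n := by
  rw [offset_add]
  calc _ ≤ ∑ β, m β := Finset.sum_le_univ_sum_of_nonneg fun _ => Nat.zero_le _
    _ = ∑ β, cnt w n β := Finset.sum_congr rfl fun β _ => (h.cnt_eq β).symm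
    _ ≤ n := by
      rw [sum_cnt_eq_card]
      exact (Finset.card_le_univ _).trans_eq (Fintype.card_fin n)

lemma apply_offset (h : IsMonotoneWord m w) {α : Fin κ} {i : ℕ} (hi : i < m α)
    (hn : offset m α + i < n) : w ⟨offset m α + i, hn⟩ = α := by
  refine le_antisymm ((h.lt_offset_add_iff α _).1 ?_) (not_lt.1 fun hlt => ?_)
  · simpa using hi
  · have := (h.lt_offset_iff α _).2 hlt
    simp at this

lemma exists_eq_offset (h : IsMonotoneWord m w) (p : Fin n) :
    ∃ i < m (w p), (p : ℕ) = offset m (w p) + i := by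
  have h1 := (h.lt_offset_add_iff (w p) p).2 le_rfl
  have h2 := mt (h.lt_offset_iff (w p) p).1 (lt_irrefl _)
  exact ⟨p - offset m (w p), by lia, by lia⟩

lemma occ_offset (h : IsMonotoneWord m w) {α : Fin κ} {i : ℕ} (hi : i < m α)
    (hn : offset m α + i < n) : occ w ⟨offset m α + i, hn⟩ = i := by
  rw [occ, h.apply_offset hi hn]
  have : ∀ l ≤ i, cnt w (offset m α + l) α = l := by
    intro l hl
    induction l with
    | zero =>
      rw [cnt, Finset.card_eq_zero, Finset.filter_eq_empty_iff]
      rintro p - ⟨hp, hpα⟩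
      exact ((h.lt_offset_iff α p).1 hp).ne hpα
    | succ l ih =>
      have h1 := cnt_succ w ⟨offset m α + l, by lia⟩ α
      rw [h.apply_offset (by lia), if_pos rfl] at h1
      rw [← add_assoc, h1, ih (by lia)]
  exact this i le_rfl

lemma unique (h : IsMonotoneWord m w) {w' : Fin n → Fin κ} (h' : IsMonotoneWord m w') :
    w = w' := by
  funext p
  refine le_antisymm ?_ ?_
  · exact (h.lt_offset_add_iff _ p).1 ((h'.lt_offset_add_iff _ p).2 le_rfl)
  · exact (h'.lt_offset_add_iff _ p).1 ((h.lt_offset_add_iff _ p).2 le_rfl)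

end IsMonotoneWord

lemma cnt_comp_perm (w : Fin n → Fin κ) (σ : Equiv.Perm (Fin n)) (α : Fin κ) :
    cnt (w ∘ σ) n α = cnt w n α := by
  rw [cnt_eq_card, cnt_eq_card]
  exact Finset.card_equiv σ (by simp)

lemma exists_isMonotoneWord {m : Fin κ → ℕ} (hm : ∑ α, m α = n) :
    ∃ w : Fin n → Fin κ, IsMonotoneWord m w := by
  subst hm
  refine ⟨sortWord fun p => (finSigmaFinEquiv.symm p).1, monotone_sortWord _, fun α => ?_⟩
  rw [sortWord, cnt_comp_perm, cnt_eq_card]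
  have h1 : (Finset.univ.filter fun p : Fin (∑ α, m α) => (finSigmaFinEquiv.symm p).1 = α).card
      = (Finset.univ.image fun i : Fin (m α) => (⟨α, i⟩ : Σ α, Fin (m α))).card := by
    refine Finset.card_equiv finSigmaFinEquiv.symm fun p => ?_
    simp only [Finset.mem_filter, Finset.mem_univ, true_and, Finset.mem_image]
    refine ⟨fun h => ?_, ?_⟩
    · subst h
      exact ⟨_, rfl⟩
    · rintro ⟨i, hi⟩
      rw [← hi]
  rw [h1, Finset.card_image_of_injective _ fun a b hab => by simpa using hab]
  simp

end MonotoneWords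

/-! ### Algebra homomorphisms from tensor products and into corners -/

section Corners

/-- The corner `e S e` of an idempotent `e`, as an algebra with unit element `e`. -/
lemma exists_corner {R : Type*} [CommRing R] {S : Type u} [Ring S] [Algebra R S] {e : S}
    (he : e * e = e) : ∃ (C : Type u) (_ : Ring C) (_ : Algebra R C) (ι : C →ₙₐ[R] S),
      Function.Injective ι ∧ ι 1 = e ∧ ∀ s, e * s = s → s * e = s → ∃ a, ι a = s := by
  let C : NonUnitalSubalgebra R S :=
    { carrier := {s | e * s = s ∧ s * e = s}
      add_mem' := fun {a b} ha hb => ⟨by rw [mul_add, ha.1, hb.1], by rw [add_mul, ha.2, hb.2]⟩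
      zero_mem' := ⟨mul_zero e, zero_mul e⟩
      mul_mem' := fun {a b} ha hb => ⟨by rw [← mul_assoc, ha.1], by rw [mul_assoc, hb.2]⟩
      smul_mem' := fun r a ha => ⟨by rw [mul_smul_comm, ha.1], by rw [smul_mul_assoc, ha.2]⟩ }
  let ringC : Ring C :=
    { (inferInstance : NonUnitalRing C) with
      one := ⟨e, he, he⟩
      one_mul := fun a => Subtype.ext a.2.1
      mul_one := fun a => Subtype.ext a.2.2 }
  let algC : Algebra R C := Algebra.ofModule
    (fun r a b => Subtype.ext (smul_mul_assoc r (a : S) (b : S)))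
    (fun r a b => Subtype.ext (mul_smul_comm r (a : S) (b : S)))
  let ι : C →ₙₐ[R] S :=
    { toFun := fun a => a
      map_smul' := fun r a => rfl
      map_zero' := rfl
      map_add' := fun a b => rfl
      map_mul' := fun a b => rfl }
  exact ⟨C, ringC, algC, ι, Subtype.val_injective, rfl, fun s h1 h2 => ⟨⟨s, h1, h2⟩, rfl⟩⟩

variable {R : Type u} [CommRing R]

lemma map_aeval_corner {S C : Type*} [Ring S] [Algebra R S] [Ring C] [Algebra R C]
    (ι : C →ₙₐ[R] S) {a : C} {s : S} (h : ι a = s * ι 1) (hs : Commute s (ι 1))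
    (p : Polynomial R) : ι (Polynomial.aeval a p) = Polynomial.aeval s p * ι 1 := by
  have h1 : ι 1 * ι 1 = ι 1 := by rw [← map_mul, mul_one]
  induction p using Polynomial.induction_on with
  | C r =>
    rw [Polynomial.aeval_C, Polynomial.aeval_C, Algebra.algebraMap_eq_smul_one, map_smul,
      Algebra.smul_def]
  | add p p' hp hp' => rw [map_add, map_add, hp, hp', map_add, add_mul]
  | monomial k r ih =>
    rw [pow_succ, ← mul_assoc, map_mul (Polynomial.aeval a), map_mul, ih,
      map_mul (Polynomial.aeval s) (_ * _) Polynomial.X, Polynomial.aeval_X, Polynomial.aeval_X, h, mul_assoc, ← mul_assoc (ι 1), ← hs.eq, mul_assoc s, h1, mul_assoc]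

lemma ArikiKoike.commute_of_gen {q : R} {I I' : Type*} [Fintype I] [Fintype I'] {P : I → R}
    {P' : I' → R} {n n' : ℕ} {C : Type*} [Ring C] [Algebra R C] (f : ArikiKoike q P n →ₐ[R] C)
    (g : ArikiKoike q P' n' →ₐ[R] C)
    (h : ∀ i < n, ∀ i' < n', Commute (f (gen q P n i)) (g (gen q P' n' i'))) (a b) :
    Commute (f a) (g b) := by
  have h1 : ∀ i < n, Commute (f (gen q P n i)) (g b) := by
    intro i hi
    have := eq_top_of_gen_mem ((Subalgebra.centralizer R {f (gen q P n i)}).comap g)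
      fun i' hi' => by
        rw [Subalgebra.mem_comap, Subalgebra.mem_centralizer_iff]
        rintro _ rfl
        exact h i hi i' hi'
    have h2 : b ∈ (Subalgebra.centralizer R {f (gen q P n i)}).comap g := by rw [this]; trivial
    rw [Subalgebra.mem_comap, Subalgebra.mem_centralizer_iff] at h2
    exact h2 _ rfl
  have := eq_top_of_gen_mem ((Subalgebra.centralizer R {g b}).comap f)
    fun i hi => by
      rw [Subalgebra.mem_comap, Subalgebra.mem_centralizer_iff]
      rintro _ rfl
      exact (h1 i hi).symm
  have h2 : a ∈ (Subalgebra.centralizer R {g b}).comap f := by rw [this]; trivial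
  rw [Subalgebra.mem_comap, Subalgebra.mem_centralizer_iff] at h2
  exact (h2 _ rfl).symm

end Corners

section Tensor

variable {R : Type u} [CommRing R]

lemma prod_ofFn_mul {M : Type*} [Monoid M] {k : ℕ} (a b : Fin k → M)
    (h : ∀ i i', i ≠ i' → Commute (a i) (b i')) :
    (List.ofFn fun i => a i * b i).prod = (List.ofFn a).prod * (List.ofFn b).prod := by
  induction k with
  | zero => simp
  | succ k ih =>
    rw [List.ofFn_succ, List.ofFn_succ, List.ofFn_succ, List.prod_cons, List.prod_cons,
      List.prod_cons, ih (fun i => a i.succ) (fun i => b i.succ)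
        fun i i' hne => h _ _ fun h' => hne (Fin.succ_injective _ h')]
    have h1 : Commute (b 0) (List.ofFn fun i => a i.succ).prod := by
      refine Commute.list_prod_right _ _ fun y hy => ?_
      obtain ⟨i, rfl⟩ := List.mem_ofFn.1 hy
      exact (h _ _ (Fin.succ_ne_zero i)).symm
    rw [mul_assoc, mul_assoc, ← mul_assoc (b 0), h1.eq, mul_assoc]

lemma prod_ofFn_ite {M : Type*} [Monoid M] {k : ℕ} (i₀ : Fin k) (y : M) :
    (List.ofFn fun i => if i = i₀ then y else 1).prod = y := by
  induction k with
  | zero => exact i₀.elim0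
  | succ k ih =>
    rw [List.ofFn_succ, List.prod_cons]
    induction i₀ using Fin.cases with
    | zero =>
      rw [if_pos rfl, List.prod_eq_one, mul_one]
      intro z hz
      obtain ⟨i, rfl⟩ := List.mem_ofFn.1 hz
      rw [if_neg (Fin.succ_ne_zero i)]
    | succ i₀ =>
      rw [if_neg (Fin.succ_ne_zero i₀).symm, one_mul]
      simpa only [Fin.succ_inj] using ih i₀

/-- Algebra homomorphisms with commuting images combine to a homomorphism from the tensor
product. -/
lemma exists_tensor_algHom {κ : ℕ} {A : Fin κ → Type*} [∀ α, Ring (A α)] [∀ α, Algebra R (A α)]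
    {C : Type*} [Ring C] [Algebra R C] (f : ∀ α, A α →ₐ[R] C)
    (hf : ∀ α β, α ≠ β → ∀ a b, Commute (f α a) (f β b)) :
    ∃ F : (⨂[R] α, A α) →ₐ[R] C, ∀ α a, F (PiTensorProduct.singleAlgHom α a) = f α a := by
  let g : MultilinearMap R A C :=
    (MultilinearMap.mkPiAlgebraFin R κ C).compLinearMap fun α => (f α).toLinearMap
  have hg : ∀ a, g a = (List.ofFn fun α => f α (a α)).prod := fun a => by
    simp only [g, MultilinearMap.compLinearMap_apply, MultilinearMap.mkPiAlgebraFin_apply]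
    rfl
  have hone : g 1 = 1 := by
    rw [hg]
    refine List.prod_eq_one fun z hz => ?_
    obtain ⟨i, rfl⟩ := List.mem_ofFn.1 hz
    exact map_one _
  have hmul : ∀ a b, g (a * b) = g a * g b := fun a b => by
    rw [hg, hg, hg, ← prod_ofFn_mul _ _ fun i i' hne => hf i i' hne _ _]
    simp only [Pi.mul_apply, map_mul]
  refine ⟨PiTensorProduct.liftAlgHom g hone hmul, fun α a => ?_⟩
  have : PiTensorProduct.liftAlgHom g hone hmul (PiTensorProduct.singleAlgHom (R := R) α a)
      = g (Pi.mulSingle α a) := PiTensorProduct.lift.tprod _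
  rw [this, hg]
  refine Eq.trans ?_ (prod_ofFn_ite α (f α a))
  congr 2
  funext β
  split_ifs with h
  · subst h; rw [Pi.mulSingle_eq_same]
  · rw [Pi.mulSingle_eq_of_ne h, map_one]

/-- A subalgebra of a tensor product is everything if it contains the factors. -/
lemma tensor_subalgebra_eq_top {κ : ℕ} {A : Fin κ → Type*} [∀ α, Ring (A α)]
    [∀ α, Algebra R (A α)] (U : Subalgebra R (⨂[R] α, A α))
    (hU : ∀ α a, PiTensorProduct.singleAlgHom α a ∈ U) : U = ⊤ := by
  refine eq_top_iff.2 fun a _ => ?_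
  induction a using PiTensorProduct.induction_on with
  | add a b ha hb => exact U.add_mem (ha trivial) (hb trivial)
  | smul_tprod r a =>
    refine U.smul_mem ?_ r
    have h1 := (congrArg (PiTensorProduct.tprod R) (Finset.noncommProd_mulSingle a).symm).trans
      (PiTensorProduct.tprod_noncommProd _ _ _)
    rw [h1]
    exact U.toSubmonoid.noncommProd_mem _ _ _ fun α _ => hU α (a α)

lemma commute_singleAlgHom {κ : ℕ} {A : Fin κ → Type*} [∀ α, Ring (A α)]
    [∀ α, Algebra R (A α)] {α β : Fin κ} (h : α ≠ β) (a : A α) (b : A β) :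
    Commute (PiTensorProduct.singleAlgHom (R := R) α a) (PiTensorProduct.singleAlgHom β b) :=
  (Pi.mulSingle_commute h a b).tprod

end Tensor

/-! ### The tensor product of Ariki-Koike algebras maps to the corner of a monotone word -/

section CornerHom

open ArikiKoike Polynomial

variable {R : Type u} [CommRing R] {S : Type u} [Ring S] [Algebra R S] {D : Type*} [CommRing D]
  [Algebra R D] {q : Rˣ} {n r κ : ℕ} {j : D →ₐ[R] S} {T : ℕ → S} {x : ℕ → D}
  {Q : Fin r → R} {c : Fin r → Fin κ} {E : (Fin n → Fin κ) → D} {m : Fin κ → ℕ}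
  {w : Fin n → Fin κ}

/-- The tensor product of Ariki-Koike algebras attached to the content `m`. -/
abbrev TensorAK (q : R) (Q : Fin r → R) (c : Fin r → Fin κ) (m : Fin κ → ℕ) : Type u :=
  ⨂[R] α, ArikiKoike q (paramPiece Q c α) (m α)

/-- The inclusion of the tensor factor with index `α`. -/
def tensorSingle (q : R) (Q : Fin r → R) (c : Fin r → Fin κ) (m : Fin κ → ℕ) (α : Fin κ) :
    ArikiKoike q (paramPiece Q c α) (m α) →ₐ[R] TensorAK q Q c m :=
  PiTensorProduct.singleAlgHom (A := fun α => ArikiKoike q (paramPiece Q c α) (m α)) α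

lemma commute_tensorSingle (q : R) (Q : Fin r → R) (c : Fin r → Fin κ) (m : Fin κ → ℕ)
    {α β : Fin κ} (h : α ≠ β) (a b) :
    Commute (tensorSingle q Q c m α a) (tensorSingle q Q c m β b) :=
  commute_singleAlgHom (A := fun α => ArikiKoike q (paramPiece Q c α) (m α)) h a b

/-- The generator `T_i` of the tensor factor with index `α`. -/
def tensorGen (q : R) (Q : Fin r → R) (c : Fin r → Fin κ) (m : Fin κ → ℕ) (α : Fin κ) (i : ℕ) :
    TensorAK q Q c m :=
  tensorSingle q Q c m α (gen q (paramPiece Q c α) (m α) i)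

lemma residuePoly_colorStrip_zero (q : Rˣ) (Q : Fin r → R) (c : Fin r → Fin κ) (α : Fin κ) :
    residuePoly q Q (colorStrip c α 0) = ∏ k, (X - C (paramPiece Q c α k)) := by
  rw [residuePoly, colorStrip, strip, Finset.prod_sigma, Finset.prod_subtype (p := fun i => c i = α)
    (F := inferInstance) _ (by simp)]
  refine Finset.prod_congr rfl fun i _ => ?_
  simp [residue, paramPiece]

/-- The tensor product of Ariki-Koike algebras maps to the corner of an increasing word. The
cyclotomic relation of the color `α` holds for the Jucys-Murphy element at the first occurrence of
`α`, by `IsBlockSystem.first_occurrence`. -/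
theorem exists_cornerHom (h : IsBlockSystem q Q c n j T x E)
    (h0 : 0 < n → aeval (x 0) (residuePoly q Q (strip Finset.univ fun _ => 0)) = 0)
    (hw : IsMonotoneWord m w) :
    ∃ ψ : TensorAK (q : R) Q c m →ₙₐ[R] S, ψ 1 = j (E w) ∧
      (∀ α, 0 < m α → ψ (tensorGen (q : R) Q c m α 0) = j (x (offset m α)) * j (E w)) ∧
      ∀ α i, i + 1 < m α →
        ψ (tensorGen (q : R) Q c m α (i + 1)) = T (offset m α + i) * j (E w) := by
  obtain ⟨C, _, _, ι, hι, hι1, hιs⟩ := exists_corner (R := R) (h.jE_mul w)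
  have hlt : ∀ {α i}, i < m α → offset m α + i < n := fun {α i} hi =>
    (Nat.add_lt_add_left hi _).trans_le (hw.offset_add_le α)
  have hne : ∀ {α β i l}, i < m α → l < m β → α ≠ β → offset m α + i ≠ offset m β + l := by
    intro α β i l hi hl hαβ he
    have h1 := hw.apply_offset hi (hlt hi)
    simp only [he] at h1
    exact hαβ (h1.symm.trans (hw.apply_offset hl (hlt hl)))
  -- elements commuting with the idempotent give elements of the corner
  have hex : ∀ s, Commute s (j (E w)) → ∃ a, ι a = s * j (E w) := fun s hs =>
    hιs _ (by rw [← mul_assoc, ← hs.eq, mul_assoc, h.jE_mul]) (by rw [mul_assoc, h.jE_mul])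
  have hmul : ∀ {a a' : C} {s s' : S}, ι a = s * j (E w) → ι a' = s' * j (E w) →
      Commute s' (j (E w)) → ι (a * a') = s * s' * j (E w) := by
    intro a a' s s' ha ha' hs
    rw [map_mul, ha, ha', mul_assoc, ← mul_assoc (j (E w)), ← hs.eq, mul_assoc s', h.jE_mul,
      mul_assoc]
  have hTE : ∀ {α i}, i + 1 < m α → Commute (T (offset m α + i)) (j (E w)) := fun {α i} hi =>
    h.T_commute (by have := hlt hi; lia) (by
      rw [hw.apply_offset (α := α) (i := i) (by lia)]
      exact (hw.apply_offset (i := i + 1) hi (hlt hi)).symm)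
  have hxE : ∀ d, Commute (j d) (j (E w)) := fun d => IsAffineHecke.jcomm j _ _
  choose xx hxx using fun α => hex _ (hxE (x (offset m α)))
  have hext : ∀ α i, ∃ a, i + 1 < m α → ι a = T (offset m α + i) * j (E w) := by
    intro α i
    by_cases hi : i + 1 < m α
    · obtain ⟨a, ha⟩ := hex _ (hTE hi)
      exact ⟨a, fun _ => ha⟩
    · exact ⟨0, fun h => (hi h).elim⟩
  choose tt htt using hext
  have hcomm : ∀ {a a' : C} {s s' : S}, ι a = s * j (E w) → ι a' = s' * j (E w) →
      Commute s (j (E w)) → Commute s' (j (E w)) → Commute s s' → Commute a a' := by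
    intro a a' s s' ha ha' hs hs' hss
    refine hι ?_
    rw [hmul ha ha' hs', hmul ha' ha hs, hss.eq]
  have hf : ∀ α, ∃ f : ArikiKoike (q : R) (paramPiece Q c α) (m α) →ₐ[R] C,
      (0 < m α → f (gen (q : R) (paramPiece Q c α) (m α) 0) = xx α) ∧
      ∀ i, i + 1 < m α → f (gen (q : R) (paramPiece Q c α) (m α) (i + 1)) = tt α i := by
    intro α
    refine ArikiKoike.exists_algHom (xx α) (tt α) (fun hm => hι ?_) (fun hm => hι ?_)
      (fun i hi => hι ?_) (fun i hi => hι ?_) (fun i l hil hl => ?_) (fun l hl hl' => ?_)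
    · rw [map_aeval_corner ι (s := j (x (offset m α))) (by rw [hxx, hι1]) (by rw [hι1]; exact hxE _),
        hι1, map_zero, aeval_algHom_apply, ← map_mul, ← residuePoly_colorStrip_zero q]
      have h1 := h.first_occurrence h0 (offset m α + 0) (hlt hm) w (hw.occ_offset hm _)
      rw [hw.apply_offset hm, add_zero] at h1
      rw [h1, map_zero]
    · have ht := htt α 0 hm
      have hc := hTE (α := α) (i := 0) hm
      rw [hmul (hmul (hmul (hxx α) ht hc) (hxx α) (hxE _)) ht hc,
        hmul (hmul (hmul ht (hxx α) (hxE _)) ht hc) (hxx α) (hxE _)]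
      have hs := h.shift (offset m α) (hlt (α := α) (i := 1) hm)
      rw [add_zero, hs, mul_assoc (j _), mul_assoc (j _), hs, mul_smul_comm,
        IsAffineHecke.jcomm, smul_mul_assoc, smul_mul_assoc,
        smul_mul_assoc]
    · have ht := htt α i hi
      have hq := h.quad (offset m α + i) (hlt hi)
      rw [hmul ht ht (hTE hi), hq, map_add, map_smul, map_smul, ht, hι1, add_mul, smul_mul_assoc,
        smul_mul_assoc, one_mul]
    · have ht := htt α i (by lia)
      have hc := hTE (α := α) (i := i) (by lia)
      have ht' := htt α (i + 1) (by lia)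
      have hc' := hTE (α := α) (i := i + 1) (by lia)
      rw [hmul (hmul ht' ht hc) ht' hc', hmul (hmul ht ht' hc') ht hc]
      rw [show offset m α + (i + 1) = offset m α + i + 1 from rfl,
        h.braid (offset m α + i) (hlt (α := α) (i := i + 2) hi)]
    · exact hcomm (htt α i (by lia)) (htt α l hl) (hTE (by lia)) (hTE hl)
        (h.far _ _ (by lia) (hlt (i := l + 1) hl))
    · refine hcomm (hxx α) (htt α l hl') (hxE _) (hTE hl') (h.comm _ _ ?_ ?_ ?_ ?_).symm
      · exact hlt hl'
      · have := hlt hl'; lia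
      · lia
      · lia
  choose f hf0 hft using hf
  have hff : ∀ α β, α ≠ β → ∀ a b, Commute (f α a) (f β b) := by
    intro α β hαβ
    refine ArikiKoike.commute_of_gen _ _ fun i hi i' hi' => ?_
    rcases Nat.eq_zero_or_eq_succ_pred i with rfl | hi0 <;>
      rcases Nat.eq_zero_or_eq_succ_pred i' with rfl | hi0'
    · rw [hf0 α hi, hf0 β hi']
      exact hcomm (hxx α) (hxx β) (hxE _) (hxE _) (IsAffineHecke.jcomm j _ _)
    · obtain ⟨l, rfl⟩ : ∃ l, i' = l + 1 := ⟨_, hi0'⟩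
      rw [hf0 α hi, hft β l hi']
      have h1 := hne (i := 0) (l := l) hi (by lia) hαβ
      have h2 := hne (i := 0) (l := l + 1) hi hi' hαβ
      exact hcomm (hxx α) (htt β l hi') (hxE _) (hTE hi')
        (h.comm _ _ (hlt (i := l + 1) hi') (hlt (i := 0) hi) h1 h2).symm
    · obtain ⟨l, rfl⟩ : ∃ l, i = l + 1 := ⟨_, hi0⟩
      rw [hf0 β hi', hft α l hi]
      have h1 := hne (i := 0) (l := l) hi' (by lia) hαβ.symm
      have h2 := hne (i := 0) (l := l + 1) hi' hi hαβ.symm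
      exact hcomm (htt α l hi) (hxx β) (hTE hi) (hxE _)
        (h.comm _ _ (hlt (i := l + 1) hi) (hlt (i := 0) hi') h1 h2)
    · obtain ⟨l, rfl⟩ : ∃ l, i = l + 1 := ⟨_, hi0⟩
      obtain ⟨l', rfl⟩ : ∃ l, i' = l + 1 := ⟨_, hi0'⟩
      rw [hft α l hi, hft β l' hi']
      refine hcomm (htt α l hi) (htt β l' hi') (hTE hi) (hTE hi') ?_
      have h1 := hne (by lia : l < m α) (by lia : l' < m β) hαβ
      have h2 := hne (by lia : l + 1 < m α) (by lia : l' < m β) hαβ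
      have h3 := hne (by lia : l < m α) (by lia : l' + 1 < m β) hαβ
      rcases Nat.lt_or_ge (offset m α + l) (offset m β + l') with hl | hl
      · exact h.far _ _ (by lia) (hlt (i := l' + 1) hi')
      · exact (h.far _ _ (by lia) (hlt (i := l + 1) hi)).symm
  obtain ⟨F, hF⟩ := exists_tensor_algHom f hff
  refine ⟨ι.comp (F : _ →ₙₐ[R] C), ?_, fun α hα => ?_, fun α i hi => ?_⟩
  · rw [NonUnitalAlgHom.comp_apply, ← hι1]
    exact congrArg ι (map_one F)
  · rw [← hxx, ← hf0 α hα, ← hF]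
    rfl
  · rw [← htt α i hi, ← hft α i hi, ← hF]
    rfl

/-- The range of the homomorphism to the corner of a monotone word. -/
lemma isCornerAlgebra_range (h : IsBlockSystem q Q c n j T x E) (hw : IsMonotoneWord m w)
    {ψ : TensorAK (q : R) Q c m →ₙₐ[R] S} (h1 : ψ 1 = j (E w))
    (hx : ∀ α, 0 < m α → ψ (tensorGen (q : R) Q c m α 0) = j (x (offset m α)) * j (E w))
    (hT : ∀ α i, i + 1 < m α →
        ψ (tensorGen (q : R) Q c m α (i + 1)) = T (offset m α + i) * j (E w)) :
    IsCornerAlgebra n j T x E w (NonUnitalAlgHom.range ψ) where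
  one_mem := ⟨1, h1⟩
  one_mul := by
    rintro _ ⟨a, rfl⟩
    rw [← h1]
    exact (map_mul ψ _ _).symm.trans (by rw [one_mul]; rfl)
  x_mem := by
    have key : ∀ α i, i < m α → j (x (offset m α + i)) * j (E w) ∈ NonUnitalAlgHom.range ψ := by
      intro α i hi
      induction i with
      | zero => exact ⟨_, hx α hi⟩
      | succ i ih =>
        have hn : offset m α + i + 1 < n :=
          (Nat.add_lt_add_left hi _).trans_le (hw.offset_add_le α)
        obtain ⟨a, ha⟩ := ih (by lia)
        have hcm := h.T_commute (k := offset m α + i) hn (w := w) (by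
          rw [hw.apply_offset (α := α) (i := i) (by lia)]
          exact (hw.apply_offset (i := i + 1) hi hn).symm)
        have ht := hT α i hi
        refine ⟨((q⁻¹ : Rˣ) : R) • (tensorGen (q : R) Q c m α (i + 1) * a
          * tensorGen (q : R) Q c m α (i + 1)), ?_⟩
        change ψ _ = _
        change ψ a = _ at ha
        rw [map_smul, map_mul, map_mul, ha, ht]
        have e1 : T (offset m α + i) * j (E w) * (j (x (offset m α + i)) * j (E w))
            * (T (offset m α + i) * j (E w))
            = T (offset m α + i) * j (x (offset m α + i)) * T (offset m α + i) * j (E w) := by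
          have hX := IsAffineHecke.jcomm j (E w) (x (offset m α + i))
          simp only [mul_assoc, h.jE_mul, IsAffineHecke.reassoc₂ hcm.symm.eq, IsAffineHecke.reassoc₂ hX]
        rw [e1, h.shift _ hn, smul_mul_assoc, smul_smul, Units.inv_mul, one_smul]
        rfl
    intro p
    obtain ⟨i, hi, hp⟩ := hw.exists_eq_offset p
    rw [hp]
    exact key _ i hi
  T_mem := by
    intro k hk hkw
    obtain ⟨i, hi, hp⟩ := hw.exists_eq_offset ⟨k, by lia⟩
    have h2 := (hw.lt_offset_add_iff (w ⟨k, by lia⟩) ⟨k + 1, hk⟩).2 hkw.ge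
    simp only at hp h2
    refine ⟨_, (hT (w ⟨k, by lia⟩) i (by lia)).trans ?_⟩
    rw [← hp]

end CornerHom

/-! ### Colored affine Hecke systems -/

section Colored

variable {R : Type*} [CommRing R] {A : Type*} [Ring A] [Algebra R A] {K : Type*}

/-- The label following `a`: the next occurrence of the same letter. -/
def nextLabel (a : K × ℕ) : K × ℕ := (a.1, a.2 + 1)

/-- A family of affine Hecke relations, one for each color `α`, such that elements of different
colors commute. A label `(α, i)` with `i < m α` stands for the `i`-th occurrence of the letter `α`
in a word; `y` are the polynomial generators, and `t a` is the Hecke generator exchanging `a` and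
`nextLabel a`. Differences of polynomial generators of different colors are invertible. -/
structure IsColoredHecke (q : Rˣ) (m : K → ℕ) (t y : K × ℕ → A) : Prop where
  quad : ∀ a, a.2 + 1 < m a.1 → t a * t a = ((q : R) - 1) • t a + (q : R) • 1
  braid : ∀ a, a.2 + 2 < m a.1 →
    t (nextLabel a) * t a * t (nextLabel a) = t a * t (nextLabel a) * t a
  far : ∀ a b, a.1 = b.1 → a.2 + 1 < b.2 → b.2 + 1 < m b.1 → Commute (t a) (t b)
  cross : ∀ a b, a.1 ≠ b.1 → a.2 + 1 < m a.1 → b.2 + 1 < m b.1 → Commute (t a) (t b)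
  y_comm : ∀ a b, a.2 < m a.1 → b.2 < m b.1 → Commute (y a) (y b)
  t_y : ∀ a b, a.2 + 1 < m a.1 → b.2 < m b.1 → b ≠ a → b ≠ nextLabel a → Commute (t a) (y b)
  shift : ∀ a, a.2 + 1 < m a.1 → t a * y a * t a = (q : R) • y (nextLabel a)
  next_mul : ∀ a, a.2 + 1 < m a.1 →
    y (nextLabel a) * t a = t a * y a + ((q : R) - 1) • y (nextLabel a)
  mul_next : ∀ a, a.2 + 1 < m a.1 →
    t a * y (nextLabel a) = y a * t a + ((q : R) - 1) • y (nextLabel a)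
  isUnit : ∀ a b, a.1 ≠ b.1 → a.2 < m a.1 → b.2 < m b.1 → IsUnit (y b - y a)

/-- The coefficient `(q - 1) y_b (y_b - y_a)⁻¹`. -/
def coef (q : Rˣ) (y : K × ℕ → A) (a b : K × ℕ) : A :=
  ((q : R) - 1) • (y b * Ring.inverse (y b - y a))

lemma commute_coef {q : Rˣ} {y : K × ℕ → A} {a b : K × ℕ} {s : A} (ha : Commute s (y a))
    (hb : Commute s (y b)) : Commute s (coef q y a b) := by
  refine Commute.smul_right (hb.mul_right ?_) _
  by_cases hu : IsUnit (y b - y a)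
  · obtain ⟨u, hu⟩ := hu
    have h1 : Commute s (u : A) := hu ▸ hb.sub_right ha
    rw [← hu, Ring.inverse_unit]
    exact h1.units_inv_right
  · rw [Ring.inverse_non_unit _ hu]
    exact Commute.zero_right s

namespace IsColoredHecke

open IsAffineHecke

variable {q : Rˣ} {m : K → ℕ} {t y : K × ℕ → A}

lemma coef_mul (h : IsColoredHecke q m t y) {a b : K × ℕ} (hab : a.1 ≠ b.1) (ha : a.2 < m a.1)
    (hb : b.2 < m b.1) : coef q y a b * (y b - y a) = ((q : R) - 1) • y b := by
  rw [coef, smul_mul_assoc, mul_assoc, Ring.inverse_mul_cancel _ (h.isUnit a b hab ha hb), mul_one]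

lemma commute_y_coef (h : IsColoredHecke q m t y) {a b c : K × ℕ} (ha : a.2 < m a.1)
    (hb : b.2 < m b.1) (hc : c.2 < m c.1) : Commute (y c) (coef q y a b) :=
  commute_coef (h.y_comm _ _ hc ha) (h.y_comm _ _ hc hb)

lemma commute_coef_coef (h : IsColoredHecke q m t y) {a b c d : K × ℕ} (ha : a.2 < m a.1)
    (hb : b.2 < m b.1) (hc : c.2 < m c.1) (hd : d.2 < m d.1) :
    Commute (coef q y a b) (coef q y c d) :=
  commute_coef (h.commute_y_coef ha hb hc).symm (h.commute_y_coef ha hb hd).symm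

lemma coef_swap (h : IsColoredHecke q m t y) {a b : K × ℕ} (hab : a.1 ≠ b.1) (ha : a.2 < m a.1)
    (hb : b.2 < m b.1) : coef q y b a = ((q : R) - 1) • 1 - coef q y a b := by
  refine (h.isUnit a b hab ha hb).mul_left_injective ?_
  have h1 := h.coef_mul hab ha hb
  have h2 := h.coef_mul hab.symm hb ha
  simp only
  rw [sub_mul, h1, ← neg_sub (y a) (y b), mul_neg, mul_neg, h2, smul_mul_assoc, one_mul]
  module

/-- The three-term relation between the coefficients, which gives the braid relation for three
distinct letters. -/
lemma coef_mul_coef (h : IsColoredHecke q m t y) {a b c : K × ℕ} (hab : a.1 ≠ b.1)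
    (hbc : b.1 ≠ c.1) (hac : a.1 ≠ c.1) (ha : a.2 < m a.1) (hb : b.2 < m b.1) (hc : c.2 < m c.1) :
    coef q y a b * coef q y b c = coef q y a b * coef q y a c + coef q y b c * coef q y a c
      - ((q : R) - 1) • coef q y a c := by
  refine (h.isUnit a c hac ha hc).mul_left_injective ?_
  have h1 := h.coef_mul hab ha hb
  have h2 := h.coef_mul hbc hb hc
  have h3 := h.coef_mul hac ha hc
  have e1 := (h.commute_y_coef ha hb hc).eq
  have e2 := (h.commute_y_coef hb hc hb).eq
  have e3 := (h.commute_coef_coef ha hb hb hc).eq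
  simp only
  have h4 : coef q y a b * coef q y b c * (y c - y a)
      = coef q y a b * (coef q y b c * (y c - y b)) + coef q y b c * (coef q y a b * (y b - y a)) := by
    rw [← mul_assoc, ← mul_assoc, ← e3]
    simp only [mul_sub]
    abel
  have h5 : coef q y b c * y c = coef q y b c * y b + ((q : R) - 1) • y c := by
    rw [← h2, mul_sub]; abel
  rw [h4, h1, h2, sub_mul, add_mul, mul_assoc, mul_assoc, smul_mul_assoc, h3, mul_smul_comm,
    mul_smul_comm, mul_smul_comm, h5]
  module

/-- Moving a Hecke generator across a coefficient. This relation and the next one give the braid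
relation for two equal letters and a third letter. -/
lemma t_mul_coef (h : IsColoredHecke q m t y) {a b : K × ℕ} (hab : a.1 ≠ b.1)
    (ha : a.2 + 1 < m a.1) (hb : b.2 < m b.1) :
    t a * coef q y a b = coef q y (nextLabel a) b * t a + ((q : R) - 1) • coef q y a b
      - coef q y a b * coef q y (nextLabel a) b := by
  have ha' : (nextLabel a).2 < m (nextLabel a).1 := ha
  refine (h.isUnit a b hab (by lia) hb).mul_left_injective ?_
  have h1 := h.coef_mul hab (by lia) hb
  have h2 := h.coef_mul (a := nextLabel a) hab ha' hb
  have e1 := (h.t_y a b ha hb (fun h => hab (by rw [h])) (fun h => hab (by rw [h]; rfl))).eq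
  have e2 := (h.commute_coef_coef (a := a) (c := nextLabel a) (by lia) hb ha' hb).eq
  have h3 : t a * (y b - y a) = (y b - y (nextLabel a)) * t a + ((q : R) - 1) • y (nextLabel a) := by
    rw [mul_sub, sub_mul, h.next_mul a ha, e1]
    abel
  have h4 : coef q y (nextLabel a) b * y (nextLabel a)
      = coef q y (nextLabel a) b * y b - ((q : R) - 1) • y b := by
    rw [← h2, mul_sub]; abel
  simp only
  rw [sub_mul, add_mul, mul_assoc, h1, mul_assoc, h3, mul_add, ← mul_assoc, h2, smul_mul_assoc,
    smul_mul_assoc, h1, e2, mul_assoc, h1, mul_smul_comm, mul_smul_comm, mul_smul_comm, h4, e1]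
  module

lemma t_mul_coef_next (h : IsColoredHecke q m t y) {a b : K × ℕ} (hab : a.1 ≠ b.1)
    (ha : a.2 + 1 < m a.1) (hb : b.2 < m b.1) :
    t a * coef q y (nextLabel a) b = coef q y a b * t a - ((q : R) - 1) • coef q y a b
      + coef q y a b * coef q y (nextLabel a) b := by
  have ha' : (nextLabel a).2 < m (nextLabel a).1 := ha
  refine (h.isUnit (nextLabel a) b hab ha' hb).mul_left_injective ?_
  have h1 := h.coef_mul hab (by lia) hb
  have h2 := h.coef_mul (a := nextLabel a) hab ha' hb
  have e1 := (h.t_y a b ha hb (fun h => hab (by rw [h])) (fun h => hab (by rw [h]; rfl))).eq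
  have h3 : t a * (y b - y (nextLabel a)) = (y b - y a) * t a - ((q : R) - 1) • y (nextLabel a) := by
    rw [mul_sub, sub_mul, h.mul_next a ha, e1]
    abel
  simp only
  rw [add_mul, sub_mul, mul_assoc, h2, mul_assoc, h3, mul_sub, ← mul_assoc, h1, mul_assoc, h2,
    mul_smul_comm, mul_smul_comm, mul_smul_comm, e1, smul_mul_assoc, smul_mul_assoc, mul_sub]
  module

end IsColoredHecke
end Colored

/-! ### The representation on functions on words -/

section LocalRelations

open IsAffineHecke

variable {R : Type*} [CommRing R] {A : Type*} [Ring A] [Algebra R A] {X : Type*}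
  {U V : (X → A) → X → A} {p : R}

/-- The quadratic relation for two distinct letters. -/
lemma local_quad {w w' : X} {c : A} (h : ∀ f, U f w = c * f w + (1 + c) * f w')
    (h' : ∀ f, U f w' = (p • 1 - c) * f w' + (1 + (p • 1 - c)) * f w) (f : X → A) :
    U (U f) w = p • U f w + (p + 1) • f w := by
  simp only [h, h', mul_add, add_mul, mul_sub, sub_mul, smul_mul_assoc, mul_smul_comm, one_mul,
    smul_add]
  module

/-- The affine relation for two distinct letters. -/
lemma local_shift {w w' : X} {c y y' : A} (h : ∀ f, U f w = c * f w + (1 + c) * f w')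
    (h' : ∀ f, U f w' = (p • 1 - c) * f w' + (1 + (p • 1 - c)) * f w)
    (hV : ∀ f, V f w = y * f w) (hV' : ∀ f, V f w' = y' * f w') (hc : c * y' = c * y + p • y')
    (hy : y * c = c * y) (hy' : y' * c = c * y') (f : X → A) :
    U (V (U f)) w = (p + 1) • (y' * f w) := by
  rw [hc] at hy'
  simp only [h, h', hV, hV', mul_add, add_mul, mul_sub, sub_mul, smul_mul_assoc, mul_smul_comm,
    one_mul, mul_assoc, smul_add, reassoc₂ hc, reassoc₂ hy, reassoc₂ hy']
  module

/-- The braid relation for two equal letters and a third letter. The words `w₁`, `w₂`, `w₃` are of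
the form `aab`, `aba` and `baa`. -/
lemma local_braid_two {w₁ w₂ w₃ : X} {t c₁ c₂ : A}
    (U1 : ∀ f, U f w₁ = t * f w₁) (V1 : ∀ f, V f w₁ = c₂ * f w₁ + (1 + c₂) * f w₂)
    (U2 : ∀ f, U f w₂ = c₁ * f w₂ + (1 + c₁) * f w₃)
    (V2 : ∀ f, V f w₂ = (p • 1 - c₂) * f w₂ + (1 + (p • 1 - c₂)) * f w₁)
    (U3 : ∀ f, U f w₃ = (p • 1 - c₁) * f w₃ + (1 + (p • 1 - c₁)) * f w₂)
    (V3 : ∀ f, V f w₃ = t * f w₃) (tt : t * t = p • t + (p + 1) • 1)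
    (tc₁ : t * c₁ = c₂ * t + p • c₁ - c₁ * c₂) (tc₂ : t * c₂ = c₁ * t - p • c₁ + c₁ * c₂)
    (hc : c₂ * c₁ = c₁ * c₂) (f : X → A) :
    V (U (V f)) w₁ = U (V (U f)) w₁ ∧ V (U (V f)) w₂ = U (V (U f)) w₂ ∧
      V (U (V f)) w₃ = U (V (U f)) w₃ := by
  refine ⟨?_, ?_, ?_⟩ <;>
  · simp only [U1, U2, U3, V1, V2, V3, mul_add, add_mul, mul_sub, sub_mul, smul_mul_assoc,
      mul_smul_comm, one_mul, mul_assoc, smul_add, smul_sub, reassoc₂ tt, reassoc₂ tc₁,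
      reassoc₂ tc₂, reassoc₂ hc]
    module

/-- The braid relation for three distinct letters, at the word `w₁₂₃`. -/
lemma local_braid_three {w₁₂₃ w₂₁₃ w₁₃₂ w₂₃₁ w₃₁₂ w₃₂₁ : X} {u v z : A}
    (U1 : ∀ f, U f w₁₂₃ = u * f w₁₂₃ + (1 + u) * f w₂₁₃)
    (V1 : ∀ f, V f w₁₂₃ = v * f w₁₂₃ + (1 + v) * f w₁₃₂)
    (U2 : ∀ f, U f w₂₁₃ = (p • 1 - u) * f w₂₁₃ + (1 + (p • 1 - u)) * f w₁₂₃)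
    (V2 : ∀ f, V f w₂₁₃ = z * f w₂₁₃ + (1 + z) * f w₂₃₁)
    (U3 : ∀ f, U f w₁₃₂ = z * f w₁₃₂ + (1 + z) * f w₃₁₂)
    (V3 : ∀ f, V f w₁₃₂ = (p • 1 - v) * f w₁₃₂ + (1 + (p • 1 - v)) * f w₁₂₃)
    (U4 : ∀ f, U f w₂₃₁ = v * f w₂₃₁ + (1 + v) * f w₃₂₁)
    (V4 : ∀ f, V f w₃₁₂ = u * f w₃₁₂ + (1 + u) * f w₃₂₁)
    (huz : z * u = u * z) (hvz : z * v = v * z) (huv : u * v = u * z + v * z - p • z)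
    (hvu : v * u = u * v) (f : X → A) : V (U (V f)) w₁₂₃ = U (V (U f)) w₁₂₃ := by
  rw [huv] at hvu
  simp only [U1, U2, U3, U4, V1, V2, V3, V4, mul_add, add_mul, mul_sub, sub_mul, smul_mul_assoc,
      mul_smul_comm, one_mul, mul_assoc, smul_add, reassoc₂ huz, reassoc₂ hvz, reassoc₂ huv,
      reassoc₂ hvu]
  module

end LocalRelations

section ContentWords

variable {n : ℕ} {K : Type*} [DecidableEq K] {m : K → ℕ}

/-- The words with `m α` letters `α`, for all `α`. -/
abbrev ContentWord (n : ℕ) (m : K → ℕ) : Type _ := {w : Fin n → K // ∀ α, cnt w n α = m α}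

/-- The label of the position `p`: its letter, together with the number of earlier occurrences of
this letter. -/
def label (w : Fin n → K) (p : Fin n) : K × ℕ := (w p, occ w p)

lemma label_valid (w : ContentWord n m) (p : Fin n) :
    (label w.1 p).2 < m (label w.1 p).1 := by
  rw [← w.2]
  exact cnt_lt w.1 p p.2

lemma occ_lt_occ {w : Fin n → K} {p p' : Fin n} (h : p < p') (hw : w p = w p') :
    occ w p < occ w p' := by
  have := cnt_lt w p h
  rwa [hw, ← hw, ← occ, hw, ← occ] at this

lemma label_injective (w : Fin n → K) : Function.Injective (label w) := by
  intro p p' h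
  simp only [label, Prod.mk.injEq] at h
  rcases lt_trichotomy p p' with hlt | heq | hlt
  · exact absurd h.2 (occ_lt_occ hlt h.1).ne
  · exact heq
  · exact absurd h.2.symm (occ_lt_occ hlt h.1.symm).ne

lemma label_next {k : ℕ} (hk : k + 1 < n) {w : Fin n → K}
    (h : (label w ⟨k, by lia⟩).1 = (label w ⟨k + 1, hk⟩).1) :
    label w ⟨k + 1, hk⟩ = nextLabel (label w ⟨k, by lia⟩) :=
  Prod.ext h.symm (occ_succ hk h)

lemma label_swapWord {k : ℕ} (hk : k + 1 < n) {w : Fin n → K}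
    (h : (label w ⟨k, by lia⟩).1 ≠ (label w ⟨k + 1, hk⟩).1) (p : Fin n) :
    label (swapWord k w) p = label w (swapAdj n k p) :=
  Prod.ext rfl (occ_swapWord hk h p)

lemma label_swapWord_left {k : ℕ} (hk : k + 1 < n) {w : Fin n → K}
    (h : (label w ⟨k, by lia⟩).1 ≠ (label w ⟨k + 1, hk⟩).1) :
    label (swapWord k w) ⟨k, by lia⟩ = label w ⟨k + 1, hk⟩ := by
  rw [label_swapWord hk h]; congr 1; ext; simp [swapAdj_val hk]

lemma label_swapWord_right {k : ℕ} (hk : k + 1 < n) {w : Fin n → K}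
    (h : (label w ⟨k, by lia⟩).1 ≠ (label w ⟨k + 1, hk⟩).1) :
    label (swapWord k w) ⟨k + 1, hk⟩ = label w ⟨k, by lia⟩ := by
  rw [label_swapWord hk h]; congr 1; ext; simp [swapAdj_val hk]

lemma label_swapWord_of_ne {k : ℕ} (hk : k + 1 < n) {w : Fin n → K}
    (h : (label w ⟨k, by lia⟩).1 ≠ (label w ⟨k + 1, hk⟩).1) {p : Fin n} (h1 : (p : ℕ) ≠ k)
    (h2 : (p : ℕ) ≠ k + 1) : label (swapWord k w) p = label w p := by
  rw [label_swapWord hk h]; congr 1; ext; simp [swapAdj_val hk, h1, h2]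

namespace ContentWord

/-- Exchange of adjacent letters in words of given content. -/
def swap (k : ℕ) (w : ContentWord n m) : ContentWord n m := ⟨swapWord k w.1, fun α => by
  by_cases hk : k + 1 < n
  · rw [cnt_swapWord hk w.1 (by lia), w.2]
  · have : swapWord k w.1 = w.1 := by
      funext p
      rw [swapWord_apply, swapAdj, dif_neg hk]
      rfl
    rw [this, w.2]⟩

lemma swap_swap (k : ℕ) (w : ContentWord n m) : (w.swap k).swap k = w :=
  Subtype.ext (swapWord_swapWord k w.1)

lemma swap_far {k l : ℕ} (hk : k + 1 < n) (hl : l + 1 < n) (hkl : k + 1 < l ∨ l + 1 < k)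
    (w : ContentWord n m) : (w.swap l).swap k = (w.swap k).swap l :=
  Subtype.ext (swapWord_far hk hl hkl w.1)

lemma swap_braid {k : ℕ} (hk : k + 2 < n) (w : ContentWord n m) :
    ((w.swap k).swap (k + 1)).swap k = ((w.swap (k + 1)).swap k).swap (k + 1) :=
  Subtype.ext (swapWord_braid hk w.1)

end ContentWord

variable {R : Type*} [CommRing R] {A : Type*} [Ring A] [Algebra R A]

/-- Left multiplication by a function on words. -/
def diagOp (R : Type*) [CommRing R] [Algebra R A] (g : ContentWord n m → A) :
    Module.End R (ContentWord n m → A) where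
  toFun f := fun w => g w * f w
  map_add' _ _ := funext fun _ => mul_add _ _ _
  map_smul' _ _ := funext fun _ => mul_smul_comm _ _ _

lemma diagOp_mul (g g' : ContentWord n m → A) :
    diagOp R g * diagOp R g' = diagOp R fun w => g w * g' w :=
  LinearMap.ext fun _ => funext fun _ => (mul_assoc _ _ _).symm

/-- The action of a Hecke generator on functions on words: the Hecke generator of the coefficient
algebra at words with two equal letters, and a combination of the values at the word and at its
transposition otherwise. -/
def heckeOp (q : Rˣ) (t y : K × ℕ → A) (k : ℕ) : Module.End R (ContentWord n m → A) where
  toFun f := fun w => if hk : k + 1 < n then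
      if (label w.1 ⟨k, by lia⟩).1 = (label w.1 ⟨k + 1, hk⟩).1 then t (label w.1 ⟨k, by lia⟩) * f w
      else coef q y (label w.1 ⟨k, by lia⟩) (label w.1 ⟨k + 1, hk⟩) * f w
        + (1 + coef q y (label w.1 ⟨k, by lia⟩) (label w.1 ⟨k + 1, hk⟩)) * f (w.swap k)
    else 0
  map_add' f f' := funext fun w => by
    simp only [Pi.add_apply, mul_add]
    split_ifs
    · rfl
    · abel
    · simp
  map_smul' r f := funext fun w => by
    simp only [Pi.smul_apply, mul_smul_comm, RingHom.id_apply]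
    split_ifs
    · rfl
    · rw [smul_add]
    · simp

section

variable {q : Rˣ} {t y : K × ℕ → A} {w : ContentWord n m}

lemma heckeOp_eq {k : ℕ} (hk : k + 1 < n) {a b : K × ℕ} (ha : label w.1 ⟨k, by lia⟩ = a)
    (hb : label w.1 ⟨k + 1, hk⟩ = b) (h : a.1 = b.1) (f : ContentWord n m → A) :
    heckeOp q t y k f w = t a * f w := by
  subst ha hb
  change dite _ _ _ = _
  rw [dif_pos hk, if_pos h]

lemma heckeOp_ne {k : ℕ} (hk : k + 1 < n) {a b : K × ℕ} (ha : label w.1 ⟨k, by lia⟩ = a)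
    (hb : label w.1 ⟨k + 1, hk⟩ = b) (h : a.1 ≠ b.1) (f : ContentWord n m → A) :
    heckeOp q t y k f w = coef q y a b * f w + (1 + coef q y a b) * f (w.swap k) := by
  subst ha hb
  change dite _ _ _ = _
  rw [dif_pos hk, if_neg h]

end

end ContentWords

/-! ### Relations of the operators on words -/

section Operators

open IsAffineHecke

variable {n : ℕ} {K : Type*} [DecidableEq K] {m : K → ℕ} {R : Type*} [CommRing R] {A : Type*}
  [Ring A] [Algebra R A] {q : Rˣ} {t y : K × ℕ → A} {w : ContentWord n m}

/-- Left multiplication by the polynomial generators belonging to the labels of the position `p`. -/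
def labelOp (y : K × ℕ → A) (p : ℕ) : Module.End R (ContentWord n m → A) :=
  diagOp R fun w => if h : p < n then y (label w.1 ⟨p, h⟩) else 0

lemma labelOp_apply {p : ℕ} (hp : p < n) {a : K × ℕ} (ha : label w.1 ⟨p, hp⟩ = a)
    (f : ContentWord n m → A) : labelOp (R := R) y p f w = y a * f w := by
  subst ha
  change (if h : p < n then y (label w.1 ⟨p, h⟩) else 0) * f w = _
  rw [dif_pos hp]

lemma label_swap_left {k : ℕ} (hk : k + 1 < n) {a b : K × ℕ} (ha : label w.1 ⟨k, by lia⟩ = a)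
    (hb : label w.1 ⟨k + 1, hk⟩ = b) (h : a.1 ≠ b.1) :
    label (w.swap k).1 ⟨k, by lia⟩ = b := by
  subst ha hb
  exact label_swapWord_left hk h

lemma label_swap_right {k : ℕ} (hk : k + 1 < n) {a b : K × ℕ} (ha : label w.1 ⟨k, by lia⟩ = a)
    (hb : label w.1 ⟨k + 1, hk⟩ = b) (h : a.1 ≠ b.1) :
    label (w.swap k).1 ⟨k + 1, hk⟩ = a := by
  subst ha hb
  exact label_swapWord_right hk h

lemma label_swap_of_ne {k : ℕ} (hk : k + 1 < n) {a b c : K × ℕ} (ha : label w.1 ⟨k, by lia⟩ = a)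
    (hb : label w.1 ⟨k + 1, hk⟩ = b) (h : a.1 ≠ b.1) {p : Fin n} (hc : label w.1 p = c)
    (h1 : (p : ℕ) ≠ k) (h2 : (p : ℕ) ≠ k + 1) : label (w.swap k).1 p = c := by
  subst ha hb hc
  exact label_swapWord_of_ne hk h h1 h2

namespace IsColoredHecke

lemma heckeOp_ne_swap (h : IsColoredHecke q m t y) {k : ℕ} (hk : k + 1 < n) {a b : K × ℕ}
    (ha : label w.1 ⟨k, by lia⟩ = a) (hb : label w.1 ⟨k + 1, hk⟩ = b) (hab : a.1 ≠ b.1)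
    (f : ContentWord n m → A) :
    heckeOp q t y k f (w.swap k) = (((q : R) - 1) • 1 - coef q y a b) * f (w.swap k)
      + (1 + (((q : R) - 1) • 1 - coef q y a b)) * f w := by
  rw [heckeOp_ne hk (label_swap_left hk ha hb hab) (label_swap_right hk ha hb hab) hab.symm,
    h.coef_swap hab (ha ▸ label_valid w _) (hb ▸ label_valid w _), w.swap_swap]

lemma next_valid {k : ℕ} (hk : k + 1 < n) {a b : K × ℕ}
    (ha : label w.1 ⟨k, by lia⟩ = a) (hb : label w.1 ⟨k + 1, hk⟩ = b) (hab : a.1 = b.1) :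
    b = nextLabel a ∧ a.2 + 1 < m a.1 := by
  subst ha hb
  have h1 := label_next hk hab
  have h2 := label_valid w ⟨k + 1, hk⟩
  rw [h1] at h2
  exact ⟨h1, h2⟩

lemma heckeOp_quad (h : IsColoredHecke q m t y) {k : ℕ} (hk : k + 1 < n) :
    (heckeOp q t y k * heckeOp q t y k : Module.End R (ContentWord n m → A))
      = ((q : R) - 1) • heckeOp q t y k + (q : R) • 1 := by
  refine LinearMap.ext fun f => funext fun w => ?_
  obtain ⟨a, ha⟩ : ∃ a, label w.1 ⟨k, by lia⟩ = a := ⟨_, rfl⟩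
  obtain ⟨b, hb⟩ : ∃ b, label w.1 ⟨k + 1, hk⟩ = b := ⟨_, rfl⟩
  change heckeOp (R := R) q t y k (heckeOp q t y k f) w
    = ((q : R) - 1) • heckeOp q t y k f w + (q : R) • f w
  by_cases hab : a.1 = b.1
  · obtain ⟨rfl, hm⟩ := next_valid hk ha hb hab
    rw [heckeOp_eq hk ha hb hab, heckeOp_eq hk ha hb hab, ← mul_assoc, h.quad a hm, add_mul,
      smul_mul_assoc, smul_mul_assoc, one_mul]
  · have := local_quad (heckeOp_ne hk ha hb hab) (h.heckeOp_ne_swap hk ha hb hab) f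
    rwa [sub_add_cancel] at this

/-- The braid relation at words where, up to rearrangement, two of three adjacent letters agree. -/
lemma heckeOp_braid_two (h : IsColoredHecke q m t y) {k : ℕ} (hk : k + 2 < n) {a c : K × ℕ}
    (ha : label w.1 ⟨k, by lia⟩ = a) (hb : label w.1 ⟨k + 1, by lia⟩ = nextLabel a)
    (hc : label w.1 ⟨k + 2, hk⟩ = c) (hac : a.1 ≠ c.1) (f : ContentWord n m → A) :
    ∀ w' ∈ ({w, w.swap (k + 1), (w.swap (k + 1)).swap k} : Set (ContentWord n m)),
      heckeOp q t y (k + 1) (heckeOp q t y k (heckeOp q t y (k + 1) f)) w'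
        = heckeOp q t y k (heckeOp q t y (k + 1) (heckeOp q t y k f)) w' := by
  have hk1 : k + 1 < n := by lia
  have hm := (next_valid hk1 ha hb rfl).2
  have vc : c.2 < m c.1 := hc ▸ label_valid w _
  have hbc : (nextLabel a).1 ≠ c.1 := hac
  have ha' := label_swap_of_ne (k := k + 1) hk hb hc hbc ha (by simp only; lia) (by simp only; lia)
  have hb' := label_swap_left (k := k + 1) hk hb hc hbc
  have hc' := label_swap_right (k := k + 1) hk hb hc hbc
  have hb'' := label_swap_right hk1 ha' hb' hac
  have hc'' := label_swap_of_ne hk1 ha' hb' hac hc' (by simp only; lia) (by simp only; lia)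
  have key := local_braid_two (p := (q : R) - 1)
    (heckeOp_eq hk1 ha hb rfl) (heckeOp_ne hk hb hc hbc) (heckeOp_ne hk1 ha' hb' hac)
    (h.heckeOp_ne_swap hk hb hc hbc) (h.heckeOp_ne_swap hk1 ha' hb' hac)
    (heckeOp_eq hk hb'' hc'' rfl) (by rw [h.quad a hm, sub_add_cancel])
    (h.t_mul_coef hac hm vc) (h.t_mul_coef_next hac hm vc)
    (h.commute_coef_coef hm vc (by lia) vc).eq f
  rintro w' (rfl | rfl | rfl)
  exacts [key.1, key.2.1, key.2.2]

lemma heckeOp_braid (h : IsColoredHecke q m t y) {k : ℕ} (hk : k + 2 < n) :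
    (heckeOp q t y (k + 1) * heckeOp q t y k * heckeOp q t y (k + 1) :
      Module.End R (ContentWord n m → A))
      = heckeOp q t y k * heckeOp q t y (k + 1) * heckeOp q t y k := by
  refine LinearMap.ext fun f => funext fun w => ?_
  change heckeOp (R := R) q t y (k + 1) (heckeOp q t y k (heckeOp q t y (k + 1) f)) w
    = heckeOp q t y k (heckeOp q t y (k + 1) (heckeOp q t y k f)) w
  have hk1 : k + 1 < n := by lia
  obtain ⟨a, ha⟩ : ∃ a, label w.1 ⟨k, by lia⟩ = a := ⟨_, rfl⟩
  obtain ⟨b, hb⟩ : ∃ b, label w.1 ⟨k + 1, hk1⟩ = b := ⟨_, rfl⟩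
  obtain ⟨c, hc⟩ : ∃ c, label w.1 ⟨k + 2, hk⟩ = c := ⟨_, rfl⟩
  have va : a.2 < m a.1 := ha ▸ label_valid w _
  have vb : b.2 < m b.1 := hb ▸ label_valid w _
  have vc : c.2 < m c.1 := hc ▸ label_valid w _
  by_cases hab : a.1 = b.1
  · obtain ⟨rfl, hm⟩ := next_valid hk1 ha hb hab
    by_cases hbc : (nextLabel a).1 = c.1
    · obtain ⟨rfl, hm'⟩ := next_valid hk hb hc hbc
      rw [heckeOp_eq hk hb hc hbc, heckeOp_eq hk1 ha hb hab, heckeOp_eq hk hb hc hbc,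
        heckeOp_eq hk1 ha hb hab, heckeOp_eq hk hb hc hbc, heckeOp_eq hk1 ha hb hab,
        ← mul_assoc, ← mul_assoc, ← mul_assoc, ← mul_assoc, h.braid a hm']
    · exact h.heckeOp_braid_two hk ha hb hc hbc f w (Or.inl rfl)
  · by_cases hbc : b.1 = c.1
    · obtain ⟨rfl, hm⟩ := next_valid hk hb hc hbc
      have ha' := label_swap_left hk1 ha hb hab
      have hb' := label_swap_right hk1 ha hb hab
      have hc' := label_swap_of_ne hk1 ha hb hab hc (by simp only; lia) (by simp only; lia)
      have ha'' := label_swap_of_ne (k := k + 1) hk hb' hc' hab ha' (by simp only; lia)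
        (by simp only; lia)
      have hb'' := label_swap_left (k := k + 1) hk hb' hc' hab
      have hc'' := label_swap_right (k := k + 1) hk hb' hc' hab
      refine h.heckeOp_braid_two hk ha'' hb'' hc'' (Ne.symm hab) f w (Or.inr (Or.inr ?_))
      rw [Set.mem_singleton_iff, ContentWord.swap_swap, ContentWord.swap_swap]
    · have ha₁ := label_swap_of_ne (k := k + 1) hk hb hc hbc ha (by simp only; lia)
        (by simp only; lia)
      have hb₁ := label_swap_left (k := k + 1) hk hb hc hbc
      have hc₁ := label_swap_right (k := k + 1) hk hb hc hbc
      by_cases hac : a.1 = c.1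
      · obtain ⟨rfl, hm⟩ : c = nextLabel a ∧ a.2 + 1 < m a.1 := by
          have ha₂ := label_swap_left hk1 ha hb hab
          have hb₂ := label_swap_right hk1 ha hb hab
          have hc₂ := label_swap_of_ne hk1 ha hb hab hc (by simp only; lia) (by simp only; lia)
          exact next_valid (k := k + 1) hk hb₂ hc₂ hac
        refine h.heckeOp_braid_two hk ha₁ hb₁ hc₁ hab f w (Or.inr (Or.inl ?_))
        rw [ContentWord.swap_swap]
      · have ha₂ := label_swap_left hk1 ha hb hab
        have hb₂ := label_swap_right hk1 ha hb hab
        have hc₂ := label_swap_of_ne hk1 ha hb hab hc (by simp only; lia) (by simp only; lia)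
        have ha₃ := label_swap_of_ne (k := k + 1) hk hb₂ hc₂ hac ha₂ (by simp only; lia)
          (by simp only; lia)
        have hb₃ := label_swap_left (k := k + 1) hk hb₂ hc₂ hac
        have hb₄ := label_swap_right hk1 ha₁ hb₁ hac
        have hc₄ := label_swap_of_ne hk1 ha₁ hb₁ hac hc₁ (by simp only; lia) (by simp only; lia)
        exact local_braid_three (p := (q : R) - 1)
          (heckeOp_ne hk1 ha hb hab) (heckeOp_ne hk hb hc hbc) (h.heckeOp_ne_swap hk1 ha hb hab)
          (heckeOp_ne hk hb₂ hc₂ hac) (heckeOp_ne hk1 ha₁ hb₁ hac)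
          (h.heckeOp_ne_swap hk hb hc hbc)
          (by rw [← ContentWord.swap_braid hk]; exact heckeOp_ne hk1 ha₃ hb₃ hbc)
          (heckeOp_ne hk hb₄ hc₄ hab)
          (h.commute_coef_coef va vc va vb).eq (h.commute_coef_coef va vc vb vc).eq
          (h.coef_mul_coef hab hbc hac va vb vc) (h.commute_coef_coef vb vc va vb).eq f

/-- Distant generators commute at words where the first pair of letters is equal and the second pair
is not. -/
lemma heckeOp_far_apply (h : IsColoredHecke q m t y) {k l : ℕ} (hk : k + 1 < n) (hl : l + 1 < n)
    (hkl : k + 1 < l ∨ l + 1 < k) {a b c d : K × ℕ} (ha : label w.1 ⟨k, by lia⟩ = a)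
    (hb : label w.1 ⟨k + 1, hk⟩ = b) (hc : label w.1 ⟨l, by lia⟩ = c)
    (hd : label w.1 ⟨l + 1, hl⟩ = d) (hab : a.1 = b.1) (hcd : c.1 ≠ d.1)
    (f : ContentWord n m → A) :
    heckeOp (R := R) q t y k (heckeOp q t y l f) w = heckeOp q t y l (heckeOp q t y k f) w := by
  have hne : ∀ {p p' : Fin n}, (p : ℕ) ≠ p' → label w.1 p ≠ label w.1 p' := fun hp he =>
    hp (congrArg Fin.val (label_injective w.1 he))
  have vc : c.2 < m c.1 := hc ▸ label_valid w _
  have vd : d.2 < m d.1 := hd ▸ label_valid w _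
  obtain ⟨rfl, hm⟩ := next_valid hk ha hb hab
  have e : Commute (t a) (coef q y c d) := by
    refine commute_coef (h.t_y _ _ hm vc ?_ ?_) (h.t_y _ _ hm vd ?_ ?_)
    · rw [← hc, ← ha]; exact hne (by simp only; lia)
    · rw [← hc, ← hb]; exact hne (by simp only; lia)
    · rw [← hd, ← ha]; exact hne (by simp only; lia)
    · rw [← hd, ← hb]; exact hne (by simp only; lia)
  have ha' := label_swap_of_ne hl hc hd hcd ha (by simp only; lia) (by simp only; lia)
  have hb' := label_swap_of_ne hl hc hd hcd hb (by simp only; lia) (by simp only; lia)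
  rw [heckeOp_eq hk ha hb hab, heckeOp_ne hl hc hd hcd, heckeOp_ne hl hc hd hcd,
    heckeOp_eq hk ha hb hab, heckeOp_eq hk ha' hb' hab]
  simp only [mul_add, add_mul, one_mul, ← mul_assoc, e.eq]

lemma heckeOp_far (h : IsColoredHecke q m t y) {k l : ℕ} (hkl : k + 1 < l) (hl : l + 1 < n) :
    Commute (heckeOp q t y k : Module.End R (ContentWord n m → A)) (heckeOp q t y l) := by
  refine LinearMap.ext fun f => funext fun w => ?_
  change heckeOp (R := R) q t y k (heckeOp q t y l f) w = heckeOp (R := R) q t y l (heckeOp q t y k f) w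
  have hk : k + 1 < n := by lia
  obtain ⟨a, ha⟩ : ∃ a, label w.1 ⟨k, by lia⟩ = a := ⟨_, rfl⟩
  obtain ⟨b, hb⟩ : ∃ b, label w.1 ⟨k + 1, hk⟩ = b := ⟨_, rfl⟩
  obtain ⟨c, hc⟩ : ∃ c, label w.1 ⟨l, by lia⟩ = c := ⟨_, rfl⟩
  obtain ⟨d, hd⟩ : ∃ d, label w.1 ⟨l + 1, hl⟩ = d := ⟨_, rfl⟩
  have va : a.2 < m a.1 := ha ▸ label_valid w _
  have vb : b.2 < m b.1 := hb ▸ label_valid w _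
  have vc : c.2 < m c.1 := hc ▸ label_valid w _
  have vd : d.2 < m d.1 := hd ▸ label_valid w _
  by_cases hab : a.1 = b.1
  · by_cases hcd : c.1 = d.1
    · rw [heckeOp_eq hk ha hb hab, heckeOp_eq hl hc hd hcd, heckeOp_eq hl hc hd hcd,
        heckeOp_eq hk ha hb hab, ← mul_assoc, ← mul_assoc]
      obtain ⟨rfl, hm⟩ := next_valid hk ha hb hab
      obtain ⟨rfl, hm'⟩ := next_valid hl hc hd hcd
      congr 1
      by_cases hac : a.1 = c.1
      · refine h.far a c hac ?_ hm'
        have h1 : (label w.1 ⟨k + 1, hk⟩).2 < (label w.1 ⟨l, by lia⟩).2 :=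
          occ_lt_occ (Fin.mk_lt_mk.2 hkl) ((congrArg Prod.fst hb).trans
            (hac.trans (congrArg Prod.fst hc).symm))
        rwa [hb, hc] at h1
      · exact h.cross a c hac hm hm'
    · exact h.heckeOp_far_apply hk hl (Or.inl hkl) ha hb hc hd hab hcd f
  · by_cases hcd : c.1 = d.1
    · exact (h.heckeOp_far_apply hl hk (Or.inr hkl) hc hd ha hb hcd hab f).symm
    · have ha' := label_swap_of_ne hl hc hd hcd ha (by simp only; lia) (by simp only; lia)
      have hb' := label_swap_of_ne hl hc hd hcd hb (by simp only; lia) (by simp only; lia)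
      have hc' := label_swap_of_ne hk ha hb hab hc (by simp only; lia) (by simp only; lia)
      have hd' := label_swap_of_ne hk ha hb hab hd (by simp only; lia) (by simp only; lia)
      have e := (h.commute_coef_coef va vb vc vd).eq
      rw [heckeOp_ne hk ha hb hab, heckeOp_ne hl hc hd hcd, heckeOp_ne hl hc' hd' hcd,
        heckeOp_ne hl hc hd hcd, heckeOp_ne hk ha hb hab, heckeOp_ne hk ha' hb' hab,
        ContentWord.swap_far hl hk (Or.inr hkl)]
      simp only [mul_add, add_mul, one_mul, ← mul_assoc, e]
      abel

lemma heckeOp_commute_labelOp (h : IsColoredHecke q m t y) {k p : ℕ} (hk : k + 1 < n) (hp : p < n)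
    (h1 : p ≠ k) (h2 : p ≠ k + 1) :
    Commute (heckeOp q t y k : Module.End R (ContentWord n m → A)) (labelOp y p) := by
  refine LinearMap.ext fun f => funext fun w => ?_
  change heckeOp (R := R) q t y k (labelOp (R := R) y p f) w = labelOp (R := R) y p (heckeOp q t y k f) w
  have hne : ∀ {p p' : Fin n}, (p : ℕ) ≠ p' → label w.1 p ≠ label w.1 p' := fun hp he =>
    hp (congrArg Fin.val (label_injective w.1 he))
  obtain ⟨a, ha⟩ : ∃ a, label w.1 ⟨k, by lia⟩ = a := ⟨_, rfl⟩
  obtain ⟨b, hb⟩ : ∃ b, label w.1 ⟨k + 1, hk⟩ = b := ⟨_, rfl⟩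
  obtain ⟨c, hc⟩ : ∃ c, label w.1 ⟨p, hp⟩ = c := ⟨_, rfl⟩
  have va : a.2 < m a.1 := ha ▸ label_valid w _
  have vb : b.2 < m b.1 := hb ▸ label_valid w _
  have vc : c.2 < m c.1 := hc ▸ label_valid w _
  by_cases hab : a.1 = b.1
  · obtain ⟨rfl, hm⟩ := next_valid hk ha hb hab
    have e : Commute (t a) (y c) := by
      refine h.t_y _ _ hm vc ?_ ?_
      · rw [← hc, ← ha]; exact hne h1
      · rw [← hc, ← hb]; exact hne h2
    rw [heckeOp_eq hk ha hb hab, labelOp_apply hp hc, labelOp_apply hp hc, heckeOp_eq hk ha hb hab,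
      ← mul_assoc, ← mul_assoc, e.eq]
  · have hc' := label_swap_of_ne hk ha hb hab hc h1 h2
    have e := (h.commute_y_coef va vb vc).eq
    rw [heckeOp_ne hk ha hb hab, labelOp_apply hp hc, labelOp_apply hp hc, labelOp_apply hp hc',
      heckeOp_ne hk ha hb hab]
    simp only [mul_add, add_mul, one_mul, ← mul_assoc, e]

lemma heckeOp_shift (h : IsColoredHecke q m t y) {k : ℕ} (hk : k + 1 < n) :
    (heckeOp q t y k * labelOp y k * heckeOp q t y k : Module.End R (ContentWord n m → A))
      = (q : R) • labelOp y (k + 1) := by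
  refine LinearMap.ext fun f => funext fun w => ?_
  change heckeOp (R := R) q t y k (labelOp (R := R) y k (heckeOp q t y k f)) w = (q : R) • labelOp (R := R) y (k + 1) f w
  have hk0 : k < n := by lia
  obtain ⟨a, ha⟩ : ∃ a, label w.1 ⟨k, by lia⟩ = a := ⟨_, rfl⟩
  obtain ⟨b, hb⟩ : ∃ b, label w.1 ⟨k + 1, hk⟩ = b := ⟨_, rfl⟩
  have va : a.2 < m a.1 := ha ▸ label_valid w _
  have vb : b.2 < m b.1 := hb ▸ label_valid w _
  rw [labelOp_apply hk hb]
  by_cases hab : a.1 = b.1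
  · obtain ⟨rfl, hm⟩ := next_valid hk ha hb hab
    rw [heckeOp_eq hk ha hb hab, labelOp_apply hk0 ha, heckeOp_eq hk ha hb hab, ← mul_assoc,
      ← mul_assoc, h.shift a hm, smul_mul_assoc]
  · have := local_shift (V := labelOp (R := R) y k) (heckeOp_ne hk ha hb hab)
      (h.heckeOp_ne_swap hk ha hb hab)
      (labelOp_apply hk0 ha) (labelOp_apply hk0 (label_swap_left hk ha hb hab)) (by
        rw [← h.coef_mul hab va vb, mul_sub]; abel)
      (h.commute_y_coef va vb va).eq (h.commute_y_coef va vb vb).eq f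
    rwa [sub_add_cancel] at this

end IsColoredHecke

lemma labelOp_commute {p p' : ℕ} (hp : p < n) (hp' : p' < n) (h : IsColoredHecke q m t y) :
    Commute (labelOp y p : Module.End R (ContentWord n m → A)) (labelOp y p') := by
  refine LinearMap.ext fun f => funext fun w => ?_
  change labelOp (R := R) y p (labelOp (R := R) y p' f) w = labelOp (R := R) y p' (labelOp (R := R) y p f) w
  rw [labelOp_apply hp rfl, labelOp_apply hp' rfl, labelOp_apply hp' rfl, labelOp_apply hp rfl,
    ← mul_assoc, ← mul_assoc, (h.y_comm _ _ (label_valid w _) (label_valid w _)).eq]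

lemma aeval_labelOp_apply {p : ℕ} (hp : p < n) (g : Polynomial R) (f : ContentWord n m → A)
    (w : ContentWord n m) : Polynomial.aeval (labelOp (R := R) y p) g f w
      = Polynomial.aeval (y (label w.1 ⟨p, hp⟩)) g * f w := by
  induction g using Polynomial.induction_on generalizing f with
  | C r =>
    rw [Polynomial.aeval_C, Polynomial.aeval_C, ← Algebra.smul_def]
    rfl
  | add g g' hg hg' =>
    rw [map_add, map_add, LinearMap.add_apply, Pi.add_apply, hg, hg', add_mul]
  | monomial k r ih =>
    rw [pow_succ, ← mul_assoc, map_mul, map_mul _ (_ * _) Polynomial.X, Polynomial.aeval_X,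
      Polynomial.aeval_X, Module.End.mul_apply, ih, labelOp_apply hp rfl, mul_assoc]

end Operators

/-! ### Faithfulness on the corners -/

section Faithful

open Polynomial ArikiKoike

variable {R : Type u} [CommRing R] {q : Rˣ} {n r κ : ℕ} {Q : Fin r → R} {c : Fin r → Fin κ}
  {m : Fin κ → ℕ}

/-- The representation of the Ariki-Koike algebra on functions on words with values in the
coefficient algebra. -/
lemma ArikiKoike.exists_wordRep {A : Type*} [Ring A] [Algebra R A] {t y : Fin κ × ℕ → A}
    (h : IsColoredHecke q m t y)
    (hcyc : ∀ α, 0 < m α → aeval (y (α, 0)) (∏ k, (X - C (Q k))) = 0) :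
    ∃ Φ : ArikiKoike (q : R) Q n →ₐ[R] Module.End R (ContentWord n m → A),
      (0 < n → Φ (gen (q : R) Q n 0) = labelOp y 0) ∧
      ∀ i, i + 1 < n → Φ (gen (q : R) Q n (i + 1)) = heckeOp q t y i := by
  refine ArikiKoike.exists_algHom _ _ (fun hn => ?_) (fun hn => ?_)
    (fun i hi => h.heckeOp_quad hi) (fun i hi => h.heckeOp_braid hi)
    (fun i l hil hl => h.heckeOp_far hil hl)
    (fun l hl hl' => (h.heckeOp_commute_labelOp hl' (by lia) (by lia) (by lia)).symm)
  · refine LinearMap.ext fun f => funext fun w => ?_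
    rw [aeval_labelOp_apply hn]
    have h1 : label w.1 ⟨0, hn⟩ = (w.1 ⟨0, hn⟩, 0) := Prod.ext rfl (cnt_zero _ _)
    have h2 := label_valid w ⟨0, hn⟩
    rw [h1] at h2 ⊢
    rw [hcyc _ h2, zero_mul]
    rfl
  · have hs := h.heckeOp_shift (n := n) (R := R) (k := 0) hn
    rw [mul_assoc (labelOp y 0), mul_assoc (labelOp y 0), hs, mul_smul_comm, smul_mul_assoc,
      (labelOp_commute (by lia) hn h).eq]

lemma residuePoly_colorStrip (q : Rˣ) (Q : Fin r → R) (c : Fin r → Fin κ) (α : Fin κ) (i : ℕ) :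
    residuePoly q (paramPiece Q c α) (strip Finset.univ fun _ => i)
      = residuePoly q Q (colorStrip c α i) := by
  rw [residuePoly, residuePoly, colorStrip, strip, strip, Finset.prod_sigma, Finset.prod_sigma,
    Finset.prod_subtype (p := fun i => c i = α) (F := inferInstance) _ (by simp)]
  rfl

/-- `exists_inverse_of_specIn` for two commuting elements of a noncommutative algebra. -/
lemma isUnit_sub_of_nilpotent {J : Type*} {P : J → R} {A : Type*} [Ring A] [Algebra R A] {y z : A}
    (hyz : Commute y z) {s s' : Finset (Σ _ : J, ℤ)}
    (hy : IsNilpotent (aeval y (residuePoly q P s)))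
    (hz : IsNilpotent (aeval z (residuePoly q P s')))
    (hu : ∀ p ∈ s, ∀ p' ∈ s', IsUnit (residue q P p - residue q P p')) : IsUnit (y - z) := by
  let U := Algebra.adjoin R ({y, z} : Set A)
  have hU : ∀ a ∈ ({y, z} : Set A), ∀ b ∈ ({y, z} : Set A), a * b = b * a := by
    rintro a (rfl | rfl) b (rfl | rfl)
    exacts [rfl, hyz.eq, hyz.symm.eq, rfl]
  let : CommRing U :=
    { (inferInstance : Ring U) with
      mul_comm := (Algebra.isMulCommutative_adjoin R hU).is_comm.comm }
  let y' : U := ⟨y, Algebra.subset_adjoin (Or.inl rfl)⟩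
  let z' : U := ⟨z, Algebra.subset_adjoin (Or.inr rfl)⟩
  have hval : ∀ (a : U) (g : R[X]), ((aeval a g : U) : A) = aeval (a : A) g := fun a g =>
    (aeval_algHom_apply U.val a g).symm
  have hnil : ∀ (a : U) (g : R[X]), IsNilpotent (aeval (a : A) g) → IsNilpotent (aeval a g * 1) := by
    rintro a g ⟨N, hN⟩
    refine ⟨N, Subtype.ext ?_⟩
    rw [mul_one]
    exact (congrArg (· ^ N) (hval a g)).trans hN
  obtain ⟨d, hd⟩ := exists_inverse_of_specIn (P := P) (q := q) IsIdempotentElem.one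
    (hnil y' _ hy) (hnil z' _ hz) 1 1 fun p hp p' hp' => by
      rw [one_mul, one_mul]; exact hu p hp p' hp'
  rw [one_smul, one_smul, mul_one] at hd
  have h1 : (y - z) * (d : A) = 1 := congrArg Subtype.val hd
  have h2 : (d : A) * (y - z) = 1 := congrArg Subtype.val ((mul_comm d (y' - z')).trans hd)
  exact ⟨⟨y - z, d, h1, h2⟩, rfl⟩

lemma IsAffineHecke.map {S S' : Type*} [Ring S] [Algebra R S] [Ring S'] [Algebra R S'] {D : Type*}
    [CommRing D] [Algebra R D] {j : D →ₐ[R] S} {T : ℕ → S} {x : ℕ → D}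
    (h : IsAffineHecke q n j T x) (f : S →ₐ[R] S') :
    IsAffineHecke q n (f.comp j) (fun k => f (T k)) x where
  quad k hk := by
    rw [← map_mul, h.quad k hk, map_add, map_smul, map_smul, map_one]
  braid k hk := by
    rw [← map_mul, ← map_mul, h.braid k hk, map_mul, map_mul]
  far k l hkl hl := (h.far k l hkl hl).map f
  comm k l hk hl h1 h2 := (h.comm k l hk hl h1 h2).map f
  shift k hk := by
    simp only [AlgHom.comp_apply]
    rw [← map_mul, ← map_mul, h.shift k hk, map_smul]

/-- Affine Hecke relations for each color, together with commutation of different colors and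
invertibility of differences, give a colored system. -/
lemma IsColoredHecke.of_isAffineHecke {A : Type*} [Ring A] [Algebra R A] {K : Type*} {m : K → ℕ}
    {D : K → Type*} [∀ α, CommRing (D α)] [∀ α, Algebra R (D α)] {j : ∀ α, D α →ₐ[R] A}
    {T : K → ℕ → A} {x : ∀ α, ℕ → D α} (h : ∀ α, IsAffineHecke q (m α) (j α) (T α) (x α))
    (hTT : ∀ α β, α ≠ β → ∀ k l, Commute (T α k) (T β l))
    (hTx : ∀ α β, α ≠ β → ∀ k l, Commute (T α k) (j β (x β l)))
    (hxx : ∀ α β, α ≠ β → ∀ k l, Commute (j α (x α k)) (j β (x β l)))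
    (hu : ∀ α β, α ≠ β → ∀ k < m α, ∀ l < m β, IsUnit (j β (x β l) - j α (x α k))) :
    IsColoredHecke q m (fun a => T a.1 a.2) fun a => j a.1 (x a.1 a.2) where
  quad a ha := (h a.1).quad a.2 ha
  braid a ha := (h a.1).braid a.2 ha
  far := by
    rintro ⟨α, i⟩ ⟨β, l⟩ hab h1 h2
    obtain rfl : α = β := hab
    exact (h α).far i l h1 h2
  cross a b hab _ _ := hTT _ _ hab _ _
  y_comm := by
    rintro ⟨α, i⟩ ⟨β, l⟩ - -
    by_cases hab : α = β
    · subst hab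
      exact IsAffineHecke.jcomm (j α) _ _
    · exact hxx _ _ hab _ _
  t_y := by
    rintro ⟨α, i⟩ ⟨β, l⟩ h1 h2 h3 h4
    by_cases hab : α = β
    · subst hab
      exact (h α).comm i l h1 h2 (fun e => h3 (by rw [e])) (fun e => h4 (by rw [e]; rfl))
    · exact hTx _ _ hab _ _
  shift a ha := (h a.1).shift a.2 ha
  next_mul a ha := (h a.1).succ_mul ha
  mul_next a ha := (h a.1).mul_succ ha
  isUnit a b hab ha hb := hu _ _ hab _ ha _ hb

/-- The Jucys-Murphy elements and the Hecke generators of the tensor factors form a colored affine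
Hecke system. -/
lemma exists_isColoredHecke (hsep : Separated q Q c n) (hm : ∀ α β, α ≠ β → m α + m β ≤ n) :
    ∃ y : Fin κ × ℕ → TensorAK (q : R) Q c m,
      IsColoredHecke q m (fun a => tensorGen (q : R) Q c m a.1 (a.2 + 1)) y ∧
      (∀ α, 0 < m α → y (α, 0) = tensorGen (q : R) Q c m α 0) ∧
      ∀ a, a.2 < m a.1 → IsNilpotent (aeval (y a) (residuePoly q Q (colorStrip c a.1 a.2))) := by
  choose D iD iA j x hj hD hH h0 using fun α =>
    exists_isAffineHecke q (paramPiece Q c α) (m α)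
  let J : ∀ α, D α →ₐ[R] TensorAK (q : R) Q c m := fun α =>
    (tensorSingle (q : R) Q c m α).comp (j α)
  have hnil : ∀ α i, i < m α →
      IsNilpotent (aeval (J α (x α i)) (residuePoly q Q (colorStrip c α i))) := by
    intro α i hi
    have h1 := (hH α).specIn_jucysMurphy (P := paramPiece Q c α) (hj α) (fun hm0 => by
      refine ⟨1, hj α ?_⟩
      rw [pow_one, mul_one, ← aeval_algHom_apply, h0 α hm0, map_zero, residuePoly, strip,
        Finset.prod_sigma]
      simpa [residue] using gen_cyclotomic hm0) hi
    rw [SpecIn, mul_one, residuePoly_colorStrip] at h1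
    have h2 := h1.map (J α)
    rwa [← aeval_algHom_apply] at h2
  refine ⟨fun a => J a.1 (x a.1 a.2), ?_, fun α hα => congrArg (tensorSingle (q : R) Q c m α) (h0 α hα),
    fun a ha => hnil _ _ ha⟩
  refine IsColoredHecke.of_isAffineHecke
    (T := fun α k => tensorSingle (q : R) Q c m α (gen (q : R) (paramPiece Q c α) (m α) (k + 1)))
    (fun α => (hH α).map (tensorSingle (q : R) Q c m α))
    (fun α β h k l => commute_tensorSingle _ _ _ _ h _ _)
    (fun α β h k l => commute_tensorSingle _ _ _ _ h _ _)
    (fun α β h k l => commute_tensorSingle _ _ _ _ h _ _) fun α β h k hk l hl => ?_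
  refine isUnit_sub_of_nilpotent (commute_tensorSingle _ _ _ _ h.symm _ _) (hnil _ _ hl)
    (hnil _ _ hk) ?_
  have := hm α β h
  exact hsep.isUnit h.symm (by lia)

open Classical in
/-- Projection of functions on words to their value at `w₀`. -/
def projOp (R : Type*) [CommRing R] {A : Type*} [Ring A] [Algebra R A] (w₀ : ContentWord n m) :
    Module.End R (ContentWord n m → A) :=
  diagOp R fun w => if w = w₀ then 1 else 0

open Classical in
lemma projOp_same {A : Type*} [Ring A] [Algebra R A] (w₀ : ContentWord n m)
    (f : ContentWord n m → A) : projOp R w₀ f w₀ = f w₀ := by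
  change (if w₀ = w₀ then (1 : A) else 0) * _ = _
  rw [if_pos rfl, one_mul]

open Classical in
lemma projOp_ne {A : Type*} [Ring A] [Algebra R A] {w w₀ : ContentWord n m} (h : w ≠ w₀)
    (f : ContentWord n m → A) : projOp R w₀ f w = 0 := by
  change (if w = w₀ then (1 : A) else 0) * _ = _
  rw [if_neg h, zero_mul]

variable {D : Type*} [CommRing D] [Algebra R D] {j : D →ₐ[R] ArikiKoike (q : R) Q n} {x : ℕ → D}
  {E : (Fin n → Fin κ) → D} {w : Fin n → Fin κ}

/-- The homomorphism from the tensor product to the corner of a monotone word is injective: in the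
word representation, the image of `a`, applied to a function supported at this word, acts as left
multiplication by `a`. -/
theorem cornerHom_injective
    (h : IsBlockSystem q Q c n j (fun k => gen (q : R) Q n (k + 1)) x E)
    (h0 : 0 < n → j (x 0) = gen (q : R) Q n 0) (hw : IsMonotoneWord m w)
    {ψ : TensorAK (q : R) Q c m →ₙₐ[R] ArikiKoike (q : R) Q n} (h1 : ψ 1 = j (E w))
    (hx : ∀ α, 0 < m α → ψ (tensorGen (q : R) Q c m α 0) = j (x (offset m α)) * j (E w))
    (hT : ∀ α i, i + 1 < m α → ψ (tensorGen (q : R) Q c m α (i + 1))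
      = gen (q : R) Q n (offset m α + i + 1) * j (E w)) : Function.Injective ψ := by
  have hm : ∀ α β, α ≠ β → m α + m β ≤ n := fun α β hαβ => by
    rw [← hw.cnt_eq, ← hw.cnt_eq]
    exact cnt_add_le w le_rfl hαβ
  obtain ⟨y, hy, hy0, hnil⟩ := exists_isColoredHecke h.sep hm
  set t := fun a : Fin κ × ℕ => tensorGen (q : R) Q c m a.1 (a.2 + 1) with ht
  obtain ⟨Φ, hΦ0, hΦT⟩ := exists_wordRep (n := n) (Q := Q) hy fun α hα => by
    rw [hy0 α hα, tensorGen, aeval_algHom_apply]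
    have h2 : (∏ k, (X - C (paramPiece Q c α k))) ∣ ∏ k, (X - C (Q k)) := by
      rw [← residuePoly_colorStrip_zero q]
      have : residuePoly q Q (strip Finset.univ fun _ => 0) = ∏ k, (X - C (Q k)) := by
        rw [residuePoly, strip, Finset.prod_sigma]
        simp [residue]
      rw [← this]
      exact Finset.prod_dvd_prod_of_subset _ _ _ (Finset.sigma_mono (Finset.filter_subset _ _)
        fun _ => le_rfl)
    obtain ⟨g, hg⟩ := h2
    rw [hg, map_mul, gen_cyclotomic hα, zero_mul, map_zero]
  have hΦx : ∀ p, p < n → Φ (j (x p)) = labelOp y p := by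
    intro p hp
    induction p with
    | zero => rw [h0 hp, hΦ0 hp]
    | succ p ih =>
      apply IsAffineHecke.smul_cancel q
      rw [← hy.heckeOp_shift hp, ← map_smul, ← h.shift p hp, map_mul, map_mul, ih (by lia),
        hΦT p hp]
  let w₀ : ContentWord n m := ⟨w, hw.cnt_eq⟩
  have hfix : Φ (j (E w)) * projOp R w₀ = projOp R w₀ := by
    refine h.fix_of_kill h.sep (Φ.comp j) _ w (occ w) (fun p α hα =>
      IsBlockSystem.occ_add_cnt_lt w p hα) fun p => ?_
    obtain ⟨N, hN⟩ := hnil (label w p) (label_valid w₀ p)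
    refine ⟨N, LinearMap.ext fun f => funext fun w' => ?_⟩
    rw [← aeval_algHom_apply, AlgHom.comp_apply, hΦx p p.2, Module.End.mul_apply,
      aeval_labelOp_apply p.2]
    by_cases hw' : w' = w₀
    · subst hw'
      rw [map_pow]
      exact mul_eq_zero_of_left hN _
    · rw [projOp_ne hw', mul_zero]
      rfl
  let L : TensorAK (q : R) Q c m → Module.End R (ContentWord n m → TensorAK (q : R) Q c m) :=
    fun a => diagOp R fun _ => a
  have hL : ∀ a b, L (a * b) = L a * L b := fun a b => (diagOp_mul _ _).symm
  have hLP : ∀ a, L a * projOp R w₀ = projOp R w₀ * L a := by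
    intro a
    refine LinearMap.ext fun f => funext fun w' => ?_
    change a * projOp R w₀ f w' = projOp R w₀ (L a f) w'
    by_cases hw' : w' = w₀
    · subst hw'
      rw [projOp_same, projOp_same]
      rfl
    · rw [projOp_ne hw', projOp_ne hw', mul_zero]
  have key : ∀ a, Φ (ψ a) * projOp R w₀ = L a * projOp R w₀ := by
    let U : Subalgebra R (TensorAK (q : R) Q c m) :=
      { carrier := {a | Φ (ψ a) * projOp R w₀ = L a * projOp R w₀}
        mul_mem' := fun {a b} ha hb => by
          change _ = _ at ha hb ⊢
          rw [map_mul, map_mul, mul_assoc, hb, hLP, ← mul_assoc, ha, mul_assoc, ← hLP, hL,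
            mul_assoc]
        add_mem' := fun {a b} ha hb => by
          change _ = _ at ha hb ⊢
          rw [map_add, map_add, add_mul, ha, hb]
          refine LinearMap.ext fun f => funext fun w' => ?_
          exact (add_mul a b _).symm
        algebraMap_mem' := fun r => by
          change _ = _
          rw [Algebra.algebraMap_eq_smul_one, map_smul, h1, map_smul, smul_mul_assoc, hfix]
          refine LinearMap.ext fun f => funext fun w' => ?_
          change r • projOp R w₀ f w' = (r • 1) * projOp R w₀ f w'
          rw [smul_mul_assoc, one_mul] }
    have hU : U = ⊤ := by
      refine tensor_subalgebra_eq_top U fun α a => ?_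
      suffices h2 : U.comap (tensorSingle (q : R) Q c m α) = ⊤ from
        (h2 ▸ Algebra.mem_top : a ∈ U.comap (tensorSingle (q : R) Q c m α))
      refine ArikiKoike.eq_top_of_gen_mem _ fun i hi => ?_
      have hn : offset m α + i < n := (Nat.add_lt_add_left hi _).trans_le (hw.offset_add_le α)
      change Φ (ψ (tensorGen (q : R) Q c m α i)) * projOp R w₀
        = L (tensorGen (q : R) Q c m α i) * projOp R w₀
      have hlab : ∀ i (hi : i < m α) (hn : offset m α + i < n),
          label w ⟨offset m α + i, hn⟩ = (α, i) := fun i hi hn =>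
        Prod.ext (hw.apply_offset hi hn) (hw.occ_offset hi hn)
      rcases i with _ | i
      · rw [hx α hi, map_mul, mul_assoc, hfix, hΦx (offset m α) hn]
        refine LinearMap.ext fun f => funext fun w' => ?_
        change labelOp (R := R) y (offset m α) (projOp R w₀ f) w'
          = tensorGen (q : R) Q c m α 0 * projOp R w₀ f w'
        by_cases hw' : w' = w₀
        · subst hw'
          rw [labelOp_apply (p := offset m α) (w := w₀) hn (hlab 0 hi hn), hy0 α hi]
        · rw [labelOp_apply (p := offset m α) hn rfl, projOp_ne hw', mul_zero, mul_zero]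
      · rw [hT α i hi, map_mul, mul_assoc, hfix, hΦT (offset m α + i) hn]
        refine LinearMap.ext fun f => funext fun w' => ?_
        change heckeOp (R := R) q t y (offset m α + i) (projOp R w₀ f) w'
          = tensorGen (q : R) Q c m α (i + 1) * projOp R w₀ f w'
        have e1 := hlab i (by lia) (by lia)
        have e2 := hlab (i + 1) hi hn
        by_cases hw' : w' = w₀
        · subst hw'
          rw [heckeOp_eq (k := offset m α + i) (w := w₀) hn e1 e2 rfl]
        · rw [projOp_ne hw', mul_zero]
          by_cases hl : (label w'.1 ⟨offset m α + i, by lia⟩).1 = (label w'.1 ⟨_, hn⟩).1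
          · rw [heckeOp_eq (k := offset m α + i) hn rfl rfl hl, projOp_ne hw', mul_zero]
          · rw [heckeOp_ne (k := offset m α + i) hn rfl rfl hl, projOp_ne hw', projOp_ne,
              mul_zero, mul_zero, add_zero]
            intro hs
            -- exchanging two equal letters of `w₀` does not change it, so `w'` would equal `w₀`
            apply hl
            have h3 := congrArg Subtype.val hs
            have h4 := swapWord_left (k := offset m α + i) hn w'.1
            have h5 := swapWord_right (k := offset m α + i) hn w'.1
            have h6 : swapWord (offset m α + i) w'.1 = w := h3
            rw [h6] at h4 h5
            exact (h5.symm.trans ((congrArg Prod.fst e2).trans (congrArg Prod.fst e1).symm)).trans h4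
    intro a
    exact (hU ▸ Algebra.mem_top : a ∈ U)
  rw [injective_iff_map_eq_zero]
  intro a ha
  have h2 := key a
  rw [ha, map_zero, zero_mul] at h2
  have h3 := congrFun (LinearMap.congr_fun h2 fun _ => 1) w₀
  change 0 = a * projOp R w₀ (fun _ => 1) w₀ at h3
  rw [projOp_same, mul_one] at h3
  exact h3.symm

end Faithful

/-! ### Morita equivalence -/

section Final

open Polynomial ArikiKoike

variable {R : Type u} [CommRing R] {q : Rˣ} {n r κ : ℕ} {Q : Fin r → R} {c : Fin r → Fin κ}

/-- The difference of the residues `q^a Q_i` and `q^b Q_j` is `q^b (q^(a - b) Q_i - Q_j)`, where the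
last factor divides `partitionPoly`. -/
lemma separated_of_isUnit_partitionPoly (hf : IsUnit (partitionPoly q Q c n)) :
    Separated q Q c n := by
  have key : ∀ (i i' : Fin r) (a : ℤ), c i < c i' → |a| < n →
      IsUnit (((q ^ a : Rˣ) : R) * Q i - Q i') := by
    intro i i' a hlt ha
    refine isUnit_of_dvd_unit ?_ hf
    rw [abs_lt] at ha
    have h1 := Finset.dvd_prod_of_mem (fun a : ℤ => ((q ^ a : Rˣ) : R) * Q i - Q i')
      (Finset.mem_Ioo.2 ha)
    have h2 := Finset.dvd_prod_of_mem (fun l : {l : Fin r // c l = c i'} =>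
      ∏ a ∈ Finset.Ioo (-(n : ℤ)) (n : ℤ), (((q ^ a : Rˣ) : R) * Q i - paramPiece Q c (c i') l))
      (Finset.mem_univ ⟨i', rfl⟩)
    have h3 := Finset.dvd_prod_of_mem (fun k : {k : Fin r // c k = c i} =>
      ∏ l : {l : Fin r // c l = c i'}, ∏ a ∈ Finset.Ioo (-(n : ℤ)) (n : ℤ),
        (((q ^ a : Rˣ) : R) * paramPiece Q c (c i) k - paramPiece Q c (c i') l))
      (Finset.mem_univ ⟨i, rfl⟩)
    have h4 := Finset.dvd_prod_of_mem (s := Finset.univ.filter fun p : Fin κ × Fin κ => p.1 < p.2)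
      (fun p : Fin κ × Fin κ =>
      ∏ k : {k : Fin r // c k = p.1}, ∏ l : {l : Fin r // c l = p.2},
        ∏ a ∈ Finset.Ioo (-(n : ℤ)) (n : ℤ),
        (((q ^ a : Rˣ) : R) * paramPiece Q c p.1 k - paramPiece Q c p.2 l))
      (Finset.mem_filter.2 ⟨Finset.mem_univ (c i, c i'), hlt⟩)
    exact h1.trans (h2.trans (h3.trans h4))
  have key' : ∀ (i i' : Fin r) (a b : ℤ), c i < c i' → |a| + |b| < n →
      IsUnit (residue q Q ⟨i, a⟩ - residue q Q ⟨i', b⟩) := by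
    intro i i' a b hlt hab
    have h1 := key i i' (a - b) hlt ((abs_sub a b).trans_lt hab)
    have h2 : residue q Q ⟨i, a⟩ - residue q Q ⟨i', b⟩
        = ((q ^ b : Rˣ) : R) * (((q ^ (a - b) : Rˣ) : R) * Q i - Q i') := by
      rw [mul_sub, ← mul_assoc, ← Units.val_mul, ← zpow_add, add_sub_cancel]
      rfl
    rw [h2]
    exact (q ^ b).isUnit.mul h1
  intro i i' a b hne hab
  rcases lt_or_gt_of_ne hne with hlt | hlt
  · exact key' i i' a b hlt hab
  · rw [← neg_sub]
    exact (key' i' i b a hlt (by rwa [add_comm])).neg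

/-- The Ariki-Koike algebra carries a system of block idempotents. -/
lemma ArikiKoike.exists_isBlockSystem (hsep : Separated q Q c n) :
    ∃ (D : Type u) (_ : CommRing D) (_ : Algebra R D) (j : D →ₐ[R] ArikiKoike (q : R) Q n)
      (x : ℕ → D) (E : (Fin n → Fin κ) → D),
      IsBlockSystem q Q c n j (fun k => gen (q : R) Q n (k + 1)) x E ∧
      Algebra.adjoin R {a | ∃ l < n, a = x l} = ⊤ ∧ (0 < n → j (x 0) = gen (q : R) Q n 0) ∧
      (0 < n → aeval (x 0) (residuePoly q Q (strip Finset.univ fun _ => 0)) = 0) := by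
  obtain ⟨D, _, _, j, x, hj, hD, hH, h0⟩ := exists_isAffineHecke q Q n
  have hcyc : 0 < n → aeval (x 0) (residuePoly q Q (strip Finset.univ fun _ => 0)) = 0 := by
    intro hn
    apply hj
    rw [← aeval_algHom_apply, h0 hn, map_zero, residuePoly, strip, Finset.prod_sigma]
    simpa [residue] using gen_cyclotomic hn
  obtain ⟨E, hE, -⟩ := exists_isWordIdempotents_of_le (c := c) hH hj (fun hn =>
    ⟨1, by rw [pow_one, hcyc hn, zero_mul]⟩) hsep n le_rfl
  exact ⟨D, inferInstance, inferInstance, j, x, E, ⟨hH, hE, hj, hsep⟩, hD, h0, hcyc⟩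

end Final
end

theorem theorem1p1 {R : Type u} [CommRing R] (q : Rˣ) (n r κ : ℕ) (Q : Fin r → R)
    (c : Fin r → Fin κ) (hf : IsUnit (partitionPoly q Q c n)) :
    IsMoritaEquivalent R (ArikiKoike (q : R) Q n) (PartitionedArikiKoike (q : R) Q c n) := by
  obtain ⟨D, _, _, j, x, E, h, hD, hx0, hcyc⟩ :=
    ArikiKoike.exists_isBlockSystem (separated_of_isUnit_partitionPoly hf)
  have hS : ∀ A : Subalgebra R (ArikiKoike (q : R) Q n), (∀ d, j d ∈ A) →
      (∀ k, k + 1 < n → ArikiKoike.gen (q : R) Q n (k + 1) ∈ A) → A = ⊤ := fun A h1 h2 =>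
    ArikiKoike.eq_top_of_gen_mem A fun i hi => by
      rcases i with _ | i
      · rw [← hx0 hi]; exact h1 _
      · exact h2 i hi
  have hfin : Finite {m : Fin κ → ℕ // ∑ α, m α = n} := by
    refine Finite.of_injective (fun m α => (⟨m.1 α, ?_⟩ : Fin (n + 1))) fun m m' hm => ?_
    · have := Finset.single_le_sum (f := m.1) (fun _ _ => Nat.zero_le _) (Finset.mem_univ α)
      have := m.2
      lia
    · exact Subtype.ext (funext fun α => congrArg Fin.val (congrFun hm α))
  have := Fintype.ofFinite {m : Fin κ → ℕ // ∑ α, m α = n}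
  choose w hw using fun m : {m : Fin κ → ℕ // ∑ α, m α = n} => exists_isMonotoneWord m.2
  choose ψ hψ1 hψx hψT using fun m => exists_cornerHom h hcyc (hw m)
  have hinj := fun m => cornerHom_injective h hx0 (hw m) (hψ1 m) (hψx m) (hψT m)
  have hB := fun m => isCornerAlgebra_range h (hw m) (hψ1 m) (hψx m) (hψT m)
  have hwne : ∀ m m', m ≠ m' → w m ≠ w m' := fun m m' hne he => hne <| Subtype.ext <| funext
    fun α => by rw [← (hw m).cnt_eq, ← (hw m').cnt_eq, he]
  have hl : ∀ m a, j (E (w m)) * ψ m a = ψ m a := fun m a => by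
    rw [← hψ1, ← map_mul, one_mul]
  have hr : ∀ m a, ψ m a * j (E (w m)) = ψ m a := fun m a => by
    rw [← hψ1, ← map_mul, mul_one]
  have horth : ∀ m m', m ≠ m' → ∀ a, j (E (w m)) * ψ m' a = 0 := fun m m' hne a => by
    rw [← hl, ← mul_assoc, h.jE_ortho (hwne m m' hne), zero_mul]
  have hproj : ∀ m (a : PartitionedArikiKoike (q : R) Q c n),
      j (E (w m)) * ∑ m', ψ m' (a m') = ψ m (a m) := fun m a => by
    rw [Finset.mul_sum, Finset.sum_eq_single m (fun m' _ hne => horth m m' hne.symm _)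
      (fun h => (h (Finset.mem_univ _)).elim), hl]
  let Ψ : PartitionedArikiKoike (q : R) Q c n →ₙₐ[R] ArikiKoike (q : R) Q n :=
    { toFun := fun a => ∑ m, ψ m (a m)
      map_smul' := fun s a => by
        simp only [Pi.smul_apply, map_smul, Finset.smul_sum]
        rfl
      map_zero' := Finset.sum_eq_zero fun m _ => map_zero _
      map_add' := fun a b => by
        rw [← Finset.sum_add_distrib]
        exact Finset.sum_congr rfl fun m _ => map_add _ _ _
      map_mul' := fun a b => by
        rw [Finset.sum_mul]
        refine Finset.sum_congr rfl fun m _ => ?_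
        rw [← hr m (a m), mul_assoc, hproj]
        exact map_mul _ _ _ }
  have hΨ : ∀ a, Ψ a = ∑ m, ψ m (a m) := fun a => rfl
  have hΨ1 : Ψ 1 = ∑ m, j (E (w m)) := Finset.sum_congr rfl fun m _ => hψ1 m
  refine isMoritaEquivalent_of_full_corner Ψ ?_ (fun s => ?_) (ι := Fin n → Fin κ)
    (fun v => sorter j (fun k => ArikiKoike.gen (q : R) Q n (k + 1)) x E v)
    (fun v => (h.exists_sorter_mul v).choose) ?_
  -- multiplication by `E (w m)` singles out the component of content `m`
  · rw [injective_iff_map_eq_zero]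
    intro a ha
    funext m
    apply hinj m
    rw [← hproj m a, ← hΨ, ha, mul_zero, Pi.zero_apply, map_zero]
  -- the corner of `Ψ 1` is the sum of the corners of the `E (w m)`, by orthogonality
  · have h1 : ∀ m, ∃ b, ψ m b = j (E (w m)) * (s * j (E (w m))) := fun m =>
      ((hB m).corner_mem h hD hS (hw m).mono (hw m).mono s).1 rfl
    choose b hb using h1
    refine ⟨b, ?_⟩
    rw [hΨ1, hΨ, Finset.sum_mul, Finset.sum_mul]
    refine Finset.sum_congr rfl fun m _ => ?_
    rw [hb, mul_assoc, Finset.mul_sum, Finset.mul_sum, Finset.sum_eq_single m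
      (fun m' _ hne => ((hB m').corner_mem h hD hS (hw m').mono (hw m).mono s).2
        (hwne m m' hne.symm)) (fun h => (h (Finset.mem_univ _)).elim)]
  -- each `E v` is the product of its sorting element, which is fixed by `Ψ 1`, and an inverse of it
  · have h1 : ∀ v, sorter j (fun k => ArikiKoike.gen (q : R) Q n (k + 1)) x E v * Ψ 1
        = sorter j (fun k => ArikiKoike.gen (q : R) Q n (k + 1)) x E v := by
      intro v
      let m : {m : Fin κ → ℕ // ∑ α, m α = n} :=
        ⟨fun α => cnt (sortWord v) n α, sum_cnt (sortWord v) le_rfl⟩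
      have h2 : sortWord v = w m :=
        IsMonotoneWord.unique (m := m.1) ⟨monotone_sortWord v, fun α => rfl⟩ (hw m)
      rw [← h.sorter_mul_jE, mul_assoc, h2, hΨ, hproj m 1]
      exact congrArg _ (hψ1 m)
    calc _ = ∑ v, j (E v) := Finset.sum_congr rfl fun v _ => by
          rw [h1, (h.exists_sorter_mul v).choose_spec]
      _ = 1 := by rw [← map_sum, h.sum, map_one]
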